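/- Let $A, B \in \mathrm{GL}(d,\mathbb{R})$ be expansive matrices, i.e. all their complex eigenvalues satisfy $|\lambda|>1$, and write $A^*$ for the transpose of $A$. A homogeneous quasi-norm associated to an expansive matrix $A$ is a measurable function $\rho_A:\mathbb{R}^d\to[0,\infty)$ such that $\rho_A(x)=0$ iff $x=0$, $\rho_A(Ax)=|\det A|\,\rho_A(x)$ for all $x$, and $\rho_A(x+y)\le C(\rho_A(x)+\rho_A(y))$ for all $x,y$ and some $C>0$. Any two homogeneous quasi-norms associated to the same matrix are comparable up to a multiplicative constant. Two expansive matrices $A,B$ are *coarsely equivalent* if for associated homogeneous quasi-norms $\rho_A,\rho_B$ (the choice does not matter) there are $C>0$ and $R\ge 0$ with $\frac1C\rho_A(x)-R\le\rho_B(x)\le C\rho_A(x)+R$ for all $x\in\mathbb{R}^d$. With $\widehat f(\xi)=\int_{\mathbb{R}^d} f(x)e^{-2\pi i x\cdot\xi}\,dx$, an *$A$-analyzing pair* is a pair $(\varphi,\Phi)$ of Schwartz functions on $\mathbb{R}^d$ such that the closed support of $\widehat\varphi$ is contained in $(-\frac12,\frac12)^d\setminus\{0\}$, the closed support of $\widehat\Phi$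 is contained in $(-\frac12,\frac12)^d$, and $\sup_{i\ge1}\max\{|\widehat\varphi((A^*)^{-i}\xi)|,|\widehat\Phi(\xi)|\}>0$ for all $\xi\in\mathbb{R}^d$. For $\alpha\in\mathbb{R}$, $p\in(0,\infty)$ and $q\in(0,\infty]$, the inhomogeneous anisotropic Triebel–Lizorkin space $\mathbf{F}^{\alpha}_{p,q}(A)=\mathbf{F}^{\alpha}_{p,q}(A;\varphi,\Phi)$ is the set of all tempered distributions $f$ on $\mathbb{R}^d$ with $$\Big\|\Big(\sum_{i=0}^\infty\big(|\det A|^{\alpha i}\,|f*\varphi^A_i|\big)^q\Big)^{1/q}\Big\|_{L^p}<\infty,\qquad \varphi^A_0:=\Phi,\quad \varphi^A_i:=|\det A|^i\varphi(A^i\,\cdot)\ \ (i\ge1),$$ with a supremum over $i$ in place of the sum if $q=\infty$. **Theorem.** Let $(\varphi,\Phi)$ be any $A$-analyzing pair and $(\psi,\Psi)$ any $B$-analyzing pair, let $p\in(0,\infty)$, and for $q\in(0,\infty]$ write $\mathbf{F}^{0}_{p,q}(A)=\mathbf{F}^{0}_{p,q}(A;\varphi,\Phi)$ and $\mathbf{F}^{0}_{p,q}(B)=\mathbf{F}^{0}_{p,q}(B;\psi,\Psi)$.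 1. If $q\in(0,\infty]$, $\mathbf{F}^{0}_{p,q}(A)=\mathbf{F}^{0}_{p,q}(B)$, and $A^*$ and $B^*$ are not coarsely equivalent, then $q=2$. 2. Consequently, if $\mathbf{F}^{0}_{p,q}(A)=\mathbf{F}^{0}_{p,q}(B)$ for some $q\in(0,\infty]$ with $q\neq2$, then $A^*$ and $B^*$ are coarsely equivalent. -/

import Mathlib

open MeasureTheory SchwartzMap FourierTransform
open scoped ENNReal MatrixGroups

noncomputable section

namespace AnisoTL

/-- Euclidean space `ℝ^d`. -/
abbrev E (d : ℕ) : Type := EuclideanSpace ℝ (Fin d)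

/-- The linear map `x ↦ M x` on `ℝ^d` given by a square matrix `M`. -/
def act {d : ℕ} (M : Matrix (Fin d) (Fin d) ℝ) : E d →L[ℝ] E d :=
  Matrix.toEuclideanCLM (n := Fin d) (𝕜 := ℝ) M

/-- The linear automorphism `x ↦ A x` of `ℝ^d` given by an invertible matrix `A`. -/
def actEquiv {d : ℕ} (A : GL (Fin d) ℝ) : E d ≃L[ℝ] E d :=
  ContinuousLinearEquiv.unitsEquiv ℝ (E d)
    (Units.map (Matrix.toEuclideanCLM (n := Fin d) (𝕜 := ℝ) :
      Matrix (Fin d) (Fin d) ℝ →* (E d →L[ℝ] E d)) A)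

theorem actEquiv_apply {d : ℕ} (A : GL (Fin d) ℝ) (x : E d) :
    actEquiv A x = act (A : Matrix (Fin d) (Fin d) ℝ) x := rfl

/-- A real matrix is expansive if all its complex eigenvalues satisfy `|λ| > 1`. -/
def IsExpansive {d : ℕ} (A : Matrix (Fin d) (Fin d) ℝ) : Prop :=
  ∀ z ∈ spectrum ℂ (A.map (algebraMap ℝ ℂ)), 1 < ‖z‖

/-! ### Homogeneous quasi-norms and coarse equivalence -/

/-- `ρ : ℝ^d → [0, ∞)` is a homogeneous quasi-norm associated to the matrix `A`. -/
structure IsHomogeneousQuasiNorm {d : ℕ} (A : Matrix (Fin d) (Fin d) ℝ) (ρ : E d → ℝ) :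
    Prop where
  measurable : Measurable ρ
  nonneg : ∀ x, 0 ≤ ρ x
  eq_zero_iff : ∀ x, ρ x = 0 ↔ x = 0
  dilation : ∀ x, ρ (act A x) = |A.det| * ρ x
  quasi_triangle : ∃ C : ℝ, 0 < C ∧ ∀ x y, ρ (x + y) ≤ C * (ρ x + ρ y)

/-- Two functions on `ℝ^d` are comparable up to multiplicative and additive constants. -/
def CoarselyEquivalentFun {d : ℕ} (ρ ρ' : E d → ℝ) : Prop :=
  ∃ C R : ℝ, 0 < C ∧ 0 ≤ R ∧ ∀ x, 1 / C * ρ x - R ≤ ρ' x ∧ ρ' x ≤ C * ρ x + R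

/-- Two expansive matrices are coarsely equivalent if their associated homogeneous quasi-norms
are. Since any two homogeneous quasi-norms associated to one expansive matrix are equivalent
(comparable up to a multiplicative constant), the choice of the quasi-norms is immaterial. -/
def CoarselyEquivalent {d : ℕ} (A B : Matrix (Fin d) (Fin d) ℝ) : Prop :=
  ∃ ρA ρB : E d → ℝ, IsHomogeneousQuasiNorm A ρA ∧ IsHomogeneousQuasiNorm B ρB ∧
    CoarselyEquivalentFun ρA ρB

/-! ### Inhomogeneous anisotropic Triebel-Lizorkin spaces -/

/-- The open cube `(-1/2, 1/2)^d`. -/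
def openCube (d : ℕ) : Set (E d) := {ξ | ∀ k, -(1 / 2 : ℝ) < ξ k ∧ ξ k < 1 / 2}

/-- `(φ, Φ)` is an `A`-analyzing pair. The supremum over `i ≥ 1` is taken in `[0, ∞]`, the index
being shifted by one. The Fourier transform is `∫ f(x) exp(-2πi x·ξ) dx`. -/
structure IsAnalyzingPair {d : ℕ} (A : GL (Fin d) ℝ) (φ Φ : 𝓢(E d, ℂ)) : Prop where
  tsupport_fourier : tsupport (𝓕 φ : 𝓢(E d, ℂ)) ⊆ openCube d \ {0}
  tsupport_fourier_zero : tsupport (𝓕 Φ : 𝓢(E d, ℂ)) ⊆ openCube d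
  nonvanishing : ∀ ξ : E d,
    0 < ⨆ i : ℕ, max
      ‖(𝓕 φ : 𝓢(E d, ℂ)) (act ((A : Matrix (Fin d) (Fin d) ℝ).transpose ^ (-((i : ℤ) + 1))) ξ)‖ₑ
      ‖(𝓕 Φ : 𝓢(E d, ℂ)) ξ‖ₑ

/-- The family `φ_0 = Φ` and `φ_i = |det A|^i φ(A^i ·)` for `i ≥ 1`. -/
def dilates {d : ℕ} (A : GL (Fin d) ℝ) (φ Φ : 𝓢(E d, ℂ)) : ℕ → 𝓢(E d, ℂ)
  | 0 => Φ
  | i + 1 => (((|(A : Matrix (Fin d) (Fin d) ℝ).det| ^ (i + 1) : ℝ)) : ℂ) •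
      compCLMOfContinuousLinearEquiv ℂ (actEquiv (A ^ (i + 1))) φ

theorem dilates_succ_apply {d : ℕ} (A : GL (Fin d) ℝ) (φ Φ : 𝓢(E d, ℂ)) (i : ℕ) (x : E d) :
    dilates A φ Φ (i + 1) x =
      ((|(A : Matrix (Fin d) (Fin d) ℝ).det| ^ (i + 1) : ℝ) : ℂ) *
        φ (act ((A : Matrix (Fin d) (Fin d) ℝ) ^ (i + 1)) x) := rfl

/-- The Schwartz function `y ↦ φ (x - y)`. -/
def reflectTranslate {d : ℕ} (φ : 𝓢(E d, ℂ)) (x : E d) : 𝓢(E d, ℂ) :=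
  compSubConstCLM ℂ x (compCLMOfContinuousLinearEquiv ℂ (ContinuousLinearEquiv.neg ℝ) φ)

theorem reflectTranslate_apply {d : ℕ} (φ : 𝓢(E d, ℂ)) (x y : E d) :
    reflectTranslate φ x y = φ (x - y) := by
  change φ (-(y - x)) = φ (x - y)
  rw [neg_sub]

/-- The convolution `f ∗ φ` of a tempered distribution with a Schwartz function, as a function:
`(f ∗ φ)(x) = ⟨f, φ(x - ·)⟩` with the bilinear pairing. -/
def conv {d : ℕ} (f : 𝓢'(E d, ℂ)) (φ : 𝓢(E d, ℂ)) (x : E d) : ℂ :=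
  f (reflectTranslate φ x)

/-- The `ℓ^q` (quasi-)norm of a sequence in `[0, ∞]`, for `q ∈ (0, ∞]`. -/
def ellNorm (q : ℝ≥0∞) (a : ℕ → ℝ≥0∞) : ℝ≥0∞ :=
  if q = ∞ then ⨆ i, a i else (∑' i, a i ^ q.toReal) ^ (1 / q.toReal)

/-- The (quasi-)norm of the inhomogeneous anisotropic Triebel-Lizorkin space, for `α ∈ ℝ`,
`p ∈ (0, ∞)` and `q ∈ (0, ∞]`, with values in `[0, ∞]`. -/
def tlNorm {d : ℕ} (A : GL (Fin d) ℝ) (φ Φ : 𝓢(E d, ℂ)) (α p : ℝ) (q : ℝ≥0∞)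
    (f : 𝓢'(E d, ℂ)) : ℝ≥0∞ :=
  (∫⁻ x : E d,
    ellNorm q (fun i : ℕ =>
      ENNReal.ofReal (|(A : Matrix (Fin d) (Fin d) ℝ).det| ^ (α * (i : ℝ))) *
        ‖conv f (dilates A φ Φ i) x‖ₑ) ^ p) ^ (1 / p)

/-- The inhomogeneous anisotropic Triebel-Lizorkin space, computed with the pair `(φ, Φ)`. -/
def tlSpace {d : ℕ} (A : GL (Fin d) ℝ) (φ Φ : 𝓢(E d, ℂ)) (α p : ℝ) (q : ℝ≥0∞) :
    Set 𝓢'(E d, ℂ) :=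
  {f | tlNorm A φ Φ α p q f < ∞}

end AnisoTL

end

/-! The argument is by contraposition: if `A*` and `B*` are not coarsely equivalent and `q ≠ 2`,
then some bounded continuous function lies in exactly one of the two spaces.

Geometry. An expansive map admits a norm contracted by its inverse (`exists_isAdapted`), hence
levels and shells in frequency space. Suppose the levels of each map vary by a bounded amount on
every shell of the other. Then each level is almost monotone in the other
(`Narrow.exists_level_mono`), and comparing the volumes of sublevel sets compares the quantities
`|det| ^ level` (`Narrow.exists_pow_le`), which gives coarse equivalence. Otherwise the shells of
one map, say `A*`, meet arbitrarily distant levels of `B*`. In dimension at least two shells are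
connected, so one shell contains any prescribed number `N` of frequencies on well-separated levels
of `B*` (`exists_separatedFrequencies`). In dimension at most one all matrices are coarsely
equivalent.

Analysis. Each of these frequencies carries a wave packet, so wide that convolution with a kernel
amounts to multiplication by the Fourier transform of the kernel at that frequency. Take signed sums
of the `N` packets. For `A` only boundedly many indices are active and one of them sees all packets,
so by Khintchine's inequality suitable signs give a norm at most, and other signs at least, a
constant times `√N`. For `B` different packets are seen by different indices, so the norm is
comparable to `N ^ (1 / q)` whatever the signs. As `1 / q ≠ 1 / 2`, the ratio of the two norms is
unbounded in one direction (`hasHumps_or`).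

Gliding hump. Such blocks can be placed at arbitrarily high indices with arbitrarily small sup norm.
Summing blocks with disjoint index windows gives one function with finite norm for one matrix and
infinite norm for the other (`HasHumps.exists_function`). Continuity of an inclusion between the
spaces is never used, and exponents below `1` need no separate treatment. -/

noncomputable section

namespace AnisoTL

/-! ### Averages over signs -/

/-- The sign `±1` attached to a Boolean. -/
def sgn (b : Bool) : ℝ := if b then 1 else -1

theorem abs_sgn (b : Bool) : |sgn b| = 1 := by cases b <;> simp [sgn]

theorem norm_sgn (b : Bool) : ‖(sgn b : ℂ)‖ = 1 := by
  rw [Complex.norm_real, Real.norm_eq_abs, abs_sgn]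

/-- The signed sum `∑ ε_k b_k`. -/
def signSum {N : ℕ} (ε : Fin N → Bool) (b : Fin N → ℂ) : ℂ := ∑ k, (sgn (ε k) : ℂ) * b k

theorem sum_exp_sign {N : ℕ} (b : Fin N → ℝ) :
    ∑ ε : Fin N → Bool, Real.exp (∑ k, sgn (ε k) * b k) = 2 ^ N * ∏ k, Real.cosh (b k) := by
  have h := Finset.prod_univ_sum (fun _ : Fin N => (Finset.univ : Finset Bool))
    (fun k s => Real.exp (sgn s * b k))
  rw [Fintype.piFinset_univ] at h
  simp_rw [Real.exp_sum, ← h, Fintype.sum_bool, sgn, Real.cosh_eq]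
  rw [Finset.prod_div_distrib]
  simp
  field_simp

/-- Sub-Gaussian exponential moment: the sum over signs factorizes, and `cosh t ≤ exp (t ^ 2 / 2)`.
-/
theorem sum_exp_sign_le {N : ℕ} (b : Fin N → ℝ) (hb : ∑ k, b k ^ 2 ≤ 1) :
    ∑ ε : Fin N → Bool, Real.exp (∑ k, sgn (ε k) * b k) ≤ 2 ^ N * Real.exp 1 := by
  rw [sum_exp_sign]
  gcongr
  calc ∏ k, Real.cosh (b k) ≤ ∏ k, Real.exp (b k ^ 2 / 2) :=
        Finset.prod_le_prod (fun k _ => (Real.cosh_pos _).le) fun k _ => Real.cosh_le_exp_half_sq _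
    _ = Real.exp (∑ k, b k ^ 2 / 2) := (Real.exp_sum _ _).symm
    _ ≤ Real.exp 1 := by
        rw [← Finset.sum_div]
        exact Real.exp_le_exp.2 (by linarith)

theorem exists_rpow_le_exp (p : ℝ) (hp : 0 < p) :
    ∃ C : ℝ, 0 < C ∧ ∀ s : ℝ, 0 ≤ s → s ^ p ≤ C * Real.exp s := by
  refine ⟨1 + (⌈p⌉₊.factorial : ℝ), by positivity, fun s hs => ?_⟩
  have h1 : 1 ≤ Real.exp s := Real.one_le_exp hs
  have h2 := Real.pow_div_factorial_le_exp s hs ⌈p⌉₊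
  rw [div_le_iff₀ (by positivity)] at h2
  rcases le_total s 1 with h | h
  · have : s ^ p ≤ 1 := Real.rpow_le_one hs h hp.le
    nlinarith [(Nat.cast_pos (α := ℝ)).2 (Nat.factorial_pos ⌈p⌉₊)]
  · have : s ^ p ≤ s ^ ⌈p⌉₊ := by
      rw [← Real.rpow_natCast]
      exact Real.rpow_le_rpow_of_exponent_le h (Nat.le_ceil p)
    nlinarith

theorem signSum_re {N : ℕ} (ε : Fin N → Bool) (b : Fin N → ℂ) :
    (signSum ε b).re = ∑ k, sgn (ε k) * (b k).re := by
  simp [signSum]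

theorem signSum_im {N : ℕ} (ε : Fin N → Bool) (b : Fin N → ℂ) :
    (signSum ε b).im = ∑ k, sgn (ε k) * (b k).im := by
  simp [signSum]

theorem signSum_smul {N : ℕ} (ε : Fin N → Bool) (b : Fin N → ℂ) (c : ℂ) :
    signSum ε (fun k => c * b k) = c * signSum ε b := by
  simp only [signSum, Finset.mul_sum]
  exact Finset.sum_congr rfl fun k _ => by ring

theorem norm_signSum_le {N : ℕ} (ε : Fin N → Bool) (b : Fin N → ℂ) :
    ‖signSum ε b‖ ≤ ∑ k, ‖b k‖ := by
  refine (norm_sum_le _ _).trans (Finset.sum_le_sum fun k _ => ?_)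
  rw [norm_mul, norm_sgn, one_mul]

theorem sum_abs_rpow_sign_le (p : ℝ) (C : ℝ)
    (hC0 : 0 < C) (hC : ∀ s : ℝ, 0 ≤ s → s ^ p ≤ C * Real.exp s)
    {N : ℕ} (b : Fin N → ℝ) (hb : ∑ k, b k ^ 2 ≤ 1) :
    ∑ ε : Fin N → Bool, |∑ k, sgn (ε k) * b k| ^ p ≤ 2 ^ N * (2 * C * Real.exp 1) := by
  have h1 := sum_exp_sign_le b hb
  have h2 := sum_exp_sign_le (fun k => - b k) (by simpa using hb)
  calc ∑ ε : Fin N → Bool, |∑ k, sgn (ε k) * b k| ^ p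
      ≤ ∑ ε : Fin N → Bool, C * (Real.exp (∑ k, sgn (ε k) * b k) +
          Real.exp (∑ k, sgn (ε k) * - b k)) := by
        refine Finset.sum_le_sum fun ε _ => (hC _ (abs_nonneg _)).trans ?_
        refine mul_le_mul_of_nonneg_left ?_ hC0.le
        simp only [mul_neg, Finset.sum_neg_distrib]
        exact Real.exp_abs_le _
    _ ≤ _ := by
        rw [← Finset.mul_sum, Finset.sum_add_distrib]
        nlinarith

/-- Powers are dominated by exponentials, so the exponential moment controls every moment; real and
imaginary parts are treated separately, and homogeneity reduces to `M = 1`. Since `M` need only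
bound the `ℓ²` norm, a pointwise envelope can take its place. -/
theorem khintchine_upper (p : ℝ) (hp : 0 < p) :
    ∃ C : ℝ, 0 < C ∧ ∀ (N : ℕ) (b : Fin N → ℂ) (M : ℝ), 0 ≤ M → ∑ k, ‖b k‖ ^ 2 ≤ M ^ 2 →
      ∑ ε : Fin N → Bool, ‖signSum ε b‖ ^ p ≤ 2 ^ N * (C * M ^ p) := by
  obtain ⟨C, hC0, hC⟩ := exists_rpow_le_exp p hp
  refine ⟨2 ^ p * (4 * C * Real.exp 1), by positivity, fun N b M hM hb => ?_⟩
  rcases hM.eq_or_lt with rfl | hM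
  · have hb0 : ∀ k, b k = 0 := fun k => by
      have := Finset.single_le_sum (f := fun k => ‖b k‖ ^ 2) (fun _ _ => by positivity)
        (Finset.mem_univ k)
      have h3 : ‖b k‖ ^ 2 ≤ 0 := by nlinarith
      simpa using pow_eq_zero_iff two_ne_zero |>.1 (le_antisymm h3 (by positivity))
    simp [signSum, hb0, Real.zero_rpow hp.ne']
  have key : ∀ b : Fin N → ℂ, ∑ k, ‖b k‖ ^ 2 ≤ 1 →
      ∑ ε : Fin N → Bool, ‖signSum ε b‖ ^ p ≤ 2 ^ N * (2 ^ p * (4 * C * Real.exp 1)) := by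
    intro b hb
    have hre : ∑ k, (b k).re ^ 2 ≤ 1 := (Finset.sum_le_sum fun k _ => by
      rw [← sq_abs]; gcongr; exact Complex.abs_re_le_norm _).trans hb
    have him : ∑ k, (b k).im ^ 2 ≤ 1 := (Finset.sum_le_sum fun k _ => by
      rw [← sq_abs]; gcongr; exact Complex.abs_im_le_norm _).trans hb
    have h1 := sum_abs_rpow_sign_le p C hC0 hC _ hre
    have h2 := sum_abs_rpow_sign_le p C hC0 hC _ him
    calc ∑ ε : Fin N → Bool, ‖signSum ε b‖ ^ p
        ≤ ∑ ε : Fin N → Bool, 2 ^ p * (|∑ k, sgn (ε k) * (b k).re| ^ p +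
            |∑ k, sgn (ε k) * (b k).im| ^ p) := by
          refine Finset.sum_le_sum fun ε _ => ?_
          rw [← signSum_re, ← signSum_im]
          set s := signSum ε b
          have h := Complex.norm_le_abs_re_add_abs_im s
          have hm : ‖s‖ ≤ 2 * max |s.re| |s.im| := by
            rcases le_total |s.re| |s.im| with h' | h' <;> simp [h'] <;> linarith
          calc ‖s‖ ^ p ≤ (2 * max |s.re| |s.im|) ^ p := by gcongr
            _ = 2 ^ p * (max |s.re| |s.im|) ^ p := Real.mul_rpow (by positivity) (by positivity)
            _ ≤ _ := by
              gcongr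
              rcases le_total |s.re| |s.im| with h' | h' <;> simp [h'] <;> positivity
      _ ≤ _ := by
          rw [← Finset.mul_sum, Finset.sum_add_distrib]
          have : (0 : ℝ) < 2 ^ p := by positivity
          nlinarith
  have hM' : (M : ℂ) ≠ 0 := by exact_mod_cast hM.ne'
  have h := key (fun k => (M : ℂ)⁻¹ * b k) (by
    simp only [norm_mul, mul_pow, ← Finset.mul_sum, norm_inv, Complex.norm_real,
      Real.norm_eq_abs, inv_pow, sq_abs]
    rw [inv_mul_le_iff₀ (by positivity)]
    simpa using hb)
  simp only [signSum_smul, norm_mul, norm_inv, Complex.norm_real, Real.norm_eq_abs,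
    abs_of_pos hM] at h
  simp_rw [Real.mul_rpow (inv_nonneg.2 hM.le) (norm_nonneg _)] at h
  rw [← Finset.mul_sum, Real.inv_rpow hM.le, inv_mul_le_iff₀ (by positivity)] at h
  linarith

/-- The parallelogram law removes one sign at a time. -/
theorem sum_norm_sq_sign {N : ℕ} (b : Fin N → ℂ) :
    ∑ ε : Fin N → Bool, ‖signSum ε b‖ ^ 2 = 2 ^ N * ∑ k, ‖b k‖ ^ 2 := by
  induction N with
  | zero => simp [signSum]
  | succ n ih =>
    rw [← (Fin.consEquiv (fun _ : Fin (n + 1) => Bool)).sum_comp, Fintype.sum_prod_type_right]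
    have h : ∀ ε : Fin n → Bool, ∑ s : Bool, ‖signSum ((Fin.consEquiv fun _ => Bool) (s, ε)) b‖ ^ 2
        = 2 * (‖b 0‖ ^ 2 + ‖signSum ε (fun k => b k.succ)‖ ^ 2) := by
      intro ε
      have h2 : ∀ s : Bool, signSum ((Fin.consEquiv fun _ => Bool) (s, ε)) b =
          (sgn s : ℂ) * b 0 + signSum ε (fun k => b k.succ) := fun s => by
        simp [signSum, Fin.sum_univ_succ, Fin.consEquiv]
      rw [Fintype.sum_bool, h2, h2]
      have := parallelogram_law_with_norm ℝ (signSum ε (fun k => b k.succ)) (b 0)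
      simp only [sgn, if_true, Bool.false_eq_true, if_false, Complex.ofReal_one, one_mul,
        Complex.ofReal_neg, neg_mul]
      rw [add_comm (b 0), neg_add_eq_sub]
      nlinarith
    rw [Finset.sum_congr rfl fun ε _ => h ε, ← Finset.mul_sum, Finset.sum_add_distrib, ih,
      Fin.sum_univ_succ]
    simp
    ring

/-- The second moment is known exactly and the fourth is bounded, so the signed sums cannot be
concentrated at very small and very large values only; what remains is controlled by the `p`-th
moment. -/
theorem khintchine_lower (p : ℝ) :
    ∃ c : ℝ, 0 < c ∧ ∀ (N : ℕ) (b : Fin N → ℂ) (M : ℝ), 0 < M → M ^ 2 ≤ ∑ k, ‖b k‖ ^ 2 →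
      0 ≤ p → 2 ^ N * (c * M ^ p) ≤ ∑ ε : Fin N → Bool, ‖signSum ε b‖ ^ p := by
  obtain ⟨C, hC0, hC⟩ := khintchine_upper 4 (by norm_num)
  -- This value gives `C / K ^ 2 ≤ 1 / 2`, so after normalization the fourth-moment term contributes
  -- at most `1 / 2`. With the constant `1 / 4` below, a quarter of the second moment is left for
  -- the `p`-th moment.
  set K : ℝ := 1 + 2 * C with hK
  have hK1 : 1 ≤ K := by linarith
  set D : ℝ := K ^ 2 * 2 ^ p with hD
  have hD0 : 0 < D := by positivity
  -- The three terms serve the ranges `t ≤ 1 / 2`, `K ≤ t`, and the interval in between.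
  have hpt : 0 ≤ p → ∀ t : ℝ, 0 ≤ t → t ^ 2 ≤ 1 / 4 + (K ^ 2)⁻¹ * t ^ 4 + D * t ^ p := by
    intro hp t ht
    have h1 : 0 ≤ (K ^ 2)⁻¹ * t ^ 4 := by positivity
    have h2 : 0 ≤ D * t ^ p := by positivity
    rcases le_total t (1 / 2) with h | h
    · nlinarith
    rcases le_total K t with h' | h'
    · have : t ^ 2 ≤ (K ^ 2)⁻¹ * t ^ 4 := by
        rw [le_inv_mul_iff₀ (by positivity)]
        have : K ^ 2 ≤ t ^ 2 := by gcongr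
        nlinarith [sq_nonneg t]
      linarith
    · have h3 : t ^ 2 ≤ K ^ 2 := by gcongr
      have h4 : 1 ≤ 2 ^ p * t ^ p := by
        rw [← Real.mul_rpow (by norm_num) ht]
        exact Real.one_le_rpow (by linarith) hp
      have : K ^ 2 ≤ D * t ^ p := by
        rw [hD, mul_assoc]
        nlinarith [sq_nonneg K]
      linarith
  refine ⟨D⁻¹ * (1 / 4), by positivity, fun N b M hM hb hp => ?_⟩
  set S := ∑ k, ‖b k‖ ^ 2 with hS
  set M₀ := Real.sqrt S with hM₀
  have hS0 : 0 < S := lt_of_lt_of_le (by positivity) hb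
  have hM₀0 : 0 < M₀ := Real.sqrt_pos.2 hS0
  have hM₀S : M₀ ^ 2 = S := Real.sq_sqrt hS0.le
  have hMM : M ≤ M₀ := Real.le_sqrt_of_sq_le hb
  have h2 := sum_norm_sq_sign b
  have h4 := hC N b M₀ hM₀0.le hM₀S.ge
  have hsum : ∑ ε : Fin N → Bool, (M₀⁻¹ * ‖signSum ε b‖) ^ 2 ≤
      ∑ ε : Fin N → Bool, (1 / 4 + (K ^ 2)⁻¹ * (M₀⁻¹ * ‖signSum ε b‖) ^ 4 +
        D * (M₀⁻¹ * ‖signSum ε b‖) ^ p) :=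
    Finset.sum_le_sum fun ε _ => hpt hp _ (by positivity)
  simp_rw [mul_pow, Real.mul_rpow (inv_nonneg.2 hM₀0.le) (norm_nonneg _)] at hsum
  rw [Finset.sum_add_distrib, Finset.sum_add_distrib] at hsum
  simp only [← Finset.mul_sum] at hsum
  rw [h2, ← hS, ← hM₀S, Finset.sum_const, Finset.card_univ, Fintype.card_fun, Fintype.card_bool,
    Fintype.card_fin, nsmul_eq_mul] at hsum
  have e1 : M₀⁻¹ ^ 2 * (2 ^ N * M₀ ^ 2) = 2 ^ N := by field_simp
  have e4 : (K ^ 2)⁻¹ * (M₀⁻¹ ^ 4 * ∑ ε : Fin N → Bool, ‖signSum ε b‖ ^ 4) ≤ 2 ^ N * (1 / 2) := by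
    have h4' : ∑ ε : Fin N → Bool, ‖signSum ε b‖ ^ 4 ≤ 2 ^ N * (C * M₀ ^ 4) := by
      exact_mod_cast h4
    calc (K ^ 2)⁻¹ * (M₀⁻¹ ^ 4 * ∑ ε : Fin N → Bool, ‖signSum ε b‖ ^ 4)
        ≤ (K ^ 2)⁻¹ * (M₀⁻¹ ^ 4 * (2 ^ N * (C * M₀ ^ 4))) := by gcongr
      _ = 2 ^ N * ((K ^ 2)⁻¹ * C) := by field_simp
      _ ≤ _ := by
        gcongr
        rw [inv_mul_le_iff₀ (by positivity)]
        nlinarith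
  rw [e1] at hsum
  push_cast at hsum
  have hfin : (2 : ℝ) ^ N * (1 / 4) ≤ D * (M₀⁻¹ ^ p * ∑ ε : Fin N → Bool, ‖signSum ε b‖ ^ p) := by
    linarith
  rw [Real.inv_rpow hM₀0.le, mul_left_comm, le_inv_mul_iff₀ (by positivity)] at hfin
  have hpp : M ^ p ≤ M₀ ^ p := Real.rpow_le_rpow hM.le hMM hp
  calc (2 : ℝ) ^ N * (D⁻¹ * (1 / 4) * M ^ p) ≤ 2 ^ N * (D⁻¹ * (1 / 4) * M₀ ^ p) := by gcongr
    _ = D⁻¹ * (M₀ ^ p * (2 ^ N * (1 / 4))) := by ring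
    _ ≤ D⁻¹ * (D * ∑ ε : Fin N → Bool, ‖signSum ε b‖ ^ p) := by gcongr
    _ = _ := by rw [inv_mul_cancel_left₀ hD0.ne']

/-! ### The sequence norm -/

theorem ellNorm_top (a : ℕ → ℝ≥0∞) : ellNorm ∞ a = ⨆ i, a i := if_pos rfl

theorem ellNorm_of_ne_top {q : ℝ≥0∞} (hq : q ≠ ∞) (a : ℕ → ℝ≥0∞) :
    ellNorm q a = (∑' i, a i ^ q.toReal) ^ (1 / q.toReal) := if_neg hq

theorem ellNorm_mono (q : ℝ≥0∞) {a b : ℕ → ℝ≥0∞} (h : ∀ i, a i ≤ b i) :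
    ellNorm q a ≤ ellNorm q b := by
  unfold ellNorm
  split_ifs
  · exact iSup_mono h
  · gcongr with i
    exact h i

/-- For `q = ∞` the convention `1 / ∞.toReal = 1 / 0 = 0` turns the cardinality factor into `1`, so
a single formula covers all `q`. The same convention is used throughout. -/
theorem ellNorm_le_card {q : ℝ≥0∞} (hq : 0 < q) {a : ℕ → ℝ≥0∞} {I : Finset ℕ} {G : ℝ≥0∞}
    (h0 : ∀ i, i ∉ I → a i = 0) (hG : ∀ i ∈ I, a i ≤ G) :
    ellNorm q a ≤ (I.card : ℝ≥0∞) ^ (1 / q.toReal) * G := by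
  by_cases hqt : q = ∞
  · subst hqt
    simp only [ellNorm_top, ENNReal.toReal_top, div_zero, ENNReal.rpow_zero, one_mul]
    refine iSup_le fun i => ?_
    by_cases hi : i ∈ I
    · exact hG i hi
    · simp [h0 i hi]
  · have hr : 0 < q.toReal := ENNReal.toReal_pos hq.ne' hqt
    rw [ellNorm_of_ne_top hqt, tsum_eq_sum (s := I) fun i hi => by
      rw [h0 i hi, ENNReal.zero_rpow_of_pos hr]]
    calc (∑ i ∈ I, a i ^ q.toReal) ^ (1 / q.toReal)
        ≤ (∑ i ∈ I, G ^ q.toReal) ^ (1 / q.toReal) := by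
          gcongr with i hi
          exact hG i hi
      _ = _ := by
          rw [Finset.sum_const, nsmul_eq_mul, ENNReal.mul_rpow_of_nonneg _ _ (by positivity),
            ← ENNReal.rpow_mul, mul_one_div_cancel hr.ne', ENNReal.rpow_one]

theorem card_le_ellNorm {q : ℝ≥0∞} (hq : 0 < q) {a : ℕ → ℝ≥0∞} {J : Finset ℕ}
    (hJ : J.Nonempty) {G : ℝ≥0∞} (hG : ∀ j ∈ J, G ≤ a j) :
    (J.card : ℝ≥0∞) ^ (1 / q.toReal) * G ≤ ellNorm q a := by
  by_cases hqt : q = ∞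
  · subst hqt
    simp only [ellNorm_top, ENNReal.toReal_top, div_zero, ENNReal.rpow_zero, one_mul]
    obtain ⟨j, hj⟩ := hJ
    exact (hG j hj).trans (le_iSup a j)
  · have hr : 0 < q.toReal := ENNReal.toReal_pos hq.ne' hqt
    rw [ellNorm_of_ne_top hqt]
    calc _ = (∑ j ∈ J, G ^ q.toReal) ^ (1 / q.toReal) := by
          rw [Finset.sum_const, nsmul_eq_mul, ENNReal.mul_rpow_of_nonneg _ _ (by positivity),
            ← ENNReal.rpow_mul, mul_one_div_cancel hr.ne', ENNReal.rpow_one]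
      _ ≤ (∑ j ∈ J, a j ^ q.toReal) ^ (1 / q.toReal) := by
          gcongr with j hj
          exact hG j hj
      _ ≤ _ := by
          gcongr
          exact ENNReal.sum_le_tsum J

theorem tsum_half_pow_succ : ∑' n : ℕ, ((2 : ℝ≥0∞) ^ (n + 1))⁻¹ = 1 := by
  simp_rw [ENNReal.inv_pow]
  rw [ENNReal.tsum_geometric_add_one, ENNReal.one_sub_inv_two, inv_inv]
  exact ENNReal.inv_mul_cancel (by simp) (by simp)

/-- A countable triangle inequality for families that dominate entrywise. -/
theorem ellNorm_rpow_le_tsum {q : ℝ≥0∞} (hq : 0 < q) {p : ℝ} (hp : 0 < p) {a : ℕ → ℝ≥0∞}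
    {b : ℕ → ℕ → ℝ≥0∞} (h : ∀ i, ∃ n, a i ≤ b n i) :
    ellNorm q a ^ p ≤ ∑' n, (((2 : ℝ≥0∞) ^ (n + 1)) ^ (1 / q.toReal) * ellNorm q (b n)) ^ p := by
  choose ν hν using h
  -- It suffices to bound by the supremum `S` of the weighted norms. For finite `q` the weights give
  -- `∑ᵢ b n i ^ q ≤ 2 ^ (-(n + 1)) * S ^ q`, and these bounds sum over `n` to `S ^ q`.
  suffices h2 : ellNorm q a ≤ ⨆ n, ((2 : ℝ≥0∞) ^ (n + 1)) ^ (1 / q.toReal) * ellNorm q (b n) by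
    calc ellNorm q a ^ p ≤ (⨆ n, ((2 : ℝ≥0∞) ^ (n + 1)) ^ (1 / q.toReal) * ellNorm q (b n)) ^ p := by
          gcongr
      _ = ⨆ n, (((2 : ℝ≥0∞) ^ (n + 1)) ^ (1 / q.toReal) * ellNorm q (b n)) ^ p :=
          by
          simpa only [ENNReal.orderIsoRpow_apply] using (ENNReal.orderIsoRpow p hp).map_iSup
            fun n => ((2 : ℝ≥0∞) ^ (n + 1)) ^ (1 / q.toReal) * ellNorm q (b n)
      _ ≤ _ := iSup_le fun n => ENNReal.le_tsum n
  set S := ⨆ n, ((2 : ℝ≥0∞) ^ (n + 1)) ^ (1 / q.toReal) * ellNorm q (b n) with hS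
  by_cases hqt : q = ∞
  · subst hqt
    simp only [ellNorm_top, ENNReal.toReal_top, div_zero, ENNReal.rpow_zero, one_mul] at hS ⊢
    exact iSup_le fun i => (hν i).trans ((le_iSup (b (ν i)) i).trans
      (hS ▸ le_iSup (fun n => ⨆ i, b n i) (ν i)))
  · have hr : 0 < q.toReal := ENNReal.toReal_pos hq.ne' hqt
    have hb : ∀ n, ∑' i, b n i ^ q.toReal ≤ ((2 : ℝ≥0∞) ^ (n + 1))⁻¹ * S ^ q.toReal := by
      intro n
      have h1 : ((2 : ℝ≥0∞) ^ (n + 1)) ^ (1 / q.toReal) * ellNorm q (b n) ≤ S :=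
        le_iSup (fun n => ((2 : ℝ≥0∞) ^ (n + 1)) ^ (1 / q.toReal) * ellNorm q (b n)) n
      have h2 := ENNReal.rpow_le_rpow h1 hr.le
      rw [ellNorm_of_ne_top hqt, ENNReal.mul_rpow_of_nonneg _ _ hr.le, ← ENNReal.rpow_mul,
        ← ENNReal.rpow_mul, one_div_mul_cancel hr.ne', ENNReal.rpow_one, ENNReal.rpow_one] at h2
      rw [mul_comm, ← div_eq_mul_inv, ENNReal.le_div_iff_mul_le (by simp) (by simp), mul_comm]
      exact h2
    rw [ellNorm_of_ne_top hqt]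
    have h3 : ∑' i, a i ^ q.toReal ≤ S ^ q.toReal := by
      calc ∑' i, a i ^ q.toReal ≤ ∑' i, ∑' n, b n i ^ q.toReal := by
            refine ENNReal.tsum_le_tsum fun i => ?_
            exact (ENNReal.rpow_le_rpow (hν i) hr.le).trans
              (ENNReal.le_tsum (f := fun n => b n i ^ q.toReal) (ν i))
        _ = ∑' n, ∑' i, b n i ^ q.toReal := ENNReal.tsum_comm
        _ ≤ ∑' n, ((2 : ℝ≥0∞) ^ (n + 1))⁻¹ * S ^ q.toReal := ENNReal.tsum_le_tsum hb
        _ = S ^ q.toReal := by rw [ENNReal.tsum_mul_right, tsum_half_pow_succ, one_mul]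
    calc _ ≤ (S ^ q.toReal) ^ (1 / q.toReal) := by gcongr
      _ = S := by rw [← ENNReal.rpow_mul, mul_one_div_cancel hr.ne', ENNReal.rpow_one]

/-! ### Adapted norms of expansive automorphisms -/

theorem det_act {d : ℕ} (M : Matrix (Fin d) (Fin d) ℝ) :
    LinearMap.det (act M : E d →ₗ[ℝ] E d) = M.det := by
  rw [← LinearMap.det_toLin (EuclideanSpace.basisFun (Fin d) ℝ).toBasis M]
  rfl

theorem actEquiv_zpow {d : ℕ} (A : GL (Fin d) ℝ) (k : ℤ) :
    actEquiv (A ^ k) = actEquiv A ^ k := by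
  simp [actEquiv]

theorem one_equiv_apply {d : ℕ} (x : E d) : (1 : E d ≃L[ℝ] E d) x = x := rfl

theorem zpow_add_apply {d : ℕ} (T : E d ≃L[ℝ] E d) (k l : ℤ) (x : E d) :
    (T ^ (k + l)) x = (T ^ k) ((T ^ l) x) := by
  rw [zpow_add]; rfl

theorem zpow_neg_zpow_apply {d : ℕ} (T : E d ≃L[ℝ] E d) (k : ℤ) (x : E d) :
    (T ^ (-k)) ((T ^ k) x) = x := by
  rw [← zpow_add_apply, neg_add_cancel, zpow_zero]; rfl

theorem zpow_zpow_neg_apply {d : ℕ} (T : E d ≃L[ℝ] E d) (k : ℤ) (x : E d) :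
    (T ^ k) ((T ^ (-k)) x) = x := by
  rw [← zpow_add_apply, add_neg_cancel, zpow_zero]; rfl

theorem zpow_neg_one_apply {d : ℕ} (T : E d ≃L[ℝ] E d) (x : E d) :
    (T ^ (-1 : ℤ)) x = T.symm x := by
  rw [zpow_neg_one]; rfl

/-- `ν` is a norm contracted by `T⁻¹` with ratio `θ < 1`. -/
structure IsAdapted {d : ℕ} (T : E d ≃L[ℝ] E d) (ν : Seminorm ℝ (E d)) (θ : ℝ) : Prop where
  pos : 0 < θ
  lt_one : θ < 1
  contract : ∀ x, ν (T.symm x) ≤ θ * ν x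
  lower : ∃ c : ℝ, 0 < c ∧ ∀ x, c * ‖x‖ ≤ ν x
  upper : ∃ C : ℝ, 0 < C ∧ ∀ x, ν x ≤ C * ‖x‖

/-- The inverse of the complexified matrix has its spectrum in the open unit disc, so by Gelfand's
formula its powers tend to zero in norm. The isometric embedding of `ℝ^d` into `ℂ^d` brings the
bound back to the real map. -/
theorem exists_contracting_pow {d : ℕ} (D : GL (Fin d) ℝ)
    (hD : IsExpansive (D : Matrix (Fin d) (Fin d) ℝ)) :
    ∃ n : ℕ, 0 < n ∧ ∀ x, ‖(actEquiv D ^ (-(n : ℤ))) x‖ ≤ 1 / 2 * ‖x‖ := by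
  rcases Nat.eq_zero_or_pos d with rfl | hd
  · exact ⟨1, one_pos, fun x => by simp [Subsingleton.elim _ (0 : E 0)]⟩
  have : Nonempty (Fin d) := ⟨⟨0, hd⟩⟩
  let U : (Matrix (Fin d) (Fin d) ℂ)ˣ :=
    Units.map (((algebraMap ℝ ℂ).mapMatrix : Matrix (Fin d) (Fin d) ℝ →+* _) :
      Matrix (Fin d) (Fin d) ℝ →* Matrix (Fin d) (Fin d) ℂ) D
  let a : (EuclideanSpace ℂ (Fin d) →L[ℂ] EuclideanSpace ℂ (Fin d))ˣ :=
    Units.map (Matrix.toEuclideanCLM (n := Fin d) (𝕜 := ℂ) :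
      Matrix (Fin d) (Fin d) ℂ →* (EuclideanSpace ℂ (Fin d) →L[ℂ] EuclideanSpace ℂ (Fin d))) U
  have hspec : ∀ z ∈ spectrum ℂ (a : EuclideanSpace ℂ (Fin d) →L[ℂ] EuclideanSpace ℂ (Fin d)),
      1 < ‖z‖ := by
    intro z hz
    apply hD z
    have h : spectrum ℂ (a : EuclideanSpace ℂ (Fin d) →L[ℂ] EuclideanSpace ℂ (Fin d)) =
        spectrum ℂ ((D : Matrix (Fin d) (Fin d) ℝ).map (algebraMap ℝ ℂ)) :=
      AlgEquiv.spectrum_eq (Matrix.toEuclideanCLM (n := Fin d) (𝕜 := ℂ)).toAlgEquiv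
        (U : Matrix (Fin d) (Fin d) ℂ)
    rw [← h]
    exact hz
  have hspec' : ∀ z ∈ spectrum ℂ
      ((a⁻¹ : _ˣ) : EuclideanSpace ℂ (Fin d) →L[ℂ] EuclideanSpace ℂ (Fin d)), ‖z‖₊ < 1 := by
    intro z hz
    have hz0 := spectrum.ne_zero_of_mem_of_unit hz
    have h := (spectrum.inv_mem_iff (r := Units.mk0 z hz0) (a := a⁻¹)).1 hz
    rw [inv_inv] at h
    have h1 := hspec _ h
    rw [Units.val_inv_eq_inv_val, Units.val_mk0, norm_inv] at h1
    have := (one_lt_inv₀ (norm_pos_iff.2 hz0)).1 h1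
    exact_mod_cast this
  have hrad := spectrum.spectralRadius_lt_of_forall_lt _ hspec'
  have hlim := spectrum.pow_nnnorm_pow_one_div_tendsto_nhds_spectralRadius
    ((a⁻¹ : _ˣ) : EuclideanSpace ℂ (Fin d) →L[ℂ] EuclideanSpace ℂ (Fin d))
  obtain ⟨r, hr1, hr2⟩ := ENNReal.lt_iff_exists_nnreal_btwn.1 hrad
  have hr2' : (r : ℝ≥0∞) < 1 := hr2
  have hev := (hlim.eventually_lt_const hr1)
  have hev2 := (ENNReal.tendsto_pow_atTop_nhds_zero_of_lt_one hr2').eventually_lt_const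
    (show (0 : ℝ≥0∞) < 1 / 2 by simp)
  obtain ⟨n, ⟨h1, h2⟩, h3⟩ := ((hev.and hev2).and (Filter.eventually_gt_atTop 0)).exists
  refine ⟨n, h3, ?_⟩
  have hn : ‖((a⁻¹ : _ˣ) : EuclideanSpace ℂ (Fin d) →L[ℂ] EuclideanSpace ℂ (Fin d)) ^ n‖ ≤ 1 / 2 := by
    have h4 := ENNReal.rpow_le_rpow h1.le (show (0 : ℝ) ≤ n by positivity)
    rw [← ENNReal.rpow_mul, one_div_mul_cancel (by positivity), ENNReal.rpow_one,
      ENNReal.rpow_natCast] at h4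
    have h5 := h4.trans h2.le
    have h6 : ‖((a⁻¹ : _ˣ) : EuclideanSpace ℂ (Fin d) →L[ℂ] EuclideanSpace ℂ (Fin d)) ^ n‖₊
        ≤ 1 / 2 := by
      rw [← ENNReal.coe_le_coe]
      exact h5.trans (by simp)
    exact_mod_cast h6
  let c : E d → EuclideanSpace ℂ (Fin d) := fun x => WithLp.toLp 2 (fun i => (x i : ℂ))
  have hc : ∀ x, ‖c x‖ = ‖x‖ := fun x => by simp [c, EuclideanSpace.norm_eq]
  have hca : ∀ x, c (actEquiv D x) = (a : EuclideanSpace ℂ (Fin d) →L[ℂ] _) (c x) := by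
    intro x
    ext i
    simp [c, actEquiv_apply, act, a, U, Matrix.mulVec, dotProduct, Matrix.ofLp_toEuclideanCLM]
  have hca' : ∀ x, c ((actEquiv D).symm x) =
      ((a⁻¹ : _ˣ) : EuclideanSpace ℂ (Fin d) →L[ℂ] EuclideanSpace ℂ (Fin d)) (c x) := by
    intro x
    have h := hca ((actEquiv D).symm x)
    rw [ContinuousLinearEquiv.apply_symm_apply] at h
    rw [h]
    change _ = (((a⁻¹ : _ˣ) : EuclideanSpace ℂ (Fin d) →L[ℂ] EuclideanSpace ℂ (Fin d)) * a) _
    rw [Units.inv_mul]; rfl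
  have hcn : ∀ (n : ℕ) x, c ((actEquiv D ^ (-(n : ℤ))) x) =
      (((a⁻¹ : _ˣ) : EuclideanSpace ℂ (Fin d) →L[ℂ] EuclideanSpace ℂ (Fin d)) ^ n) (c x) := by
    intro n
    induction n with
    | zero => intro x; simp [one_equiv_apply]
    | succ n ih =>
      intro x
      rw [Nat.cast_succ, neg_add, add_comm, zpow_add_apply, zpow_neg_one_apply, hca', ih, pow_succ']
      rfl
  intro x
  rw [← hc, hcn, ← hc x]
  exact (ContinuousLinearMap.le_opNorm _ _).trans (by gcongr)

/-- The norm is `∑_{k<n} l ^ k * ‖T⁻ᵏ x‖`. Replacing `x` by `T⁻¹ x` and multiplying by `l` shifts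
the sum by one index, trading the term `‖x‖` for `l ^ n * ‖T⁻ⁿ x‖`, which is no larger. -/
theorem exists_isAdapted {d : ℕ} (D : GL (Fin d) ℝ)
    (hD : IsExpansive (D : Matrix (Fin d) (Fin d) ℝ)) :
    ∃ (ν : Seminorm ℝ (E d)) (θ : ℝ), IsAdapted (actEquiv D) ν θ := by
  obtain ⟨n, hn, hc⟩ := exists_contracting_pow D hD
  set T := actEquiv D
  -- Chosen so that `l ^ n = 2` exactly offsets the contraction factor `1 / 2` of `T⁻ⁿ`.
  set l : ℝ := 2 ^ (1 / (n : ℝ)) with hl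
  have hl1 : 1 < l := Real.one_lt_rpow (by norm_num) (by positivity)
  have hl0 : 0 < l := by positivity
  have hln : l ^ n = 2 := by
    rw [hl, ← Real.rpow_natCast, ← Real.rpow_mul (by norm_num), one_div_mul_cancel (by positivity),
      Real.rpow_one]
  let ν : Seminorm ℝ (E d) := Seminorm.of
    (fun x => ∑ k ∈ Finset.range n, l ^ k * ‖(T ^ (-(k : ℤ))) x‖)
    (fun x y => by
      rw [← Finset.sum_add_distrib]
      refine Finset.sum_le_sum fun k _ => ?_
      rw [map_add, ← mul_add]
      gcongr
      exact norm_add_le _ _)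
    (fun a x => by
      rw [Finset.mul_sum]
      refine Finset.sum_congr rfl fun k _ => ?_
      rw [map_smul, norm_smul]
      ring)
  have hν : ∀ x, ν x = ∑ k ∈ Finset.range n, l ^ k * ‖(T ^ (-(k : ℤ))) x‖ := fun x => rfl
  refine ⟨ν, l⁻¹, by positivity, inv_lt_one_of_one_lt₀ hl1, fun x => ?_, ⟨1, one_pos, fun x => ?_⟩,
    ⟨1 + ∑ k ∈ Finset.range n, l ^ k * ‖((T ^ (-(k : ℤ)) : E d ≃L[ℝ] E d) : E d →L[ℝ] E d)‖,
      by positivity, fun x => ?_⟩⟩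
  · have hs : ν (T.symm x) = ∑ k ∈ Finset.range n, l⁻¹ * (l ^ (k + 1) * ‖(T ^ (-((k + 1 : ℕ) : ℤ))) x‖) := by
      rw [hν]
      refine Finset.sum_congr rfl fun k _ => ?_
      rw [← zpow_neg_one_apply, ← zpow_add_apply]
      push_cast
      rw [show -(k : ℤ) + -1 = -((k : ℤ) + 1) by ring, pow_succ]
      field_simp
    rw [hs, ← Finset.mul_sum]
    gcongr
    have h1 := Finset.sum_range_succ (fun k : ℕ => l ^ k * ‖(T ^ (-(k : ℤ))) x‖) n
    have h2 := Finset.sum_range_succ' (fun k : ℕ => l ^ k * ‖(T ^ (-(k : ℤ))) x‖) n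
    have h3 : l ^ n * ‖(T ^ (-(n : ℤ))) x‖ ≤ ‖x‖ := by
      rw [hln]; linarith [hc x]
    have h4 : l ^ 0 * ‖(T ^ (-((0 : ℕ) : ℤ))) x‖ = ‖x‖ := by simp [one_equiv_apply]
    rw [hν]
    rw [h4] at h2
    linarith
  · rw [one_mul, hν]
    have h := Finset.single_le_sum (f := fun k : ℕ => l ^ k * ‖(T ^ (-(k : ℤ))) x‖)
      (fun k _ => by positivity) (Finset.mem_range.2 hn)
    simpa [one_equiv_apply] using h
  · rw [hν, add_mul, one_mul, Finset.sum_mul]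
    have : ∑ k ∈ Finset.range n, l ^ k * ‖(T ^ (-(k : ℤ))) x‖ ≤ ∑ k ∈ Finset.range n,
        l ^ k * ‖((T ^ (-(k : ℤ)) : E d ≃L[ℝ] E d) : E d →L[ℝ] E d)‖ * ‖x‖ := by
      refine Finset.sum_le_sum fun k _ => ?_
      rw [mul_assoc]
      gcongr
      exact ContinuousLinearMap.le_opNorm ((T ^ (-(k : ℤ)) : E d ≃L[ℝ] E d) : E d →L[ℝ] E d) x
    linarith [norm_nonneg x]

namespace IsAdapted

variable {d : ℕ} {T : E d ≃L[ℝ] E d} {ν : Seminorm ℝ (E d)} {θ : ℝ}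

theorem continuous (h : IsAdapted T ν θ) : Continuous ν := by
  obtain ⟨C, hC, hu⟩ := h.upper
  refine Seminorm.continuous_of_le (q := C.toNNReal • normSeminorm ℝ (E d)) ?_ fun x => ?_
  · exact continuous_const.mul continuous_norm
  · simpa [NNReal.smul_def, hC.le] using hu x

theorem eq_zero (h : IsAdapted T ν θ) {x : E d} (hx : ν x = 0) : x = 0 := by
  obtain ⟨c, hc, hl⟩ := h.lower
  have := hl x
  rw [hx] at this
  exact norm_le_zero_iff.1 (by nlinarith [norm_nonneg x])

theorem pos_of_ne_zero (h : IsAdapted T ν θ) {x : E d} (hx : x ≠ 0) : 0 < ν x :=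
  lt_of_le_of_ne (apply_nonneg _ _) fun h0 => hx (h.eq_zero h0.symm)

theorem pow_contract (h : IsAdapted T ν θ) (n : ℕ) (x : E d) :
    ν ((T ^ (-(n : ℤ))) x) ≤ θ ^ n * ν x := by
  induction n with
  | zero => simp [one_equiv_apply]
  | succ n ih =>
    rw [Nat.cast_succ, neg_add, add_comm, zpow_add_apply, zpow_neg_one_apply, pow_succ', mul_assoc]
    exact (h.contract _).trans (mul_le_mul_of_nonneg_left ih h.pos.le)

theorem scale_le (h : IsAdapted T ν θ) {k l : ℤ} (n : ℕ) (hkl : l = k + n) (x : E d) :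
    ν ((T ^ (-l)) x) ≤ θ ^ n * ν ((T ^ (-k)) x) := by
  rw [hkl, neg_add, add_comm, zpow_add_apply]
  exact h.pow_contract n _

theorem scale_anti (h : IsAdapted T ν θ) {k l : ℤ} (hkl : k ≤ l) (x : E d) :
    ν ((T ^ (-l)) x) ≤ ν ((T ^ (-k)) x) := by
  obtain ⟨n, rfl⟩ := Int.le.dest hkl
  refine (h.scale_le n rfl x).trans ?_
  exact mul_le_of_le_one_left (apply_nonneg _ _) (pow_le_one₀ h.pos.le h.lt_one.le)

theorem exists_scale_le_one (h : IsAdapted T ν θ) (x : E d) :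
    ∃ k : ℕ, ν ((T ^ (-(k : ℤ))) x) ≤ 1 := by
  have hl : Filter.Tendsto (fun n : ℕ => θ ^ n * ν x) Filter.atTop (nhds (0 * ν x)) :=
    (tendsto_pow_atTop_nhds_zero_of_lt_one h.pos.le h.lt_one).mul_const _
  rw [zero_mul] at hl
  obtain ⟨n, hn⟩ := (hl.eventually_lt_const one_pos).exists
  exact ⟨n, (h.pow_contract n x).trans hn.le⟩

theorem exists_one_lt_scale (h : IsAdapted T ν θ) {x : E d} (hx : x ≠ 0) :
    ∃ k : ℤ, 1 < ν ((T ^ (-k)) x) := by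
  have h0 := h.pos_of_ne_zero hx
  have hl : Filter.Tendsto (fun n : ℕ => θ ^ n) Filter.atTop (nhds 0) :=
    tendsto_pow_atTop_nhds_zero_of_lt_one h.pos.le h.lt_one
  obtain ⟨n, hn⟩ := (hl.eventually_lt_const h0).exists
  refine ⟨-n, ?_⟩
  by_contra! hle
  have := h.pow_contract n ((T ^ (n : ℤ)) x)
  rw [zpow_neg_zpow_apply] at this
  rw [neg_neg] at hle
  have : θ ^ n * ν ((T ^ (n : ℤ)) x) ≤ θ ^ n := mul_le_of_le_one_right (pow_nonneg h.pos.le _) hle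
  linarith

theorem continuous_scale (h : IsAdapted T ν θ) (k : ℤ) : Continuous fun x => ν ((T ^ k) x) :=
  h.continuous.comp (T ^ k).continuous

end IsAdapted

/-- The least `k ≥ 0` such that `T^{-k} x` lies in the unit ball of `ν`. -/
def level {d : ℕ} (T : E d ≃L[ℝ] E d) (ν : Seminorm ℝ (E d)) (x : E d) : ℕ :=
  sInf {k : ℕ | ν ((T ^ (-(k : ℤ))) x) ≤ 1}

namespace IsAdapted

variable {d : ℕ} {T : E d ≃L[ℝ] E d} {ν : Seminorm ℝ (E d)} {θ : ℝ}

theorem scale_level (h : IsAdapted T ν θ) (x : E d) : ν ((T ^ (-(level T ν x : ℤ))) x) ≤ 1 :=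
  Nat.sInf_mem (s := {k : ℕ | ν ((T ^ (-(k : ℤ))) x) ≤ 1}) (h.exists_scale_le_one x)

theorem level_le_iff (h : IsAdapted T ν θ) {x : E d} {k : ℕ} :
    level T ν x ≤ k ↔ ν ((T ^ (-(k : ℤ))) x) ≤ 1 := by
  refine ⟨fun hk => (h.scale_anti (by exact_mod_cast hk) x).trans (h.scale_level x), fun hk => ?_⟩
  exact Nat.sInf_le hk

theorem lt_level_iff (h : IsAdapted T ν θ) {x : E d} {k : ℕ} :
    k < level T ν x ↔ 1 < ν ((T ^ (-(k : ℤ))) x) := by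
  rw [← not_le, h.level_le_iff, not_le]

/-- The volume of the dilated unit ball. -/
theorem volume_level_le (h : IsAdapted T ν θ) (k : ℕ) :
    volume {x | level T ν x ≤ k} =
      ENNReal.ofReal (|LinearMap.det (T : E d →ₗ[ℝ] E d)| ^ k) * volume {x : E d | ν x ≤ 1} := by
  have hs : {x | level T ν x ≤ k} = (T ^ k) '' {x : E d | ν x ≤ 1} := by
    ext x
    simp only [Set.mem_ofPred_eq, h.level_le_iff, Set.mem_image]
    constructor
    · intro hx
      exact ⟨_, hx, by rw [← zpow_natCast]; exact zpow_zpow_neg_apply T k x⟩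
    · rintro ⟨y, hy, rfl⟩
      rw [← zpow_natCast, zpow_neg_zpow_apply]
      exact hy
  have hdet : ∀ k : ℕ, LinearMap.det ((T ^ k : E d ≃L[ℝ] E d) : E d →ₗ[ℝ] E d) =
      LinearMap.det (T : E d →ₗ[ℝ] E d) ^ k := by
    intro k
    rw [← map_pow]
    congr 1
    induction k with
    | zero => rfl
    | succ n ih => rw [pow_succ, pow_succ, ← ih]; rfl
  rw [hs, Measure.addHaar_image_continuousLinearEquiv, ← abs_pow]
  congr 3
  exact hdet k

theorem volume_unitBall_pos (h : IsAdapted T ν θ) : 0 < volume {x : E d | ν x ≤ 1} := by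
  refine lt_of_lt_of_le (IsOpen.measure_pos volume (U := {x : E d | ν x < 1}) ?_ ⟨0, by simp⟩)
    (measure_mono fun x hx => by simp only [Set.mem_ofPred_eq] at hx ⊢; exact hx.le)
  exact isOpen_lt h.continuous continuous_const

theorem isCompact_sublevel (h : IsAdapted T ν θ) (R : ℝ) : IsCompact {x : E d | ν x ≤ R} := by
  obtain ⟨c, hc, hl⟩ := h.lower
  refine Metric.isCompact_of_isClosed_isBounded (isClosed_le h.continuous continuous_const) ?_
  refine (Metric.isBounded_closedBall (x := (0 : E d)) (r := R / c)).subset fun x hx => ?_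
  rw [mem_closedBall_zero_iff, le_div_iff₀ hc]
  have h1 := hl x
  have h2 : ν x ≤ R := hx
  linarith

theorem volume_unitBall_lt_top (h : IsAdapted T ν θ) : volume {x : E d | ν x ≤ 1} < ∞ :=
  (h.isCompact_sublevel 1).measure_lt_top

theorem isCompact_level_le (h : IsAdapted T ν θ) (k : ℕ) : IsCompact {x | level T ν x ≤ k} := by
  have : {x | level T ν x ≤ k} = (T ^ (-(k : ℤ))).toHomeomorph ⁻¹' {x : E d | ν x ≤ 1} := by
    ext x; simp [h.level_le_iff]
  rw [this]
  exact (Homeomorph.isCompact_preimage _).2 (h.isCompact_sublevel 1)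

/-- The sublevel sets of `level` exhaust the space, which has infinite volume; with `|det T| ≤ 1`
their volumes would stay bounded. -/
theorem one_lt_abs_det [Nontrivial (E d)] (h : IsAdapted T ν θ) :
    1 < |LinearMap.det (T : E d →ₗ[ℝ] E d)| := by
  by_contra! hle
  have h1 : ∀ k, volume {x | level T ν x ≤ k} ≤ volume {x : E d | ν x ≤ 1} := by
    intro k
    rw [h.volume_level_le]
    refine mul_le_of_le_one_left (by positivity) ?_
    exact ENNReal.ofReal_le_one.2 (pow_le_one₀ (abs_nonneg _) hle)
  have h2 : (⋃ k, {x | level T ν x ≤ k}) = Set.univ :=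
    Set.eq_univ_of_forall fun x => Set.mem_iUnion.2 ⟨level T ν x, by simp⟩
  have h3 : Monotone fun k => {x | level T ν x ≤ k} := fun k l hkl x hx => by
    simp only [Set.mem_ofPred_eq] at hx ⊢; exact hx.trans hkl
  have h4 := h3.measure_iUnion (μ := (volume : Measure (E d)))
  rw [h2, measure_univ_of_isAddLeftInvariant] at h4
  exact absurd (h4.trans_le (iSup_le h1)) (not_le.2 h.volume_unitBall_lt_top)

end IsAdapted

/-! ### The step quasi-norm -/

/-- The step quasi-norm attached to an adapted norm. -/
def stepNorm {d : ℕ} (T : E d ≃L[ℝ] E d) (ν : Seminorm ℝ (E d)) (x : E d) : ℝ :=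
  sInf {r | ∃ k : ℤ, ν ((T ^ (-k)) x) ≤ 1 ∧ r = |LinearMap.det (T : E d →ₗ[ℝ] E d)| ^ k}

theorem stepNorm_nonneg {d : ℕ} (T : E d ≃L[ℝ] E d) (ν : Seminorm ℝ (E d)) (x : E d) :
    0 ≤ stepNorm T ν x := by
  refine Real.sInf_nonneg fun r hr => ?_
  obtain ⟨k, -, rfl⟩ := hr
  positivity

theorem bddBelow_stepNorm {d : ℕ} (T : E d ≃L[ℝ] E d) (ν : Seminorm ℝ (E d)) (x : E d) :
    BddBelow {r | ∃ k : ℤ, ν ((T ^ (-k)) x) ≤ 1 ∧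
      r = |LinearMap.det (T : E d →ₗ[ℝ] E d)| ^ k} := by
  refine ⟨0, fun r hr => ?_⟩
  obtain ⟨k, -, rfl⟩ := hr
  positivity

theorem stepNorm_le {d : ℕ} {T : E d ≃L[ℝ] E d} {ν : Seminorm ℝ (E d)} {x : E d} {k : ℤ}
    (hk : ν ((T ^ (-k)) x) ≤ 1) :
    stepNorm T ν x ≤ |LinearMap.det (T : E d →ₗ[ℝ] E d)| ^ k :=
  csInf_le (bddBelow_stepNorm T ν x) ⟨k, hk, rfl⟩

namespace IsAdapted

variable {d : ℕ} {T : E d ≃L[ℝ] E d} {ν : Seminorm ℝ (E d)} {θ : ℝ}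

theorem stepNorm_lt_iff (h : IsAdapted T ν θ) {x : E d} {c : ℝ} :
    stepNorm T ν x < c ↔
      ∃ k : ℤ, ν ((T ^ (-k)) x) ≤ 1 ∧ |LinearMap.det (T : E d →ₗ[ℝ] E d)| ^ k < c := by
  obtain ⟨k, hk⟩ := h.exists_scale_le_one x
  rw [stepNorm, csInf_lt_iff (bddBelow_stepNorm T ν x) ⟨_, k, hk, rfl⟩]
  constructor
  · rintro ⟨_, ⟨k, hk, rfl⟩, hc⟩
    exact ⟨k, hk, hc⟩
  · rintro ⟨k, hk, hc⟩
    exact ⟨_, ⟨k, hk, rfl⟩, hc⟩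

theorem stepNorm_eq [Nontrivial (E d)] (h : IsAdapted T ν θ) {x : E d} {k : ℤ}
    (hk : ν ((T ^ (-k)) x) ≤ 1) (hk' : 1 < ν ((T ^ (-(k - 1))) x)) :
    stepNorm T ν x = |LinearMap.det (T : E d →ₗ[ℝ] E d)| ^ k := by
  refine le_antisymm (stepNorm_le hk) (le_csInf ⟨_, k, hk, rfl⟩ ?_)
  rintro _ ⟨l, hl, rfl⟩
  refine zpow_le_zpow_right₀ h.one_lt_abs_det.le ?_
  by_contra! hlk
  exact absurd (h.scale_anti (k := l) (l := k - 1) (by omega) x) (not_le.2 (hl.trans_lt hk'))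

theorem exists_stepNorm_eq [Nontrivial (E d)] (h : IsAdapted T ν θ) {x : E d} (hx : x ≠ 0) :
    ∃ k : ℤ, ν ((T ^ (-k)) x) ≤ 1 ∧ 1 < ν ((T ^ (-(k - 1))) x) := by
  obtain ⟨k₁, hk₁⟩ := h.exists_scale_le_one x
  obtain ⟨k₀, hk₀⟩ := h.exists_one_lt_scale hx
  obtain ⟨k, hk, hmin⟩ := Int.exists_least_of_bdd (P := fun k => ν ((T ^ (-k)) x) ≤ 1)
    ⟨k₀, fun z hz => by
      by_contra! hlt
      exact absurd (h.scale_anti hlt.le x) (not_le.2 (hz.trans_lt hk₀))⟩ ⟨k₁, hk₁⟩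
  refine ⟨k, hk, ?_⟩
  by_contra! hle
  have := hmin _ hle
  omega

theorem stepNorm_zero [Nontrivial (E d)] (h : IsAdapted T ν θ) : stepNorm T ν 0 = 0 := by
  refine le_antisymm (le_of_forall_pos_le_add fun ε hε => ?_) (stepNorm_nonneg _ _ _)
  have hd := h.one_lt_abs_det
  obtain ⟨n, hn⟩ := exists_pow_lt_of_lt_one hε (inv_lt_one_of_one_lt₀ hd)
  rw [zero_add]
  refine (stepNorm_le (k := -n) (by simp)).trans ?_
  rw [zpow_neg, zpow_natCast, ← inv_pow]
  exact hn.le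

theorem stepNorm_eq_zero_iff [Nontrivial (E d)] (h : IsAdapted T ν θ) (x : E d) :
    stepNorm T ν x = 0 ↔ x = 0 := by
  refine ⟨fun h0 => ?_, fun hx => hx ▸ h.stepNorm_zero⟩
  by_contra hx
  obtain ⟨k, hk, hk'⟩ := h.exists_stepNorm_eq hx
  rw [h.stepNorm_eq hk hk'] at h0
  have := h.one_lt_abs_det
  exact absurd h0 (by positivity)

theorem stepNorm_apply [Nontrivial (E d)] (h : IsAdapted T ν θ) (x : E d) :
    stepNorm T ν (T x) = |LinearMap.det (T : E d →ₗ[ℝ] E d)| * stepNorm T ν x := by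
  by_cases hx : x = 0
  · simp [hx, h.stepNorm_zero]
  obtain ⟨k, hk, hk'⟩ := h.exists_stepNorm_eq hx
  have hT : ∀ l : ℤ, (T ^ (-(l + 1))) (T x) = (T ^ (-l)) x := fun l => by
    rw [neg_add, zpow_add_apply, zpow_neg_one_apply, ContinuousLinearEquiv.symm_apply_apply]
  have hd := h.one_lt_abs_det
  rw [h.stepNorm_eq hk hk', h.stepNorm_eq (k := k + 1) (by rwa [hT])
    (by rw [show k + 1 - 1 = k - 1 + 1 by ring, hT]; exact hk'), zpow_add_one₀ (by positivity),
    mul_comm]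

theorem stepNorm_add_le [Nontrivial (E d)] (h : IsAdapted T ν θ) :
    ∃ C : ℝ, 0 < C ∧ ∀ x y, stepNorm T ν (x + y) ≤ C * (stepNorm T ν x + stepNorm T ν y) := by
  have hd := h.one_lt_abs_det
  set δ := |LinearMap.det (T : E d →ₗ[ℝ] E d)| with hδ
  -- After `m` further contractions the sum of two vectors of the unit ball lies in the unit ball
  -- again, so `δ ^ m` serves as quasi-triangle constant.
  obtain ⟨m, hm⟩ := exists_pow_lt_of_lt_one (show (0 : ℝ) < 1 / 2 by norm_num) h.lt_one
  have h1 : 1 ≤ δ ^ m := one_le_pow₀ hd.le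
  refine ⟨δ ^ m, by positivity, fun x y => ?_⟩
  by_cases hx : x = 0
  · simp only [hx, zero_add, h.stepNorm_zero]
    exact le_mul_of_one_le_left (stepNorm_nonneg _ _ _) h1
  by_cases hy : y = 0
  · simp only [hy, add_zero, h.stepNorm_zero]
    exact le_mul_of_one_le_left (stepNorm_nonneg _ _ _) h1
  obtain ⟨k, hk, hk'⟩ := h.exists_stepNorm_eq hx
  obtain ⟨l, hl, hl'⟩ := h.exists_stepNorm_eq hy
  rw [h.stepNorm_eq hk hk', h.stepNorm_eq hl hl', ← hδ]
  have hb : ν ((T ^ (-(max k l + m))) (x + y)) ≤ 1 := by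
    refine (h.scale_le m rfl _).trans ?_
    rw [map_add]
    have hx1 := (h.scale_anti (le_max_left k l) x).trans hk
    have hy1 := (h.scale_anti (le_max_right k l) y).trans hl
    have := map_add_le_add ν ((T ^ (-(max k l))) x) ((T ^ (-(max k l))) y)
    have h0 : 0 < θ ^ m := pow_pos h.pos m
    nlinarith
  refine (stepNorm_le hb).trans ?_
  rw [← hδ, zpow_add₀ (by positivity), mul_comm, zpow_natCast]
  gcongr
  rcases le_total k l with hkl | hkl <;> simp [hkl] <;> positivity

theorem measurable_stepNorm (h : IsAdapted T ν θ) : Measurable (stepNorm T ν) := by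
  refine measurable_of_Iio fun c => ?_
  have : stepNorm T ν ⁻¹' Set.Iio c =
      ⋃ k : {k : ℤ // |LinearMap.det (T : E d →ₗ[ℝ] E d)| ^ k < c}, {x | ν ((T ^ (-k.1)) x) ≤ 1} := by
    ext x
    simp only [Set.mem_preimage, Set.mem_Iio, h.stepNorm_lt_iff, Set.mem_iUnion, Set.mem_ofPred_eq,
      Subtype.exists]
    constructor
    · rintro ⟨k, h1, h2⟩; exact ⟨k, h2, h1⟩
    · rintro ⟨k, h1, h2⟩; exact ⟨k, h2, h1⟩
  rw [this]
  exact MeasurableSet.iUnion fun k =>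
    (isClosed_le (h.continuous_scale _) continuous_const).measurableSet

theorem stepNorm_le_pow_level (h : IsAdapted T ν θ) (x : E d) :
    stepNorm T ν x ≤ |LinearMap.det (T : E d →ₗ[ℝ] E d)| ^ level T ν x := by
  have := stepNorm_le (h.scale_level x)
  rwa [zpow_natCast] at this

/-- At positive level both quantities coincide; the additive `1` pays for the truncation of `level`
at zero. -/
theorem pow_level_le [Nontrivial (E d)] (h : IsAdapted T ν θ) (x : E d) :
    |LinearMap.det (T : E d →ₗ[ℝ] E d)| ^ level T ν x ≤ stepNorm T ν x + 1 := by
  rcases Nat.eq_zero_or_eq_succ_pred (level T ν x) with h0 | h0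
  · rw [h0]; simp [stepNorm_nonneg]
  · have h1 := h.scale_level x
    have h2 : 1 < ν ((T ^ (-((level T ν x : ℤ) - 1))) x) := by
      have := (h.lt_level_iff (k := (level T ν x).pred) (x := x)).1 (by omega)
      convert this using 4
      omega
    rw [h.stepNorm_eq h1 h2, zpow_natCast]
    linarith

end IsAdapted

theorem isHomogeneousQuasiNorm_stepNorm {d : ℕ} [Nontrivial (E d)] {D : GL (Fin d) ℝ}
    {ν : Seminorm ℝ (E d)} {θ : ℝ} (h : IsAdapted (actEquiv D) ν θ) :
    IsHomogeneousQuasiNorm (D : Matrix (Fin d) (Fin d) ℝ) (stepNorm (actEquiv D) ν) where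
  measurable := h.measurable_stepNorm
  nonneg := stepNorm_nonneg _ _
  eq_zero_iff := h.stepNorm_eq_zero_iff
  dilation x := by
    rw [← det_act]
    exact h.stepNorm_apply x
  quasi_triangle := h.stepNorm_add_le

/-- The additive constant in coarse equivalence absorbs the truncation of levels at zero, so
multiplicative comparison of `|det| ^ level` is enough. -/
theorem coarselyEquivalent_of_level {d : ℕ} [Nontrivial (E d)] {D F : GL (Fin d) ℝ}
    {ν μ : Seminorm ℝ (E d)} {θ η : ℝ} (hD : IsAdapted (actEquiv D) ν θ)
    (hF : IsAdapted (actEquiv F) μ η)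
    (h₁ : ∃ C : ℝ, ∀ x, |LinearMap.det (actEquiv D : E d →ₗ[ℝ] E d)| ^ level (actEquiv D) ν x ≤
      C * |LinearMap.det (actEquiv F : E d →ₗ[ℝ] E d)| ^ level (actEquiv F) μ x)
    (h₂ : ∃ C : ℝ, ∀ x, |LinearMap.det (actEquiv F : E d →ₗ[ℝ] E d)| ^ level (actEquiv F) μ x ≤
      C * |LinearMap.det (actEquiv D : E d →ₗ[ℝ] E d)| ^ level (actEquiv D) ν x) :
    CoarselyEquivalent (D : Matrix (Fin d) (Fin d) ℝ) (F : Matrix (Fin d) (Fin d) ℝ) := by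
  obtain ⟨C₁, h₁⟩ := h₁
  obtain ⟨C₂, h₂⟩ := h₂
  refine ⟨_, _, isHomogeneousQuasiNorm_stepNorm hD, isHomogeneousQuasiNorm_stepNorm hF,
    1 + |C₁| + |C₂|, 1 + |C₁| + |C₂|, by positivity, by positivity, fun x => ⟨?_, ?_⟩⟩
  · have a1 := hD.stepNorm_le_pow_level x
    have a2 := hF.pow_level_le x
    have a3 := h₁ x
    set C := 1 + |C₁| + |C₂| with hC
    have hC1 : 1 ≤ C := by rw [hC]; linarith [abs_nonneg C₁, abs_nonneg C₂]
    have a4 : stepNorm (actEquiv D) ν x ≤ C * (stepNorm (actEquiv F) μ x + 1) := by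
      refine a1.trans (a3.trans ?_)
      gcongr
      rw [hC]; linarith [le_abs_self C₁, abs_nonneg C₂]
    rw [tsub_le_iff_right, one_div, inv_mul_le_iff₀ (by positivity)]
    nlinarith
  · have a1 := hF.stepNorm_le_pow_level x
    have a2 := hD.pow_level_le x
    have a3 := h₂ x
    set C := 1 + |C₁| + |C₂| with hC
    have a4 : stepNorm (actEquiv F) μ x ≤ C * (stepNorm (actEquiv D) ν x + 1) := by
      refine a1.trans (a3.trans ?_)
      gcongr
      rw [hC]; linarith [le_abs_self C₂, abs_nonneg C₁]
    linarith

/-- On the line a matrix acts as multiplication by its determinant, so the absolute value is a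
homogeneous quasi-norm for every matrix. This case is separate because shells on the line are
disconnected. -/
theorem coarselyEquivalent_of_le_one {d : ℕ} (hd : d ≤ 1) (M N : Matrix (Fin d) (Fin d) ℝ) :
    CoarselyEquivalent M N := by
  have key : ∀ M : Matrix (Fin d) (Fin d) ℝ, IsHomogeneousQuasiNorm M (fun x : E d => ‖x‖) := by
    intro M
    refine ⟨measurable_norm, fun x => norm_nonneg x, fun x => norm_eq_zero, fun x => ?_,
      1, one_pos, fun x y => by rw [one_mul]; exact norm_add_le x y⟩
    interval_cases d
    · simp [Subsingleton.elim x 0]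
    · simp [EuclideanSpace.norm_eq, act, Matrix.ofLp_toEuclideanCLM, Matrix.mulVec, dotProduct,
        Real.sqrt_sq_eq_abs, abs_mul]
  exact ⟨_, _, key M, key N, 1, 0, one_pos, le_rfl, fun x => by simp⟩

/-! ### Shells -/

/-- The closed shell between the spheres of levels `i` and `i + 1`. -/
def shell {d : ℕ} (T : E d ≃L[ℝ] E d) (ν : Seminorm ℝ (E d)) (i : ℕ) : Set (E d) :=
  {x | ν ((T ^ (-((i : ℤ) + 1))) x) ≤ 1 ∧ 1 ≤ ν ((T ^ (-(i : ℤ))) x)}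

namespace IsAdapted

variable {d : ℕ} {T : E d ≃L[ℝ] E d} {ν : Seminorm ℝ (E d)} {θ : ℝ}

theorem scale_succ_lt (h : IsAdapted T ν θ) (i : ℤ) {x : E d} (hx : x ≠ 0) :
    ν ((T ^ (-(i + 1))) x) < ν ((T ^ (-i)) x) := by
  have h1 := h.scale_le (k := i) (l := i + 1) 1 rfl x
  have h2 : 0 < ν ((T ^ (-i)) x) := h.pos_of_ne_zero (by simpa using hx)
  have := h.lt_one
  nlinarith

theorem ne_zero_of_mem_shell {i : ℕ} {x : E d} (hx : x ∈ shell T ν i) : x ≠ 0 := by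
  rintro rfl
  have := hx.2
  simp only [map_zero] at this
  linarith

theorem level_le_of_mem_shell (h : IsAdapted T ν θ) {i : ℕ} {x : E d} (hx : x ∈ shell T ν i) :
    level T ν x ≤ i + 1 :=
  h.level_le_iff.2 (by exact_mod_cast hx.1)

theorem le_level_of_mem_shell (h : IsAdapted T ν θ) {i : ℕ} {x : E d} (hx : x ∈ shell T ν i) :
    i ≤ level T ν x := by
  rcases i with _ | i
  · omega
  · refine Nat.succ_le_of_lt (h.lt_level_iff.2 (lt_of_le_of_lt hx.2 ?_))
    have := h.scale_succ_lt (i : ℤ) (ne_zero_of_mem_shell hx)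
    exact_mod_cast this

theorem mem_shell_of_level_eq (h : IsAdapted T ν θ) {i : ℕ} {x : E d} (hx : level T ν x = i + 1) :
    x ∈ shell T ν i := by
  refine ⟨?_, (h.lt_level_iff.1 (by omega)).le⟩
  have := h.level_le_iff.1 hx.le
  exact_mod_cast this

theorem mem_shell_of_scale_eq_one (h : IsAdapted T ν θ) {i : ℕ} {x : E d}
    (hx : ν ((T ^ (-(i : ℤ))) x) = 1) : x ∈ shell T ν i :=
  ⟨(h.scale_anti (by omega) x).trans hx.le, hx.ge⟩

theorem mem_shell_of_scale_succ_eq_one (h : IsAdapted T ν θ) {i : ℕ} {x : E d}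
    (hx : ν ((T ^ (-((i + 1 : ℕ) : ℤ))) x) = 1) : x ∈ shell T ν i :=
  ⟨by exact_mod_cast hx.le, hx.ge.trans (h.scale_anti (by omega) x)⟩

theorem level_of_scale_eq_one (h : IsAdapted T ν θ) {i : ℕ} {x : E d}
    (hx : ν ((T ^ (-(i : ℤ))) x) = 1) : level T ν x = i :=
  le_antisymm (h.level_le_iff.2 hx.le) (h.le_level_of_mem_shell (h.mem_shell_of_scale_eq_one hx))

theorem exists_scale_eq_one [Nontrivial (E d)] (h : IsAdapted T ν θ) (i : ℕ) :
    ∃ x, ν ((T ^ (-(i : ℤ))) x) = 1 := by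
  obtain ⟨y, hy⟩ := exists_ne (0 : E d)
  have h0 : 0 < ν ((T ^ (-(i : ℤ))) y) := h.pos_of_ne_zero (by simpa using hy)
  refine ⟨(ν ((T ^ (-(i : ℤ))) y))⁻¹ • y, ?_⟩
  rw [map_smul, map_smul_eq_mul, Real.norm_eq_abs, abs_of_pos (inv_pos.2 h0),
    inv_mul_cancel₀ h0.ne']

/-- The shell is a continuous radial image of the punctured space, which is connected when the
dimension exceeds one. -/
theorem isPreconnected_shell (h : IsAdapted T ν θ) (hd : 1 < Module.rank ℝ (E d)) (i : ℕ) :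
    IsPreconnected (shell T ν i) := by
  set a : E d → ℝ := fun x => ν ((T ^ (-(i : ℤ))) x) with ha
  set b : E d → ℝ := fun x => ν ((T ^ (-((i : ℤ) + 1))) x) with hb
  -- The multiples `s • x` with `s ≥ 0` that lie in the shell are those with `s` in `[1 / a x, 1 / b
  -- x]`; `t x` clamps `1` to this interval, hence equals `1` on the shell itself.
  set t : E d → ℝ := fun x => max (a x)⁻¹ (min 1 (b x)⁻¹) with ht
  have hac : Continuous a := h.continuous_scale _
  have hbc : Continuous b := h.continuous_scale _
  have ha0 : ∀ x, x ≠ 0 → 0 < a x := fun x hx => h.pos_of_ne_zero (by simpa using hx)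
  have hb0 : ∀ x, x ≠ 0 → 0 < b x := fun x hx => h.pos_of_ne_zero (by simpa using hx)
  have himg : shell T ν i = (fun x => t x • x) '' {0}ᶜ := by
    ext x
    constructor
    · intro hx
      have hx0 := ne_zero_of_mem_shell hx
      refine ⟨x, hx0, ?_⟩
      have h1 : 1 ≤ (b x)⁻¹ := (one_le_inv₀ (hb0 x hx0)).2 hx.1
      have h2 : (a x)⁻¹ ≤ 1 := inv_le_one_of_one_le₀ hx.2
      have : t x = 1 := by simp only [ht]; rw [min_eq_left h1, max_eq_right h2]
      simp [this]
    · rintro ⟨y, hy, rfl⟩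
      have hy0 : y ≠ 0 := hy
      have ht0 : 0 ≤ t y := le_max_of_le_left (inv_nonneg.2 (ha0 y hy0).le)
      have hlt : b y < a y := h.scale_succ_lt i hy0
      refine ⟨?_, ?_⟩
      · rw [map_smul, map_smul_eq_mul, Real.norm_eq_abs, abs_of_nonneg ht0]
        change t y * b y ≤ 1
        rw [← le_div_iff₀ (hb0 y hy0), one_div]
        exact max_le (inv_anti₀ (hb0 y hy0) hlt.le) (min_le_right _ _)
      · rw [map_smul, map_smul_eq_mul, Real.norm_eq_abs, abs_of_nonneg ht0]
        change 1 ≤ t y * a y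
        rw [← div_le_iff₀ (ha0 y hy0), one_div]
        exact le_max_left _ _
  rw [himg]
  refine (isPathConnected_compl_singleton_of_one_lt_rank hd 0).isConnected.isPreconnected.image _ ?_
  have htc : ContinuousOn t {0}ᶜ := by
    have h1 : ContinuousOn (fun x => (a x)⁻¹) {0}ᶜ :=
      ContinuousOn.inv₀ hac.continuousOn fun x hx => (ha0 x hx).ne'
    have h2 : ContinuousOn (fun x => (b x)⁻¹) {0}ᶜ :=
      ContinuousOn.inv₀ hbc.continuousOn fun x hx => (hb0 x hx).ne'
    exact ContinuousOn.sup h1 (ContinuousOn.inf continuousOn_const h2)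
  exact htc.smul continuousOn_id

theorem exists_level_le (h : IsAdapted T ν θ) (R : ℝ) :
    ∃ M : ℕ, ∀ x, ‖x‖ ≤ R → level T ν x ≤ M := by
  obtain ⟨C, hC, hu⟩ := h.upper
  have hl : Filter.Tendsto (fun n : ℕ => θ ^ n * (C * R)) Filter.atTop (nhds (0 * (C * R))) :=
    (tendsto_pow_atTop_nhds_zero_of_lt_one h.pos.le h.lt_one).mul_const _
  rw [zero_mul] at hl
  obtain ⟨n, hn⟩ := (hl.eventually_lt_const one_pos).exists
  refine ⟨n, fun x hx => h.level_le_iff.2 ((h.pow_contract n x).trans (le_trans ?_ hn.le))⟩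
  have := h.pos
  gcongr
  exact (hu x).trans (by gcongr)

theorem exists_norm_le (h : IsAdapted T ν θ) (k : ℕ) :
    ∃ R : ℝ, ∀ x, level T ν x ≤ k → ‖x‖ ≤ R := by
  obtain ⟨R, hR⟩ := (h.isCompact_level_le k).isBounded.exists_norm_le
  exact ⟨R, fun x hx => hR x hx⟩

end IsAdapted

/-! ### Comparison of levels -/

/-- The levels of the second automorphism vary by at most `N` on each shell of the first. -/
def Narrow {d : ℕ} (S T : E d ≃L[ℝ] E d) (ν μ : Seminorm ℝ (E d)) (N : ℕ) : Prop :=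
  ∀ i, ∀ x ∈ shell S ν i, ∀ y ∈ shell S ν i, level T μ y ≤ level T μ x + N

namespace Narrow

variable {d : ℕ} {S T : E d ≃L[ℝ] E d} {ν μ : Seminorm ℝ (E d)} {θ η : ℝ} {N : ℕ}

theorem mono {M : ℕ} (h : Narrow S T ν μ N) (hNM : N ≤ M) : Narrow S T ν μ M :=
  fun i x hx y hy => (h i x hx y hy).trans (by omega)

/-- The points `σ i` and `σ (i + 1)` lie in the common shell `i`, so each step along the chain
changes the other level by at most `N`. -/
theorem sphere (hn : Narrow S T ν μ N) (hS : IsAdapted S ν θ) {σ : ℕ → E d}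
    (hσ : ∀ i : ℕ, ν ((S ^ (-(i : ℤ))) (σ i)) = 1) (i n : ℕ) :
    level T μ (σ (i + n)) ≤ level T μ (σ i) + N * n ∧
      level T μ (σ i) ≤ level T μ (σ (i + n)) + N * n := by
  induction n with
  | zero => simp
  | succ n ih =>
    have h1 := hS.mem_shell_of_scale_eq_one (hσ (i + n))
    have h2 := hS.mem_shell_of_scale_succ_eq_one (hσ (i + n + 1))
    have h3 := hn _ _ h1 _ h2
    have h4 := hn _ _ h2 _ h1
    rw [← add_assoc, Nat.mul_succ]
    omega

/-- Level zero is excluded because the unit ball is not contained in a shell. -/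
theorem of_level_eq (hn : Narrow S T ν μ N) (hS : IsAdapted S ν θ) {σ : ℕ → E d}
    (hσ : ∀ i : ℕ, ν ((S ^ (-(i : ℤ))) (σ i)) = 1) {x : E d} (hx : level S ν x ≠ 0) :
    level T μ x ≤ level T μ (σ (level S ν x)) + N ∧
      level T μ (σ (level S ν x)) ≤ level T μ x + N := by
  obtain ⟨i, hi⟩ := Nat.exists_eq_succ_of_ne_zero hx
  have h1 := hS.mem_shell_of_level_eq hi
  have h2 : σ (level S ν x) ∈ shell S ν i :=
    hS.mem_shell_of_scale_succ_eq_one (by rw [hi]; exact hσ _)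
  exact ⟨hn _ _ h2 _ h1, hn _ _ h1 _ h2⟩

/-- The walk goes from `x` to the chain `σ`, then `n` steps along it, then to `y`: a cost of `N` for
each transfer and for each step. -/
theorem of_level_add (hn : Narrow S T ν μ N) [Nontrivial (E d)] (hS : IsAdapted S ν θ)
    {x y : E d} {n : ℕ} (hx : level S ν x ≠ 0) (hy : level S ν y = level S ν x + n) :
    level T μ y ≤ level T μ x + N * (n + 2) := by
  choose σ hσ using hS.exists_scale_eq_one
  have h1 := hn.of_level_eq hS hσ hx
  have h2 := hn.of_level_eq hS hσ (x := y) (by omega)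
  have h3 := hn.sphere hS hσ (level S ν x) n
  rw [hy] at h2
  rw [mul_add]
  omega

/-- Along the chain `σ` the `T`-level moves in steps of at most `N` and is unbounded. If it dropped
far below its value at `i₁`, it would later return close to that value; narrowness in the other
direction then forces the return, and hence the drop, to happen near `i₁`, where the level cannot
have changed much. -/
theorem exists_level_mono [Nontrivial (E d)] (hn : Narrow S T ν μ N) (hn' : Narrow T S μ ν N)
    (hS : IsAdapted S ν θ) (hT : IsAdapted T μ η) :
    ∃ K : ℕ, ∀ x y, level S ν y ≠ 0 → level S ν x ≤ level S ν y →
      level T μ x ≤ level T μ y + K := by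
  choose σ hσ using hS.exists_scale_eq_one
  have hσl : ∀ i, level S ν (σ i) = i := fun i => hS.level_of_scale_eq_one (hσ i)
  obtain ⟨R, hR⟩ := hS.exists_norm_le 0
  obtain ⟨M, hM⟩ := hT.exists_level_le R
  -- Sublevel sets of `T` are bounded, and on bounded sets the `S`-level is bounded, whereas `σ i`
  -- has `S`-level `i`.
  have hunb : ∀ m i₂ : ℕ, ∃ i, i₂ ≤ i ∧ m ≤ level T μ (σ i) := by
    intro m i₂
    obtain ⟨R', hR'⟩ := hT.exists_norm_le m
    obtain ⟨M', hM'⟩ := hS.exists_level_le R'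
    refine ⟨i₂ + M' + 1, by omega, ?_⟩
    by_contra! hlt
    have := hM' _ (hR' _ hlt.le)
    rw [hσl] at this
    omega
  have hmain : ∀ i₁ i₂ : ℕ, i₁ ≤ i₂ →
      level T μ (σ i₁) ≤ level T μ (σ i₂) + N * (N * (N + 2)) := by
    intro i₁ i₂ hi
    by_contra! hlt
    classical
    -- `i₃` is the first index from `i₂` on where the `T`-level is again at least its value at `i₁`.
    -- By minimality and the step bound it exceeds that value by at most `N`.
    have hex := hunb (level T μ (σ i₁)) i₂
    obtain ⟨hi3, hi3'⟩ := Nat.find_spec hex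
    set i₃ := Nat.find hex with hi₃
    have hne : i₃ ≠ i₂ := fun h => by rw [h] at hi3'; omega
    obtain ⟨j, hj⟩ := Nat.exists_eq_succ_of_ne_zero (show i₃ ≠ 0 by omega)
    have hlt3 : level T μ (σ j) < level T μ (σ i₁) := by
      by_contra! hle
      exact Nat.find_min hex (m := j) (by omega) ⟨by omega, hle⟩
    have hstep := (hn.sphere hS hσ j 1).1
    rw [show j + 1 = i₃ by omega] at hstep
    obtain ⟨n, hn3⟩ := Nat.exists_eq_add_of_le hi3'
    have h5 := hn'.of_level_add hT (x := σ i₁) (y := σ i₃) (n := n) (by omega) hn3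
    rw [hσl, hσl] at h5
    have hnN : n ≤ N := by omega
    have h6 : N * (n + 2) ≤ N * (N + 2) := Nat.mul_le_mul_left _ (by omega)
    obtain ⟨m, rfl⟩ := Nat.exists_eq_add_of_le hi
    have h7 := (hn.sphere hS hσ i₁ m).2
    have h8 : N * m ≤ N * (N * (N + 2)) := Nat.mul_le_mul_left _ (by omega)
    omega
  -- `M` handles points `x` of `S`-level zero, which form a bounded set; `2 * N` pays for passing
  -- from `x` and `y` to the chain.
  refine ⟨M + 2 * N + N * (N * (N + 2)), fun x y hy hxy => ?_⟩
  rcases Nat.eq_zero_or_pos (level S ν x) with h0 | h0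
  · have := hM x (hR x h0.le)
    omega
  · have h1 := hn.of_level_eq hS hσ (x := x) (by omega)
    have h2 := hn.of_level_eq hS hσ hy
    have h3 := hmain _ _ hxy
    omega

/-- Almost monotonicity places a sublevel set of `S` inside a sublevel set of `T` whose level is
larger by at most `K`. Their volumes are the powers of the determinants times fixed constants, so
the powers are comparable. -/
theorem exists_pow_le [Nontrivial (E d)] (hn : Narrow S T ν μ N) (hn' : Narrow T S μ ν N)
    (hS : IsAdapted S ν θ) (hT : IsAdapted T μ η) :
    ∃ C : ℝ, ∀ x, |LinearMap.det (S : E d →ₗ[ℝ] E d)| ^ level S ν x ≤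
      C * |LinearMap.det (T : E d →ₗ[ℝ] E d)| ^ level T μ x := by
  obtain ⟨K, hK⟩ := hn.exists_level_mono hn' hS hT
  have hdS := hS.one_lt_abs_det
  have hdT := hT.one_lt_abs_det
  set δ := |LinearMap.det (S : E d →ₗ[ℝ] E d)| with hδ
  set ε := |LinearMap.det (T : E d →ₗ[ℝ] E d)| with hε
  set a := (volume {x : E d | ν x ≤ 1}).toReal with ha
  set b := (volume {x : E d | μ x ≤ 1}).toReal with hb
  have ha0 : 0 < a := ENNReal.toReal_pos hS.volume_unitBall_pos.ne' hS.volume_unitBall_lt_top.ne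
  refine ⟨1 + a⁻¹ * (ε ^ K * b), fun x => ?_⟩
  have hb0 : 0 ≤ b := ENNReal.toReal_nonneg
  have h1 : 1 ≤ ε ^ level T μ x := one_le_pow₀ hdT.le
  have hnn : 0 ≤ a⁻¹ * (ε ^ K * b) := by positivity
  by_cases hx : level S ν x = 0
  · rw [hx, pow_zero]
    nlinarith
  · have hsub : {y | level S ν y ≤ level S ν x} ⊆ {y | level T μ y ≤ level T μ x + K} :=
      fun y hy => hK y x hx hy
    have hv := measure_mono (μ := (volume : Measure (E d))) hsub
    rw [hS.volume_level_le, hT.volume_level_le] at hv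
    have hv' := ENNReal.toReal_mono
      (ENNReal.mul_ne_top ENNReal.ofReal_ne_top hT.volume_unitBall_lt_top.ne) hv
    rw [ENNReal.toReal_mul, ENNReal.toReal_mul, ENNReal.toReal_ofReal (by positivity),
      ENNReal.toReal_ofReal (by positivity), ← ha, ← hb, ← hδ, ← hε, pow_add] at hv'
    calc δ ^ level S ν x ≤ (ε ^ level T μ x * ε ^ K * b) / a := by
          rwa [le_div_iff₀ ha0]
      _ = a⁻¹ * (ε ^ K * b) * ε ^ level T μ x := by field_simp
      _ ≤ _ := by nlinarith

end Narrow

theorem coarselyEquivalent_of_narrow {d : ℕ} [Nontrivial (E d)] {D F : GL (Fin d) ℝ}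
    {ν μ : Seminorm ℝ (E d)} {θ η : ℝ} (hD : IsAdapted (actEquiv D) ν θ)
    (hF : IsAdapted (actEquiv F) μ η)
    (h₁ : ∃ N, Narrow (actEquiv D) (actEquiv F) ν μ N)
    (h₂ : ∃ N, Narrow (actEquiv F) (actEquiv D) μ ν N) :
    CoarselyEquivalent (D : Matrix (Fin d) (Fin d) ℝ) (F : Matrix (Fin d) (Fin d) ℝ) := by
  obtain ⟨N, hN⟩ := h₁
  obtain ⟨M, hM⟩ := h₂
  have hN' := hN.mono (le_max_left N M)
  have hM' := hM.mono (le_max_right N M)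
  exact coarselyEquivalent_of_level hD hF (hN'.exists_pow_le hM' hD hF)
    (hM'.exists_pow_le hN' hF hD)

/-- If some shell of `S` meets very different levels of `T`, then it meets all the spheres of `T`
in between. -/
theorem exists_points_of_not_narrow {d : ℕ} {S T : E d ≃L[ℝ] E d} {ν μ : Seminorm ℝ (E d)}
    {θ η : ℝ} (hd : 1 < Module.rank ℝ (E d)) (hS : IsAdapted S ν θ) (hT : IsAdapted T μ η) {N : ℕ}
    (h : ¬ Narrow S T ν μ N) :
    ∃ i j₀ : ℕ, ∀ j, j₀ ≤ j → j < j₀ + N →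
      ∃ x ∈ shell S ν i, μ ((T ^ (-(j : ℤ))) x) = 1 := by
  simp only [Narrow, not_forall, not_le] at h
  obtain ⟨i, x, hx, y, hy, hlt⟩ := h
  refine ⟨i, level T μ x, fun j hj hj' => ?_⟩
  have h1 : μ ((T ^ (-(j : ℤ))) x) ≤ 1 := hT.level_le_iff.1 hj
  have h2 : 1 < μ ((T ^ (-(j : ℤ))) y) := hT.lt_level_iff.1 (by omega)
  -- The intermediate value theorem on the connected shell.
  obtain ⟨z, hz, hz'⟩ := (hS.isPreconnected_shell hd i).intermediate_value hx hy
    (hT.continuous_scale (-(j : ℤ))).continuousOn ⟨h1, h2.le⟩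
  exact ⟨z, hz, hz'⟩

/-! ### Fourier transforms of the dilates -/

/-- The transpose of an invertible matrix. -/
def transposeGL {d : ℕ} (A : GL (Fin d) ℝ) : GL (Fin d) ℝ where
  val := (A : Matrix (Fin d) (Fin d) ℝ).transpose
  inv := ((A⁻¹ : GL (Fin d) ℝ) : Matrix (Fin d) (Fin d) ℝ).transpose
  val_inv := by rw [← Matrix.transpose_mul, Units.inv_mul, Matrix.transpose_one]
  inv_val := by rw [← Matrix.transpose_mul, Units.mul_inv, Matrix.transpose_one]

theorem coe_transposeGL {d : ℕ} (A : GL (Fin d) ℝ) :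
    (transposeGL A : Matrix (Fin d) (Fin d) ℝ) = (A : Matrix (Fin d) (Fin d) ℝ).transpose := rfl

theorem isExpansive_transpose {d : ℕ} {M : Matrix (Fin d) (Fin d) ℝ} (hM : IsExpansive M) :
    IsExpansive M.transpose := by
  intro z hz
  apply hM z
  rw [spectrum.mem_iff, Matrix.isUnit_iff_isUnit_det] at hz ⊢
  rw [← Matrix.det_transpose] at hz
  convert hz using 3
  ext i j
  simp [Matrix.algebraMap_matrix_apply, eq_comm]

theorem inner_act {d : ℕ} (M : Matrix (Fin d) (Fin d) ℝ) (x y : E d) :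
    inner ℝ (act M x) y = inner ℝ x (act M.transpose y) := by
  simp only [EuclideanSpace.inner_eq_star_dotProduct, act, Matrix.ofLp_toEuclideanCLM, star_trivial]
  rw [Matrix.dotProduct_mulVec, Matrix.mulVec_transpose]

theorem act_transpose_zpow {d : ℕ} (A : GL (Fin d) ℝ) (k : ℤ) (ξ : E d) :
    act ((A : Matrix (Fin d) (Fin d) ℝ).transpose ^ k) ξ = (actEquiv (transposeGL A) ^ k) ξ := by
  rw [← actEquiv_zpow, actEquiv_apply, Matrix.coe_units_zpow, coe_transposeGL]

theorem inner_actEquiv_zpow {d : ℕ} (A : GL (Fin d) ℝ) (k : ℤ) (x y : E d) :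
    inner ℝ ((actEquiv A ^ k) x) y = inner ℝ x ((actEquiv (transposeGL A) ^ k) y) := by
  rw [← actEquiv_zpow, actEquiv_apply, inner_act, ← act_transpose_zpow, Matrix.coe_units_zpow,
    Matrix.transpose_zpow]

/-- The factor `|det A| ^ (i + 1)` cancels the Jacobian of `y = A ^ (i + 1) x`. Moving `A` across
the inner product is what makes the transpose govern frequency space. -/
theorem fourier_dilates_succ {d : ℕ} (A : GL (Fin d) ℝ) (φ Φ : 𝓢(E d, ℂ)) (i : ℕ) (ξ : E d) :
    (𝓕 (dilates A φ Φ (i + 1)) : 𝓢(E d, ℂ)) ξ =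
      (𝓕 φ : 𝓢(E d, ℂ)) ((actEquiv (transposeGL A) ^ (-((i : ℤ) + 1))) ξ) := by
  set L := actEquiv A ^ ((i : ℤ) + 1) with hL
  have hdet : LinearMap.det (L : E d →ₗ[ℝ] E d) = (A : Matrix (Fin d) (Fin d) ℝ).det ^ (i + 1) := by
    rw [hL, ← actEquiv_zpow]
    refine (det_act _).trans ?_
    rw [show ((i : ℤ) + 1) = ((i + 1 : ℕ) : ℤ) by push_cast; rfl, zpow_natCast, Units.val_pow_eq_pow_val,
      Matrix.det_pow]
  have hA0 : (A : Matrix (Fin d) (Fin d) ℝ).det ≠ 0 := by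
    have := (Matrix.isUnit_iff_isUnit_det _).1 A.isUnit
    exact this.ne_zero
  have hdet0 : LinearMap.det (L : E d →ₗ[ℝ] E d) ≠ 0 := by rw [hdet]; positivity
  have hval : ∀ x, dilates A φ Φ (i + 1) x =
      ((|(A : Matrix (Fin d) (Fin d) ℝ).det| ^ (i + 1) : ℝ) : ℂ) * φ (L x) := by
    intro x
    rw [dilates_succ_apply, hL, ← actEquiv_zpow, actEquiv_apply]
    congr 3
  rw [fourier_coe, fourier_coe, Real.fourier_eq, Real.fourier_eq]
  have hmap := Measure.map_linearMap_addHaar_eq_smul_addHaar (volume : Measure (E d)) hdet0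
  have hint : ∀ g : E d → ℂ, ∫ x, g (L x) = |(LinearMap.det (L : E d →ₗ[ℝ] E d))⁻¹| • ∫ y, g y := by
    intro g
    have h1 : ∫ y, g y ∂(Measure.map L volume) = ∫ x, g (L x) :=
      L.toHomeomorph.toMeasurableEquiv.measurableEmbedding.integral_map _
    rw [← h1]
    have h2 : Measure.map L (volume : Measure (E d)) = Measure.map (L : E d →ₗ[ℝ] E d) volume := rfl
    rw [h2, hmap, integral_smul_measure, ENNReal.toReal_ofReal (abs_nonneg _)]
  have h3 := hint (fun y => Real.fourierChar (-inner ℝ y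
    ((actEquiv (transposeGL A) ^ (-((i : ℤ) + 1))) ξ)) • φ y)
  have h4 : ∀ x, inner ℝ (L x) ((actEquiv (transposeGL A) ^ (-((i : ℤ) + 1))) ξ) = inner ℝ x ξ := by
    intro x
    rw [hL, inner_actEquiv_zpow, zpow_zpow_neg_apply]
  simp only [h4] at h3
  simp only [hval]
  have h5 : ∀ x : E d, Real.fourierChar (-inner ℝ x ξ) •
      (((|(A : Matrix (Fin d) (Fin d) ℝ).det| ^ (i + 1) : ℝ) : ℂ) * φ (L x)) =
      (|(A : Matrix (Fin d) (Fin d) ℝ).det| ^ (i + 1) : ℝ) •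
        (Real.fourierChar (-inner ℝ x ξ) • φ (L x)) := by
    intro x
    rw [Circle.smul_def, Circle.smul_def, smul_eq_mul, smul_eq_mul, Complex.real_smul]
    ring
  simp only [h5]
  rw [integral_smul, h3, hdet, smul_smul, abs_inv, abs_pow, mul_inv_cancel₀ (by positivity), one_smul]

theorem fourier_dilates_add {d : ℕ} (A : GL (Fin d) ℝ) (φ Φ : 𝓢(E d, ℂ)) (i n : ℕ) (ξ : E d) :
    (𝓕 (dilates A φ Φ (i + 1 + n)) : 𝓢(E d, ℂ)) ξ =
      (𝓕 (dilates A φ Φ (i + 1)) : 𝓢(E d, ℂ)) ((actEquiv (transposeGL A) ^ (-(n : ℤ))) ξ) := by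
  rw [show i + 1 + n = (i + n) + 1 by ring, fourier_dilates_succ, fourier_dilates_succ,
    ← zpow_add_apply]
  congr 3
  push_cast
  ring

/-! ### Families of kernels localized to the levels of an automorphism -/

/-- The Fourier transform of `u i` lives at levels close to `i`, is bounded uniformly in `i`, and
these Fourier transforms have no common approximate zeros. -/
structure IsScaleFamily {d : ℕ} (T : E d ≃L[ℝ] E d) (ν : Seminorm ℝ (E d))
    (u : ℕ → 𝓢(E d, ℂ)) (m : ℕ) (c M : ℝ) : Prop where
  pos : 0 < c
  localized : ∀ i ξ, (𝓕 (u i) : 𝓢(E d, ℂ)) ξ ≠ 0 → level T ν ξ ≤ i + m ∧ i ≤ level T ν ξ + m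
  bounded : ∀ i ξ, ‖(𝓕 (u i) : 𝓢(E d, ℂ)) ξ‖ ≤ M
  lower : ∀ ξ, ∃ i, c ≤ ‖(𝓕 (u i) : 𝓢(E d, ℂ)) ξ‖

theorem exists_norm_schwartz_le {d : ℕ} (f : 𝓢(E d, ℂ)) : ∃ M : ℝ, ∀ x, ‖f x‖ ≤ M := by
  obtain ⟨C, -, hC⟩ := f.decay 0 0
  exact ⟨C, fun x => by simpa using hC x⟩

theorem exists_norm_le_of_mem_openCube {d : ℕ} : ∃ R : ℝ, ∀ ξ ∈ openCube d, ‖ξ‖ ≤ R := by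
  refine ⟨Real.sqrt d, fun ξ hξ => ?_⟩
  rw [EuclideanSpace.norm_eq]
  refine Real.sqrt_le_sqrt ?_
  calc ∑ i, ‖ξ i‖ ^ 2 ≤ ∑ _i : Fin d, (1 : ℝ) := by
        refine Finset.sum_le_sum fun i _ => ?_
        have := hξ i
        rw [Real.norm_eq_abs, sq_abs]
        nlinarith
    _ = d := by simp

theorem IsAnalyzingPair.localized {d : ℕ} {A : GL (Fin d) ℝ} {φ Φ : 𝓢(E d, ℂ)}
    (hφ : IsAnalyzingPair A φ Φ) {ν : Seminorm ℝ (E d)} {θ : ℝ}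
    (hν : IsAdapted (actEquiv (transposeGL A)) ν θ) :
    ∃ m : ℕ, ∀ i ξ, (𝓕 (dilates A φ Φ i) : 𝓢(E d, ℂ)) ξ ≠ 0 →
      level (actEquiv (transposeGL A)) ν ξ ≤ i + m ∧
        i ≤ level (actEquiv (transposeGL A)) ν ξ + m := by
  set T := actEquiv (transposeGL A) with hT
  obtain ⟨R, hR⟩ := exists_norm_le_of_mem_openCube (d := d)
  obtain ⟨M, hM⟩ := hν.exists_level_le R
  have h0 : (0 : E d) ∉ tsupport (𝓕 φ : 𝓢(E d, ℂ)) := fun h => (hφ.tsupport_fourier h).2 rfl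
  obtain ⟨r, hr, hball⟩ := Metric.isOpen_iff.1 (isClosed_tsupport
    (𝓕 φ : 𝓢(E d, ℂ))).isOpen_compl 0 h0
  obtain ⟨c, hc, hlow⟩ := hν.lower
  -- On the support of `𝓕 φ` the adapted norm is at least `c * r > θ ^ n`, so a frequency seen by
  -- the kernel cannot have been contracted `n` times from inside the unit ball.
  obtain ⟨n, hn⟩ := exists_pow_lt_of_lt_one (mul_pos hc hr) hν.lt_one
  refine ⟨M + n, fun i ξ hne => ?_⟩
  rcases i with _ | i
  · have hmem : ξ ∈ tsupport (𝓕 Φ : 𝓢(E d, ℂ)) := subset_tsupport _ hne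
    have := hM ξ (hR _ (hφ.tsupport_fourier_zero hmem))
    omega
  · rw [fourier_dilates_succ, ← hT] at hne
    set ζ := (T ^ (-((i : ℤ) + 1))) ξ with hζ
    have hmem : ζ ∈ tsupport (𝓕 φ : 𝓢(E d, ℂ)) := subset_tsupport _ hne
    have h1 := hM ζ (hR _ (hφ.tsupport_fourier hmem).1)
    have h2 : r ≤ ‖ζ‖ := by
      by_contra! hlt
      exact hball (mem_ball_zero_iff.2 hlt) hmem
    have h3 : c * r ≤ ν ζ := (mul_le_mul_of_nonneg_left h2 hc.le).trans (hlow ζ)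
    constructor
    · rw [hν.level_le_iff] at h1 ⊢
      rw [hζ, ← zpow_add_apply] at h1
      refine le_trans (hν.scale_anti (k := M + (i + 1)) ?_ ξ) ?_
      · push_cast; omega
      · rw [neg_add]; exact h1
    · by_contra! hlt
      have h4 : level T ν ξ ≤ i + 1 - n := by omega
      have hni : n ≤ i + 1 := by omega
      have h5 := hν.level_le_iff.1 h4
      have h6 := hν.scale_le (k := ((i + 1 - n : ℕ) : ℤ)) (l := (i : ℤ) + 1) n (by omega) ξ
      have h7 : 0 < θ ^ n := pow_pos hν.pos n
      have : ν ζ ≤ θ ^ n * 1 := h6.trans (by gcongr)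
      linarith

theorem IsAnalyzingPair.exists_ne_zero {d : ℕ} {A : GL (Fin d) ℝ} {φ Φ : 𝓢(E d, ℂ)}
    (hφ : IsAnalyzingPair A φ Φ) (ξ : E d) :
    ∃ i, (𝓕 (dilates A φ Φ i) : 𝓢(E d, ℂ)) ξ ≠ 0 := by
  obtain ⟨i, hi⟩ := lt_iSup_iff.1 (hφ.nonvanishing ξ)
  rcases lt_max_iff.1 hi with h | h
  · refine ⟨i + 1, ?_⟩
    rw [fourier_dilates_succ, ← act_transpose_zpow]
    simpa using h
  · exact ⟨0, by simpa [dilates] using h⟩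

theorem exists_pos_le_of_isCompact {X : Type*} [TopologicalSpace X] {K : Set X} (hK : IsCompact K)
    {f : ℕ → X → ℝ} (hf : ∀ i, Continuous (f i)) (hpos : ∀ x ∈ K, ∃ i, 0 < f i x) :
    ∃ c : ℝ, 0 < c ∧ ∀ x ∈ K, ∃ i, c ≤ f i x := by
  obtain ⟨n, hn⟩ := hK.elim_directed_cover (fun n : ℕ => ⋃ i, {x | 1 / ((n : ℝ) + 1) < f i x})
    (fun n => isOpen_iUnion fun i => isOpen_lt continuous_const (hf i))
    (fun x hx => by
      obtain ⟨i, hi⟩ := hpos x hx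
      obtain ⟨n, hn⟩ := exists_nat_one_div_lt hi
      exact Set.mem_iUnion.2 ⟨n, Set.mem_iUnion.2 ⟨i, hn⟩⟩)
    (directed_of_isDirected_le fun n k hnk => Set.iUnion_mono fun i x hx => by
      rw [Set.mem_ofPred_eq] at hx ⊢
      exact lt_of_le_of_lt (Nat.one_div_le_one_div hnk) hx)
  refine ⟨1 / ((n : ℝ) + 1), by positivity, fun x hx => ?_⟩
  obtain ⟨i, hi⟩ := Set.mem_iUnion.1 (hn hx)
  exact ⟨i, le_of_lt hi⟩

/-- Up to level `m + 1` the lower bound follows from compactness and nonvanishing; higher levels are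
reduced to level `m + 1` by dilation. -/
theorem IsAnalyzingPair.exists_isScaleFamily {d : ℕ} {A : GL (Fin d) ℝ} {φ Φ : 𝓢(E d, ℂ)}
    (hφ : IsAnalyzingPair A φ Φ) {ν : Seminorm ℝ (E d)} {θ : ℝ}
    (hν : IsAdapted (actEquiv (transposeGL A)) ν θ) :
    ∃ m c M, IsScaleFamily (actEquiv (transposeGL A)) ν (dilates A φ Φ) m c M := by
  obtain ⟨m, hm⟩ := hφ.localized hν
  set T := actEquiv (transposeGL A) with hT
  obtain ⟨c, hc, hlow⟩ := exists_pos_le_of_isCompact (hν.isCompact_level_le (m + 1))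
    (f := fun i ξ => ‖(𝓕 (dilates A φ Φ i) : 𝓢(E d, ℂ)) ξ‖) (fun i => (SchwartzMap.continuous _).norm)
    (fun ξ _ => by
      obtain ⟨i, hi⟩ := hφ.exists_ne_zero ξ
      exact ⟨i, norm_pos_iff.2 hi⟩)
  obtain ⟨M₁, hM₁⟩ := exists_norm_schwartz_le (𝓕 φ : 𝓢(E d, ℂ))
  obtain ⟨M₂, hM₂⟩ := exists_norm_schwartz_le (𝓕 Φ : 𝓢(E d, ℂ))
  refine ⟨m, c, max M₁ M₂, hc, hm, fun i ξ => ?_, fun ξ => ?_⟩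
  · rcases i with _ | i
    · exact (hM₂ ξ).trans (le_max_right _ _)
    · rw [fourier_dilates_succ]
      exact (hM₁ _).trans (le_max_left _ _)
  · rcases le_or_gt (level T ν ξ) (m + 1) with h | h
    · exact hlow ξ h
    · obtain ⟨n, hn⟩ := Nat.exists_eq_add_of_lt h
      have h1 : level T ν ((T ^ (-((n + 1 : ℕ) : ℤ))) ξ) ≤ m + 1 := by
        rw [hν.level_le_iff, ← zpow_add_apply]
        have := hν.scale_level ξ
        rw [hn] at this
        convert this using 4
        push_cast
        ring
      have h2 : m + 1 ≤ level T ν ((T ^ (-((n + 1 : ℕ) : ℤ))) ξ) := by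
        refine Nat.succ_le_of_lt (hν.lt_level_iff.2 ?_)
        rw [← zpow_add_apply]
        have := (hν.lt_level_iff (x := ξ) (k := m + n + 1)).1 (by omega)
        convert this using 4
        push_cast
        ring
      obtain ⟨i, hi⟩ := hlow _ h1
      have hi0 : (𝓕 (dilates A φ Φ i) : 𝓢(E d, ℂ)) ((T ^ (-((n + 1 : ℕ) : ℤ))) ξ) ≠ 0 :=
        norm_pos_iff.1 (hc.trans_le hi)
      -- The contracted frequency has level `m + 1`, beyond the reach of `Φ`. The index detecting it
      -- is therefore positive and can be shifted by `n + 1`.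
      rcases i with _ | i
      · have := (hm _ _ hi0).1
        omega
      · exact ⟨i + 1 + (n + 1), by rw [fourier_dilates_add]; exact hi⟩

/-! ### Separated frequencies -/

/-- Frequencies `ξ k` lying on one common scale of the family `u`, and on pairwise different
scales of the family `v`, all of them beyond `lo`. -/
structure SeparatedFrequencies {d : ℕ} (u v : ℕ → 𝓢(E d, ℂ)) (m : ℕ) (c c' : ℝ) (lo N : ℕ)
    (ξ : Fin N → E d) (r : ℝ) (i₁ : ℕ) (j : Fin N → ℕ) (I : Finset ℕ) (J : Fin N → Finset ℕ) :
    Prop where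
  pos : 0 < r
  lower_left : ∀ k, c ≤ ‖(𝓕 (u i₁) : 𝓢(E d, ℂ)) (ξ k)‖
  lower_right : ∀ k, c' ≤ ‖(𝓕 (v (j k)) : 𝓢(E d, ℂ)) (ξ k)‖
  support_left : ∀ k, ∀ ζ ∈ Metric.ball (ξ k) r, ∀ i, (𝓕 (u i) : 𝓢(E d, ℂ)) ζ ≠ 0 → i ∈ I
  support_right : ∀ k, ∀ ζ ∈ Metric.ball (ξ k) r, ∀ l, (𝓕 (v l) : 𝓢(E d, ℂ)) ζ ≠ 0 → l ∈ J k
  card_left : I.card ≤ m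
  card_right : ∀ k, (J k).card ≤ m
  disjoint : ∀ k l, k ≠ l → Disjoint (J k) (J l)
  lt_left : ∀ i ∈ I, lo < i
  lt_right : ∀ k, ∀ l ∈ J k, lo < l

/-- Sublevel sets are closed, so `level` is lower semicontinuous; strict contraction between
consecutive scales limits its upward jumps to one. -/
theorem IsAdapted.exists_ball_level {d : ℕ} {T : E d ≃L[ℝ] E d} {ν : Seminorm ℝ (E d)} {θ : ℝ}
    (h : IsAdapted T ν θ) {ξ : E d} (hξ : ξ ≠ 0) :
    ∃ r : ℝ, 0 < r ∧ ∀ ζ ∈ Metric.ball ξ r,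
      level T ν ξ ≤ level T ν ζ ∧ level T ν ζ ≤ level T ν ξ + 1 := by
  have h1 : ∀ᶠ ζ in nhds ξ, level T ν ζ ≤ level T ν ξ + 1 := by
    have hlt : ν ((T ^ (-((level T ν ξ : ℤ) + 1))) ξ) < 1 :=
      (h.scale_succ_lt _ hξ).trans_le (h.scale_level ξ)
    filter_upwards [(h.continuous_scale _).continuousAt.eventually_lt continuousAt_const hlt]
      with ζ hζ
    exact h.level_le_iff.2 (by exact_mod_cast hζ.le)
  have h2 : ∀ᶠ ζ in nhds ξ, level T ν ξ ≤ level T ν ζ := by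
    rcases Nat.eq_zero_or_eq_succ_pred (level T ν ξ) with h0 | h0
    · exact Filter.Eventually.of_forall fun ζ => by omega
    · have hlt := (h.lt_level_iff (k := (level T ν ξ).pred) (x := ξ)).1 (by omega)
      filter_upwards [continuousAt_const.eventually_lt (h.continuous_scale _).continuousAt hlt]
        with ζ hζ
      have := h.lt_level_iff.2 hζ
      omega
  obtain ⟨r, hr, hb⟩ := Metric.eventually_nhds_iff_ball.1 (h2.and h1)
  exact ⟨r, hr, hb⟩

/-- A shell of `S` meeting very distant levels of `T` supplies many points at equally spaced
`T`-levels. Only boundedly many indices of `u` can detect points of this shell, so by pigeonhole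
many of the points share one detecting index. -/
theorem exists_separatedFrequencies {d : ℕ} {S T : E d ≃L[ℝ] E d} {ν μ : Seminorm ℝ (E d)}
    {θ η : ℝ} (hd : 1 < Module.rank ℝ (E d)) (hS : IsAdapted S ν θ) (hT : IsAdapted T μ η)
    {u v : ℕ → 𝓢(E d, ℂ)} {m m' : ℕ} {c c' M M' : ℝ} (hu : IsScaleFamily S ν u m c M)
    (hv : IsScaleFamily T μ v m' c' M') (hn : ∀ N, ¬ Narrow S T ν μ N) (lo : ℕ) {N : ℕ} (hN : 0 < N) :
    ∃ ξ r i₁ j I J, SeparatedFrequencies u v (2 * m + 2 * m' + 5) c c' lo N ξ r i₁ j I J := by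
  obtain ⟨R, hR⟩ := hS.exists_norm_le (lo + m + 1)
  obtain ⟨L₀, hL₀⟩ := hT.exists_level_le R
  -- The offset `L` puts the indices of `v` beyond `lo`. It also exceeds every `T`-level on the
  -- bounded set of `S`-levels at most `lo + m + 1`, which forces `lo + m < i₀`.
  set L := L₀ + lo + m' + 1 with hL
  -- The spacing exceeds the length of the index windows `[l - m', l + 1 + m']`, which makes them
  -- disjoint.
  set s := 2 * m' + 3 with hs
  set P := (2 * m + 3) * N with hP
  obtain ⟨i₀, j₀, hpts⟩ := exists_points_of_not_narrow hd hS hT (hn (L + s * P))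
  have hex : ∀ t : Fin P, ∃ x ∈ shell S ν i₀, μ ((T ^ (-((j₀ + L + s * t : ℕ) : ℤ))) x) = 1 := by
    intro t
    refine hpts _ (by omega) ?_
    have h1 : s * (t : ℕ) < s * P := Nat.mul_lt_mul_of_pos_left t.2 (by omega)
    omega
  choose x hxs hx1 using hex
  have hlT : ∀ t, level T μ (x t) = j₀ + L + s * t := fun t => hT.level_of_scale_eq_one (hx1 t)
  have hi₀ : ∀ t : Fin P, lo + m < i₀ := by
    intro t
    by_contra! hle
    have h1 := hS.level_le_of_mem_shell (hxs t)
    have h2 := hL₀ _ (hR (x t) (by omega))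
    rw [hlT] at h2
    omega
  choose α hα using fun t => hu.lower (x t)
  choose β hβ using fun t => hv.lower (x t)
  set I : Finset ℕ := Finset.Icc (i₀ - m) (i₀ + 2 + m) with hI
  have hαI : ∀ t, α t ∈ Finset.Icc (i₀ - m) (i₀ + 1 + m) := by
    intro t
    have h0 : (𝓕 (u (α t)) : 𝓢(E d, ℂ)) (x t) ≠ 0 := norm_pos_iff.1 (hu.pos.trans_le (hα t))
    have h1 := hu.localized _ _ h0
    have h2 := hS.level_le_of_mem_shell (hxs t)
    have h3 := hS.le_level_of_mem_shell (hxs t)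
    rw [Finset.mem_Icc]
    omega
  -- At most `2 * m + 2` indices are possible for `(2 * m + 3) * N` points, so some index is shared
  -- by at least `N` of them.
  obtain ⟨i₁, -, hi₁⟩ := Finset.exists_le_card_fiber_of_mul_le_card_of_maps_to
    (s := (Finset.univ : Finset (Fin P))) (t := Finset.Icc (i₀ - m) (i₀ + 1 + m)) (n := N) (f := α)
    (fun t _ => hαI t) ⟨i₀, by rw [Finset.mem_Icc]; omega⟩ (by
      rw [Finset.card_univ, Fintype.card_fin, Nat.card_Icc, hP]
      exact Nat.mul_le_mul_right _ (by omega))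
  obtain ⟨F, hF, hFc⟩ := Finset.exists_subset_card_eq hi₁
  set e : Fin N ≃ F := (F.equivFinOfCardEq hFc).symm with he
  have hinj : ∀ k l : Fin N, k ≠ l → ((e k : Fin P) : ℕ) ≠ (e l : Fin P) := by
    intro k l hkl h
    exact hkl (e.injective (Subtype.ext (Fin.ext h)))
  have hball : ∀ k : Fin N, ∃ r : ℝ, 0 < r ∧ ∀ ζ ∈ Metric.ball (x (e k)) r,
      (level S ν (x (e k)) ≤ level S ν ζ ∧ level S ν ζ ≤ level S ν (x (e k)) + 1) ∧
      (level T μ (x (e k)) ≤ level T μ ζ ∧ level T μ ζ ≤ level T μ (x (e k)) + 1) := by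
    intro k
    have h0 := IsAdapted.ne_zero_of_mem_shell (hxs (e k))
    obtain ⟨r₁, hr₁, hb₁⟩ := hS.exists_ball_level h0
    obtain ⟨r₂, hr₂, hb₂⟩ := hT.exists_ball_level h0
    exact ⟨min r₁ r₂, lt_min hr₁ hr₂, fun ζ hζ =>
      ⟨hb₁ ζ (Metric.ball_subset_ball (min_le_left _ _) hζ),
        hb₂ ζ (Metric.ball_subset_ball (min_le_right _ _) hζ)⟩⟩
  choose r hr hrb using hball
  obtain ⟨r₀, hr₀, hr₀'⟩ : ∃ r₀ : ℝ, (∀ k, r₀ ≤ r k) ∧ 0 < r₀ := by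
    have h1 : ∀ᶠ t in nhdsWithin (0 : ℝ) (Set.Ioi 0), ∀ k, t ≤ r k :=
      Filter.eventually_all.2 fun k => by
        filter_upwards [Ioo_mem_nhdsGT (hr k)] with t ht
        exact ht.2.le
    exact (h1.and self_mem_nhdsWithin).exists
  refine ⟨fun k => x (e k), r₀, i₁, fun k => β (e k), I,
    fun k => Finset.Icc (level T μ (x (e k)) - m') (level T μ (x (e k)) + 1 + m'),
    ⟨hr₀', fun k => ?_, fun k => hβ _, fun k ζ hζ i hne => ?_, fun k ζ hζ l hne => ?_, ?_,
      fun k => ?_, fun k l hkl => ?_, fun i hi => ?_, fun k l hl => ?_⟩⟩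
  · have := (Finset.mem_filter.1 (hF (e k).2)).2
    rw [← this]
    exact hα _
  · have h1 := (hrb k ζ (Metric.ball_subset_ball (hr₀ k) hζ)).1
    have h2 := hu.localized _ _ hne
    have h3 := hS.level_le_of_mem_shell (hxs (e k))
    have h4 := hS.le_level_of_mem_shell (hxs (e k))
    rw [hI, Finset.mem_Icc]
    omega
  · have h1 := (hrb k ζ (Metric.ball_subset_ball (hr₀ k) hζ)).2
    have h2 := hv.localized _ _ hne
    rw [Finset.mem_Icc]
    omega
  · rw [hI, Nat.card_Icc]
    omega
  · rw [Nat.card_Icc]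
    omega
  · rw [Finset.disjoint_left]
    intro a ha ha'
    rw [Finset.mem_Icc, hlT] at ha ha'
    rcases lt_or_gt_of_ne (hinj k l hkl) with h | h
    · have : s * ((e k : Fin P) + 1 : ℕ) ≤ s * (e l : Fin P) := Nat.mul_le_mul_left _ h
      rw [Nat.mul_succ] at this
      omega
    · have : s * ((e l : Fin P) + 1 : ℕ) ≤ s * (e k : Fin P) := Nat.mul_le_mul_left _ h
      rw [Nat.mul_succ] at this
      omega
  · rw [hI, Finset.mem_Icc] at hi
    have := hi₀ (e ⟨0, hN⟩)
    omega
  · rw [Finset.mem_Icc, hlT] at hl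
    omega

/-! ### Wave packets -/

/-- The inverse Fourier transform of a nonnegative bump; its value at the origin is the integral of
the bump. -/
theorem exists_bandlimited (d : ℕ) :
    ∃ η : 𝓢(E d, ℂ), η 0 ≠ 0 ∧ ∀ ω, (𝓕 η : 𝓢(E d, ℂ)) ω ≠ 0 → ‖ω‖ < 1 := by
  let f : ContDiffBump (0 : E d) := ⟨1 / 4, 1 / 2, by norm_num, by norm_num⟩
  have hsm : ContDiff ℝ ((⊤ : ℕ∞) : WithTop ℕ∞) (fun x => ((f x : ℝ) : ℂ)) :=
    Complex.ofRealCLM.contDiff.comp f.contDiff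
  have hcs : HasCompactSupport (fun x => ((f x : ℝ) : ℂ)) :=
    f.hasCompactSupport.comp_left Complex.ofReal_zero
  let θ : 𝓢(E d, ℂ) := hcs.toSchwartzMap hsm
  have hθ : ∀ x, θ x = ((f x : ℝ) : ℂ) := fun x => rfl
  refine ⟨𝓕⁻ θ, ?_, fun ω hω => ?_⟩
  · rw [fourierInv_coe, Real.fourierInv_eq]
    simp only [inner_zero_right, AddChar.map_zero_eq_one, one_smul, hθ]
    rw [integral_complex_ofReal]
    exact_mod_cast f.integral_pos.ne'
  · rw [fourier_fourierInv_eq, hθ] at hω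
    have h1 : ω ∈ Function.support f := by
      simpa using hω
    rw [f.support_eq, mem_ball_zero_iff] at h1
    exact h1.trans (show (1 / 2 : ℝ) < 1 by norm_num)

/-- The wave packet `y ↦ e^{2πi y·ξ} η(δ y)`. -/
def packet {d : ℕ} (η : 𝓢(E d, ℂ)) (δ : ℝ) (ξ y : E d) : ℂ :=
  Real.fourierChar (inner ℝ y ξ) * η (δ • y)

/-- The convolution of a function with a Schwartz function. -/
def cv {d : ℕ} (h : E d → ℂ) (w : 𝓢(E d, ℂ)) (x : E d) : ℂ := ∫ y, h y * w (x - y)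

theorem continuous_packet {d : ℕ} (η : 𝓢(E d, ℂ)) (δ : ℝ) (ξ : E d) :
    Continuous (packet η δ ξ) := by
  unfold packet
  have h1 : Continuous fun y : E d => ((Real.fourierChar (inner ℝ y ξ) : Circle) : ℂ) :=
    continuous_subtype_val.comp (Real.continuous_fourierChar.comp (by fun_prop))
  have h2 : Continuous fun y : E d => η (δ • y) := η.continuous.comp (by fun_prop)
  exact h1.mul h2

theorem norm_packet {d : ℕ} (η : 𝓢(E d, ℂ)) (δ : ℝ) (ξ y : E d) :
    ‖packet η δ ξ y‖ = ‖η (δ • y)‖ := by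
  rw [packet, norm_mul, Circle.norm_coe, one_mul]

theorem cv_packet {d : ℕ} (η : 𝓢(E d, ℂ)) (δ : ℝ) (ξ : E d) (w : 𝓢(E d, ℂ)) (x : E d) :
    cv (packet η δ ξ) w x = Real.fourierChar (inner ℝ x ξ) *
      ∫ z, (Real.fourierChar (-inner ℝ z ξ) * w z) * η (δ • (x - z)) := by
  rw [cv, ← integral_sub_left_eq_self _ volume x, ← integral_const_mul]
  refine integral_congr_ae (Filter.Eventually.of_forall fun z => ?_)
  simp only [packet, sub_sub_cancel, inner_sub_left, sub_eq_add_neg (inner ℝ x ξ),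
    AddChar.map_add_eq_mul, Circle.coe_mul]
  ring

/-- The packet has spectrum in the ball of radius `δ` about `ξ`. With `η` written by Fourier
inversion, the symmetry `∫ ĝ F = ∫ g F̂` for the form `δ⟨·,·⟩` turns the convolution into an
integral of `𝓕 w (ξ + δ • ω)` against `𝓕 η ω`, where one factor always vanishes. -/
theorem cv_packet_eq_zero {d : ℕ} {η : 𝓢(E d, ℂ)}
    (hη : ∀ ω, (𝓕 η : 𝓢(E d, ℂ)) ω ≠ 0 → ‖ω‖ < 1) {δ : ℝ} (hδ : 0 < δ) {ξ : E d}
    {w : 𝓢(E d, ℂ)} (hw : ∀ ζ ∈ Metric.ball ξ δ, (𝓕 w : 𝓢(E d, ℂ)) ζ = 0) (x : E d) :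
    cv (packet η δ ξ) w x = 0 := by
  set F : E d → ℂ := fun ω => Real.fourierChar (inner ℝ ω (δ • x)) * (𝓕 η : 𝓢(E d, ℂ)) ω with hF
  set g : E d → ℂ := fun z => Real.fourierChar (-inner ℝ z ξ) * w z with hg
  have hgi : Integrable g := by
    refine (w.integrable (μ := volume)).norm.mono' ?_ (Filter.Eventually.of_forall fun z => ?_)
    · refine Continuous.aestronglyMeasurable (Continuous.mul ?_ w.continuous)
      exact continuous_subtype_val.comp (Real.continuous_fourierChar.comp (by fun_prop))
    · rw [hg, norm_mul, Circle.norm_coe, one_mul]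
  have hFi : Integrable F := by
    refine ((𝓕 η : 𝓢(E d, ℂ)).integrable (μ := volume)).norm.mono' ?_
      (Filter.Eventually.of_forall fun z => ?_)
    · refine Continuous.aestronglyMeasurable (Continuous.mul ?_ (𝓕 η : 𝓢(E d, ℂ)).continuous)
      exact continuous_subtype_val.comp (Real.continuous_fourierChar.comp (by fun_prop))
    · rw [hF, norm_mul, Circle.norm_coe, one_mul]
  have hflip := VectorFourier.integral_fourierIntegral_smul_eq_flip (e := Real.fourierChar)
    (μ := (volume : Measure (E d))) (ν := (volume : Measure (E d))) (L := δ • innerₗ (E d))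
    Real.continuous_fourierChar (by
      simp only [LinearMap.smul_apply, innerₗ_apply_apply]
      fun_prop) hgi hFi
  have hL : ∀ ω, VectorFourier.fourierIntegral Real.fourierChar volume (δ • innerₗ (E d)) g ω =
      (𝓕 w : 𝓢(E d, ℂ)) (ξ + δ • ω) := by
    intro ω
    rw [fourier_coe, Real.fourier_eq, VectorFourier.fourierIntegral]
    refine integral_congr_ae (Filter.Eventually.of_forall fun z => ?_)
    simp only [hg, LinearMap.smul_apply, innerₗ_apply_apply, Circle.smul_def, smul_eq_mul,
      inner_add_right, inner_smul_right, neg_add, AddChar.map_add_eq_mul, Circle.coe_mul]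
    ring
  have hR : ∀ z, VectorFourier.fourierIntegral Real.fourierChar volume (δ • innerₗ (E d)).flip F z =
      η (δ • (x - z)) := by
    intro z
    have h1 : η (δ • (x - z)) = (𝓕⁻ (𝓕 η : 𝓢(E d, ℂ)) : 𝓢(E d, ℂ)) (δ • (x - z)) := by
      rw [fourierInv_fourier_eq]
    rw [h1, fourierInv_coe, Real.fourierInv_eq, VectorFourier.fourierIntegral]
    refine integral_congr_ae (Filter.Eventually.of_forall fun ω => ?_)
    simp only [hF, LinearMap.flip_apply, LinearMap.smul_apply, innerₗ_apply_apply, Circle.smul_def,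
      smul_eq_mul, inner_smul_right, sub_eq_add_neg, inner_add_right, inner_neg_right, mul_add,
      mul_neg, AddChar.map_add_eq_mul, Circle.coe_mul, real_inner_comm ω z]
    ring
  simp only [hL, hR] at hflip
  rw [cv_packet]
  have h0 : ∫ z, (Real.fourierChar (-inner ℝ z ξ) * w z) * η (δ • (x - z)) = 0 := by
    refine hflip.symm.trans (integral_eq_zero_of_ae (Filter.Eventually.of_forall fun ω => ?_))
    change (𝓕 w : 𝓢(E d, ℂ)) (ξ + δ • ω) • F ω = 0
    by_cases h : (𝓕 η : 𝓢(E d, ℂ)) ω = 0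
    · simp [hF, h]
    · rw [hw, zero_smul]
      rw [mem_ball_iff_norm, add_sub_cancel_left, norm_smul, Real.norm_eq_abs, abs_of_pos hδ]
      exact mul_lt_of_lt_one_right hδ (hη ω h)
  rw [h0, mul_zero]

theorem exists_decay {d : ℕ} (f : 𝓢(E d, ℂ)) (L : ℕ) :
    ∃ C : ℝ, 0 < C ∧ (∀ x, ‖f x‖ ≤ C / (1 + ‖x‖) ^ L) ∧
      ∀ x, ‖fderiv ℝ f x‖ ≤ C / (1 + ‖x‖) ^ L := by
  set C := 2 ^ L * ((Finset.Iic (L, 1)).sup fun m => SchwartzMap.seminorm ℝ m.1 m.2) f with hC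
  have h0 : 0 ≤ C := by positivity
  refine ⟨C + 1, by positivity, fun x => ?_, fun x => ?_⟩
  · have := f.one_add_le_sup_seminorm_apply (𝕜 := ℝ) (m := (L, 1)) (k := L) (n := 0) le_rfl
      (by norm_num) x
    rw [norm_iteratedFDeriv_zero] at this
    rw [le_div_iff₀ (by positivity)]
    linarith
  · have := f.one_add_le_sup_seminorm_apply (𝕜 := ℝ) (m := (L, 1)) (k := L) (n := 1) le_rfl
      le_rfl x
    rw [← norm_fderiv_iteratedFDeriv] at this
    rw [le_div_iff₀ (by positivity)]
    have h2 : ‖fderiv ℝ (iteratedFDeriv ℝ 0 f) x‖ = ‖fderiv ℝ f x‖ := by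
      rw [norm_fderiv_iteratedFDeriv, norm_iteratedFDeriv_one]
    rw [h2] at this
    linarith

/-- Mean value inequality on the ball of radius `‖v‖` about `u`; decay at nearby points becomes
decay at `u` through `1 + ‖u‖ ≤ (1 + ‖x‖) * (1 + ‖v‖)`. -/
theorem exists_norm_sub_le {d : ℕ} (f : 𝓢(E d, ℂ)) (L : ℕ) :
    ∃ C : ℝ, 0 < C ∧ ∀ u v, ‖f (u - v) - f u‖ ≤ C * ‖v‖ * (1 + ‖v‖) ^ L / (1 + ‖u‖) ^ L := by
  obtain ⟨C, hC, -, hd⟩ := exists_decay f L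
  refine ⟨C, hC, fun u v => ?_⟩
  have hb : ∀ x ∈ Metric.closedBall u ‖v‖, ‖fderiv ℝ f x‖ ≤ C * (1 + ‖v‖) ^ L / (1 + ‖u‖) ^ L := by
    intro x hx
    refine (hd x).trans ?_
    rw [div_le_div_iff₀ (by positivity) (by positivity), mul_assoc, ← mul_pow]
    gcongr
    rw [mem_closedBall_iff_norm'] at hx
    have h1 : ‖u‖ ≤ ‖x‖ + ‖v‖ := by
      have := norm_add_le x (u - x)
      rw [add_sub_cancel] at this
      linarith
    nlinarith [norm_nonneg x, norm_nonneg v]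
  have h := (convex_closedBall u ‖v‖).norm_image_sub_le_of_norm_fderiv_le
    (fun x _ => f.differentiableAt) hb (Metric.mem_closedBall_self (norm_nonneg v))
    (show u - v ∈ Metric.closedBall u ‖v‖ by simp)
  refine h.trans (le_of_eq ?_)
  rw [sub_sub_cancel_left, norm_neg]
  ring

theorem integrable_one_add_pow_mul {d : ℕ} (w : 𝓢(E d, ℂ)) (L : ℕ) :
    Integrable fun z => (1 + ‖z‖) ^ L * ‖w z‖ := by
  have h1 := (w.integrable_pow_mul volume L).add (w.integrable_pow_mul volume 0)
  refine (h1.const_mul (2 ^ L)).mono' ?_ (Filter.Eventually.of_forall fun z => ?_)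
  · exact Continuous.aestronglyMeasurable (by have := w.continuous; fun_prop)
  · rw [Real.norm_eq_abs, abs_of_nonneg (by positivity)]
    simp only [Pi.add_apply, pow_zero, one_mul]
    have h2 : (1 + ‖z‖) ^ L ≤ 2 ^ L * (‖z‖ ^ L + 1) := by
      rcases le_total ‖z‖ 1 with h | h
      · calc (1 + ‖z‖) ^ L ≤ 2 ^ L := by gcongr; linarith
          _ ≤ _ := le_mul_of_one_le_right (by positivity) (by linarith [pow_nonneg (norm_nonneg z) L])
      · calc (1 + ‖z‖) ^ L ≤ (2 * ‖z‖) ^ L := by gcongr; linarith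
          _ = 2 ^ L * ‖z‖ ^ L := mul_pow _ _ _
          _ ≤ _ := by gcongr; linarith
    calc (1 + ‖z‖) ^ L * ‖w z‖ ≤ 2 ^ L * (‖z‖ ^ L + 1) * ‖w z‖ := by gcongr
      _ = _ := by ring

/-- For small `δ` the profile `η (δ • ·)` is nearly constant at the scale of `w`, so convolution
acts as multiplication by `𝓕 w ξ`. The error is of order `δ`, uniformly in `ξ`, and decays like the
envelope. -/
theorem exists_packet_approx {d : ℕ} (η w : 𝓢(E d, ℂ)) (L : ℕ) :
    ∃ C : ℝ, 0 < C ∧ ∀ δ : ℝ, 0 < δ → δ ≤ 1 → ∀ ξ x : E d,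
      ‖cv (packet η δ ξ) w x -
        Real.fourierChar (inner ℝ x ξ) * ((𝓕 w : 𝓢(E d, ℂ)) ξ * η (δ • x))‖ ≤
        C * δ / (1 + ‖δ • x‖) ^ L := by
  obtain ⟨C, hC, hsub⟩ := exists_norm_sub_le η L
  set W := ∫ z, (1 + ‖z‖) ^ (L + 1) * ‖w z‖ with hW
  have hW0 : 0 ≤ W := integral_nonneg fun z => by positivity
  refine ⟨C * (W + 1), by positivity, fun δ hδ hδ1 ξ x => ?_⟩
  have hchar : Continuous fun z : E d => ((Real.fourierChar (-inner ℝ z ξ) : Circle) : ℂ) :=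
    continuous_subtype_val.comp (Real.continuous_fourierChar.comp (by fun_prop))
  have hgi : Integrable fun z : E d => ((Real.fourierChar (-inner ℝ z ξ) : Circle) : ℂ) * w z := by
    refine (w.integrable (μ := volume)).norm.mono'
      (hchar.mul w.continuous).aestronglyMeasurable (Filter.Eventually.of_forall fun z => ?_)
    rw [norm_mul, Circle.norm_coe, one_mul]
  have hint : Integrable fun z : E d =>
      (((Real.fourierChar (-inner ℝ z ξ) : Circle) : ℂ) * w z) * η (δ • (x - z)) := by
    obtain ⟨M, hM⟩ := exists_norm_schwartz_le η
    refine hgi.mul_bdd (c := M) ?_ (Filter.Eventually.of_forall fun z => hM _)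
    exact (η.continuous.comp (by fun_prop)).aestronglyMeasurable
  have hfw : (𝓕 w : 𝓢(E d, ℂ)) ξ = ∫ z, ((Real.fourierChar (-inner ℝ z ξ) : Circle) : ℂ) * w z := by
    rw [fourier_coe, Real.fourier_eq]
    rfl
  rw [cv_packet, hfw, ← mul_sub, norm_mul, Circle.norm_coe, one_mul, ← integral_mul_const,
    ← integral_sub hint (hgi.mul_const _)]
  refine (norm_integral_le_integral_norm _).trans ?_
  have hle : ∀ z, ‖((Real.fourierChar (-inner ℝ z ξ) : Circle) : ℂ) * w z * η (δ • (x - z)) -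
      ((Real.fourierChar (-inner ℝ z ξ) : Circle) : ℂ) * w z * η (δ • x)‖ ≤
      (C * δ / (1 + ‖δ • x‖) ^ L) * ((1 + ‖z‖) ^ (L + 1) * ‖w z‖) := by
    intro z
    rw [← mul_sub, norm_mul, norm_mul, Circle.norm_coe, one_mul, smul_sub]
    have h1 := hsub (δ • x) (δ • z)
    have h2 : ‖δ • z‖ = δ * ‖z‖ := by rw [norm_smul, Real.norm_eq_abs, abs_of_pos hδ]
    have h3 : ‖δ • z‖ ≤ ‖z‖ := by rw [h2]; exact mul_le_of_le_one_left (norm_nonneg z) hδ1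
    calc ‖w z‖ * ‖η (δ • x - δ • z) - η (δ • x)‖
        ≤ ‖w z‖ * (C * (δ * (1 + ‖z‖)) * (1 + ‖z‖) ^ L / (1 + ‖δ • x‖) ^ L) := by
          gcongr
          refine h1.trans ?_
          gcongr
          rw [h2]
          gcongr
          linarith
      _ = _ := by rw [pow_succ]; ring
  calc _ ≤ ∫ z, (C * δ / (1 + ‖δ • x‖) ^ L) * ((1 + ‖z‖) ^ (L + 1) * ‖w z‖) :=
        integral_mono_of_nonneg (Filter.Eventually.of_forall fun z => norm_nonneg _)
          ((integrable_one_add_pow_mul w (L + 1)).const_mul _) (Filter.Eventually.of_forall hle)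
    _ = (C * δ / (1 + ‖δ • x‖) ^ L) * W := integral_const_mul _ _
    _ ≤ (C * δ / (1 + ‖δ • x‖) ^ L) * (W + 1) := by gcongr; linarith
    _ = _ := by ring

/-! ### Mixed norms of signed sums -/

/-- The `p`-th power of the mixed `L^p(ℓ^q)` quasi-norm. -/
def mixedPow {d : ℕ} (q : ℝ≥0∞) (p : ℝ) (a : ℕ → E d → ℂ) : ℝ≥0∞ :=
  ∫⁻ x, ellNorm q (fun i => ‖a i x‖ₑ) ^ p

theorem exists_sign_le {N : ℕ} {F : (Fin N → Bool) → ℝ≥0∞} {X : ℝ≥0∞}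
    (h : ∑ ε, F ε ≤ 2 ^ N * X) : ∃ ε, F ε ≤ X := by
  by_contra! hlt
  have hne : X ≠ ∞ := fun hX => by
    have := hlt (fun _ => true)
    rw [hX] at this
    exact absurd this not_top_lt
  have h1 : ∑ _ε : Fin N → Bool, X < ∑ ε, F ε :=
    ENNReal.sum_lt_sum_of_nonempty Finset.univ_nonempty fun ε _ => hlt ε
  rw [Finset.sum_const, Finset.card_univ, Fintype.card_fun, Fintype.card_bool, Fintype.card_fin,
    nsmul_eq_mul] at h1
  push_cast at h1
  exact absurd h (not_le.2 h1)

theorem exists_le_sign {N : ℕ} {F : (Fin N → Bool) → ℝ≥0∞} {X : ℝ≥0∞}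
    (h : 2 ^ N * X ≤ ∑ ε, F ε) : ∃ ε, X ≤ F ε := by
  by_contra! hlt
  have h1 : ∑ ε, F ε < ∑ _ε : Fin N → Bool, X :=
    ENNReal.sum_lt_sum_of_nonempty Finset.univ_nonempty fun ε _ => hlt ε
  rw [Finset.sum_const, Finset.card_univ, Fintype.card_fun, Fintype.card_bool, Fintype.card_fin,
    nsmul_eq_mul] at h1
  push_cast at h1
  exact absurd h (not_le.2 h1)

theorem continuous_signSum {X : Type*} [TopologicalSpace X] {N : ℕ} (ε : Fin N → Bool)
    {b : Fin N → X → ℂ} (hb : ∀ k, Continuous (b k)) : Continuous fun x => signSum ε fun k => b k x := by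
  unfold signSum
  exact continuous_finsetSum _ fun k _ => continuous_const.mul (hb k)

theorem enorm_rpow {z : ℂ} {p : ℝ} (hp : 0 < p) : ‖z‖ₑ ^ p = ENNReal.ofReal (‖z‖ ^ p) := by
  rw [← ofReal_norm, ENNReal.ofReal_rpow_of_nonneg (norm_nonneg _) hp.le]

theorem sqrt_mul_sq {N : ℕ} (B : ℝ) : (Real.sqrt N * B) ^ 2 = N * B ^ 2 := by
  rw [mul_pow, Real.sq_sqrt (Nat.cast_nonneg N)]

section

variable {d N : ℕ} {q : ℝ≥0∞} {p : ℝ} {b : ℕ → Fin N → E d → ℂ}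

/-- With only the indices of `I` active, all `ℓ^q` norms are comparable. Passing to `ℓ^p` lets the
average over signs enter the sum and the integral, where Khintchine applies pointwise. -/
theorem exists_sign_mixedPow_le (hq : 0 < q) (hp : 0 < p) {C : ℝ}
    (hC : ∀ (b : Fin N → ℂ) (M : ℝ), 0 ≤ M → ∑ k, ‖b k‖ ^ 2 ≤ M ^ 2 →
      ∑ ε : Fin N → Bool, ‖signSum ε b‖ ^ p ≤ 2 ^ N * (C * M ^ p))
    (hbc : ∀ i k, Continuous (b i k)) {I : Finset ℕ}
    (hI : ∀ i, i ∉ I → ∀ k x, b i k x = 0) {B : E d → ℝ}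
    (hB : ∀ i k x, ‖b i k x‖ ≤ B x) (hN : 0 < N) :
    ∃ ε : Fin N → Bool, mixedPow q p (fun i x => signSum ε fun k => b i k x) ≤
      ((I.card : ℝ≥0∞) ^ (1 / q.toReal)) ^ p * (I.card *
        ∫⁻ x, ENNReal.ofReal (C * (Real.sqrt N * B x) ^ p)) := by
  set K : ℝ≥0∞ := ((I.card : ℝ≥0∞) ^ (1 / q.toReal)) ^ p with hK
  have hB0 : ∀ x, 0 ≤ B x := fun x => (norm_nonneg _).trans (hB 0 ⟨0, hN⟩ x)
  have hmeas : ∀ (ε : Fin N → Bool) i,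
      Measurable fun x => ‖signSum ε fun k => b i k x‖ₑ ^ p := fun ε i =>
    ((continuous_signSum ε (hbc i)).measurable.enorm).pow_const p
  have h1 : ∀ ε : Fin N → Bool, mixedPow q p (fun i x => signSum ε fun k => b i k x) ≤
      K * ∑ i ∈ I, ∫⁻ x, ‖signSum ε fun k => b i k x‖ₑ ^ p := by
    intro ε
    rw [← lintegral_finsetSum _ fun i _ => hmeas ε i, ← lintegral_const_mul _
      (Finset.measurable_sum _ fun i _ => hmeas ε i)]
    refine lintegral_mono fun x => ?_
    have h2 := ellNorm_le_card hq (a := fun i => ‖signSum ε fun k => b i k x‖ₑ) (I := I)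
      (G := (∑ i ∈ I, ‖signSum ε fun k => b i k x‖ₑ ^ p) ^ (1 / p))
      (fun i hi => by simp [signSum, hI i hi]) (fun i hi => by
        rw [one_div, ENNReal.le_rpow_inv_iff hp]
        exact Finset.single_le_sum (f := fun i => ‖signSum ε fun k => b i k x‖ₑ ^ p)
          (fun _ _ => zero_le) hi)
    refine (ENNReal.rpow_le_rpow h2 hp.le).trans (le_of_eq ?_)
    rw [ENNReal.mul_rpow_of_nonneg _ _ hp.le, ← ENNReal.rpow_mul _ (1 / p),
      one_div_mul_cancel hp.ne', ENNReal.rpow_one]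
  have h2 : ∑ ε : Fin N → Bool, K * ∑ i ∈ I, ∫⁻ x, ‖signSum ε fun k => b i k x‖ₑ ^ p ≤
      2 ^ N * (K * (I.card * ∫⁻ x, ENNReal.ofReal (C * (Real.sqrt N * B x) ^ p))) := by
    rw [← Finset.mul_sum, Finset.sum_comm, mul_left_comm]
    refine mul_le_mul_right ?_ _
    rw [← nsmul_eq_mul, ← Finset.sum_const, Finset.mul_sum]
    refine Finset.sum_le_sum fun i _ => ?_
    rw [← lintegral_finsetSum _ fun ε _ => hmeas ε i, ← lintegral_const_mul' _ _ (by simp)]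
    refine lintegral_mono fun x => ?_
    simp_rw [enorm_rpow hp]
    rw [← ENNReal.ofReal_sum_of_nonneg fun _ _ => by positivity]
    have h3 := hC (fun k => b i k x) (Real.sqrt N * B x) (mul_nonneg (Real.sqrt_nonneg _) (hB0 x)) (by
      rw [sqrt_mul_sq]
      calc ∑ k, ‖b i k x‖ ^ 2 ≤ ∑ _k : Fin N, B x ^ 2 :=
            Finset.sum_le_sum fun k _ => pow_le_pow_left₀ (norm_nonneg _) (hB i k x) 2
        _ = _ := by simp)
    refine (ENNReal.ofReal_le_ofReal h3).trans (le_of_eq ?_)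
    rw [ENNReal.ofReal_mul (by positivity), ENNReal.ofReal_pow (by norm_num), ENNReal.ofReal_ofNat]
  exact exists_sign_le ((Finset.sum_le_sum fun ε _ => h1 ε).trans h2)

/-- The single index `i₁` and the set `S` suffice: the lower Khintchine inequality is integrated
over `S`. -/
theorem exists_le_sign_mixedPow (hq : 0 < q) (hp : 0 < p) {c : ℝ}
    (hc : ∀ (b : Fin N → ℂ) (M : ℝ), 0 < M → M ^ 2 ≤ ∑ k, ‖b k‖ ^ 2 →
      2 ^ N * (c * M ^ p) ≤ ∑ ε : Fin N → Bool, ‖signSum ε b‖ ^ p)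
    (hbc : ∀ i k, Continuous (b i k)) {i₁ : ℕ} {S : Set (E d)} (hS : MeasurableSet S)
    {β : ℝ}
    (hβ : 0 < β) (hB : ∀ k, ∀ x ∈ S, β ≤ ‖b i₁ k x‖) (hN : 0 < N) :
    ∃ ε : Fin N → Bool, ENNReal.ofReal (c * (Real.sqrt N * β) ^ p) * volume S ≤
      mixedPow q p (fun i x => signSum ε fun k => b i k x) := by
  have hmeas : ∀ (ε : Fin N → Bool),
      Measurable fun x => ‖signSum ε fun k => b i₁ k x‖ₑ ^ p := fun ε =>
    ((continuous_signSum ε (hbc i₁)).measurable.enorm).pow_const p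
  have h1 : ∀ ε : Fin N → Bool, ∫⁻ x in S, ‖signSum ε fun k => b i₁ k x‖ₑ ^ p ≤
      mixedPow q p (fun i x => signSum ε fun k => b i k x) := by
    intro ε
    refine (setLIntegral_le_lintegral _ _).trans (lintegral_mono fun x => ?_)
    have := card_le_ellNorm hq (a := fun i => ‖signSum ε fun k => b i k x‖ₑ) (J := {i₁})
      (Finset.singleton_nonempty _) (G := ‖signSum ε fun k => b i₁ k x‖ₑ) (by simp)
    simp only [Finset.card_singleton, Nat.cast_one, ENNReal.one_rpow, one_mul] at this
    exact ENNReal.rpow_le_rpow this hp.le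
  obtain ⟨ε, hε⟩ := exists_le_sign (F := fun ε => ∫⁻ x in S, ‖signSum ε fun k => b i₁ k x‖ₑ ^ p)
    (X := ENNReal.ofReal (c * (Real.sqrt N * β) ^ p) * volume S)
    (by
      rw [← lintegral_finsetSum _ fun ε _ => hmeas ε, ← mul_assoc, ← setLIntegral_const]
      refine setLIntegral_mono' hS fun x hx => ?_
      simp_rw [enorm_rpow hp]
      rw [← ENNReal.ofReal_sum_of_nonneg fun _ _ => by positivity]
      have h3 := hc (fun k => b i₁ k x) (Real.sqrt N * β) (by positivity) (by
        rw [sqrt_mul_sq]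
        calc N * β ^ 2 = ∑ _k : Fin N, β ^ 2 := by simp
          _ ≤ _ := Finset.sum_le_sum fun k _ => pow_le_pow_left₀ hβ.le (hB k x hx) 2)
      refine le_trans (le_of_eq ?_) (ENNReal.ofReal_le_ofReal h3)
      rw [ENNReal.ofReal_mul (p := 2 ^ N) (by positivity), ENNReal.ofReal_pow (by norm_num),
        ENNReal.ofReal_ofNat])
  exact ⟨ε, hε.trans (h1 ε)⟩

theorem signSum_eq_of_disjoint {J : Fin N → Finset ℕ} (hJ : ∀ l k, l ∉ J k → ∀ x, b l k x = 0)
    (hdisj : ∀ k k', k ≠ k' → Disjoint (J k) (J k')) (ε : Fin N → Bool) {l : ℕ} {k : Fin N}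
    (hl : l ∈ J k) (x : E d) : (signSum ε fun k => b l k x) = (sgn (ε k) : ℂ) * b l k x := by
  rw [signSum, Finset.sum_eq_single k]
  · intro k' _ hk'
    rw [hJ l k' (Finset.disjoint_left.1 (hdisj k k' hk'.symm) hl) x, mul_zero]
  · simp

/-- Each index sees at most one packet, so signs are irrelevant: at most `N * m` entries are
nonzero, each bounded by the envelope. -/
theorem mixedPow_le_of_disjoint (hq : 0 < q) (hp : 0 < p) {J : Fin N → Finset ℕ} {m : ℕ}
    (hJ : ∀ l k, l ∉ J k → ∀ x, b l k x = 0) (hdisj : ∀ k k', k ≠ k' → Disjoint (J k) (J k'))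
    (hm : ∀ k, (J k).card ≤ m) {B : E d → ℝ}
    (hB : ∀ i k x, ‖b i k x‖ ≤ B x) (ε : Fin N → Bool) :
    mixedPow q p (fun i x => signSum ε fun k => b i k x) ≤
      (((N * m : ℕ) : ℝ≥0∞) ^ (1 / q.toReal)) ^ p * ∫⁻ x, ENNReal.ofReal (B x) ^ p := by
  classical
  rw [← lintegral_const_mul' _ _ (ENNReal.rpow_ne_top_of_nonneg hp.le
    (ENNReal.rpow_ne_top_of_nonneg (by positivity) (ENNReal.natCast_ne_top _)))]
  refine lintegral_mono fun x => ?_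
  rw [← ENNReal.mul_rpow_of_nonneg _ _ hp.le]
  refine ENNReal.rpow_le_rpow ?_ hp.le
  refine (ellNorm_le_card hq (I := Finset.univ.biUnion J) (G := ENNReal.ofReal (B x))
    (fun l hl => ?_) fun l hl => ?_).trans ?_
  · have h0 : ∀ k, b l k x = 0 := fun k => hJ l k (fun h => hl (by
      rw [Finset.mem_biUnion]; exact ⟨k, Finset.mem_univ k, h⟩)) x
    simp [signSum, h0]
  · obtain ⟨k, -, hk⟩ := Finset.mem_biUnion.1 hl
    beta_reduce
    rw [signSum_eq_of_disjoint hJ hdisj ε hk, ← ofReal_norm, norm_mul, norm_sgn, one_mul]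
    exact ENNReal.ofReal_le_ofReal (hB l k x)
  · gcongr
    calc (Finset.univ.biUnion J).card ≤ (Finset.univ : Finset (Fin N)).card * m :=
          Finset.card_biUnion_le_card_mul _ _ _ fun k _ => hm k
      _ = N * m := by simp

/-- The indices `j k` are distinct, so on `S` there are `N` entries of size at least `β`, for any
signs. -/
theorem le_mixedPow_of_disjoint (hq : 0 < q) (hp : 0 < p) {J : Fin N → Finset ℕ}
    (hJ : ∀ l k, l ∉ J k → ∀ x, b l k x = 0) (hdisj : ∀ k k', k ≠ k' → Disjoint (J k) (J k'))
    {j : Fin N → ℕ} (hj : ∀ k, j k ∈ J k) {S : Set (E d)} (hS : MeasurableSet S) {β : ℝ}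
    (hB : ∀ k, ∀ x ∈ S, β ≤ ‖b (j k) k x‖) (hN : 0 < N) (ε : Fin N → Bool) :
    ((N : ℝ≥0∞) ^ (1 / q.toReal)) ^ p * (ENNReal.ofReal β ^ p * volume S) ≤
      mixedPow q p (fun i x => signSum ε fun k => b i k x) := by
  classical
  have hinj : Function.Injective j := fun k k' h => by
    by_contra hne
    exact Finset.disjoint_left.1 (hdisj k k' hne) (hj k) (h ▸ hj k')
  have hcard : (Finset.univ.image j).card = N := by
    rw [Finset.card_image_of_injective _ hinj, Finset.card_univ, Fintype.card_fin]
  rw [← mul_assoc, ← ENNReal.mul_rpow_of_nonneg _ _ hp.le, ← setLIntegral_const]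
  refine le_trans (setLIntegral_mono' hS fun x hx => ?_) (setLIntegral_le_lintegral S _)
  refine ENNReal.rpow_le_rpow ?_ hp.le
  have h := card_le_ellNorm hq (a := fun i => ‖signSum ε fun k => b i k x‖ₑ)
    (J := Finset.univ.image j) (G := ENNReal.ofReal β)
    (Finset.image_nonempty.2 ⟨⟨0, hN⟩, Finset.mem_univ _⟩) (fun l hl => by
      obtain ⟨k, -, rfl⟩ := Finset.mem_image.1 hl
      rw [signSum_eq_of_disjoint hJ hdisj ε (hj k), ← ofReal_norm, norm_mul, norm_sgn, one_mul]
      exact ENNReal.ofReal_le_ofReal (hB k x hx))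
  rwa [hcard] at h

end

/-! ### Convolution of bounded continuous functions -/

section

variable {d : ℕ} {h : E d → ℂ} {R : ℝ}

theorem integrable_cv (hc : Continuous h) (hR : ∀ y, ‖h y‖ ≤ R) (w : 𝓢(E d, ℂ)) (x : E d) :
    Integrable fun y => h y * w (x - y) := by
  have h1 : Integrable fun y => w (x - y) := (w.integrable (μ := volume)).comp_sub_left x
  exact h1.bdd_mul hc.aestronglyMeasurable (Filter.Eventually.of_forall hR)

theorem continuous_cv (hc : Continuous h) (hR : ∀ y, ‖h y‖ ≤ R) (w : 𝓢(E d, ℂ)) :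
    Continuous (cv h w) := by
  have h1 : cv h w = fun x => ∫ z, h (x - z) * w z := by
    ext x
    rw [cv, ← integral_sub_left_eq_self _ volume x]
    simp only [sub_sub_cancel]
  rw [h1]
  refine continuous_of_dominated (bound := fun z => R * ‖w z‖) (fun x => ?_) (fun x => ?_)
    ((w.integrable (μ := volume)).norm.const_mul R) ?_
  · exact ((hc.comp (by fun_prop)).mul w.continuous).aestronglyMeasurable
  · refine Filter.Eventually.of_forall fun z => ?_
    rw [norm_mul]
    gcongr
    exact hR _
  · exact Filter.Eventually.of_forall fun z => (hc.comp (by fun_prop)).mul continuous_const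

theorem cv_signSum {N : ℕ} {b : Fin N → E d → ℂ} (hc : ∀ k, Continuous (b k))
    (hR : ∀ k y, ‖b k y‖ ≤ R) (a : ℂ) (ε : Fin N → Bool) (w : 𝓢(E d, ℂ)) (x : E d) :
    cv (fun y => a * signSum ε fun k => b k y) w x = signSum ε fun k => a * cv (b k) w x := by
  have h1 : ∀ y, (a * signSum ε fun k => b k y) * w (x - y) =
      ∑ k, ((sgn (ε k) : ℂ) * a) * (b k y * w (x - y)) := by
    intro y
    rw [signSum, Finset.mul_sum, Finset.sum_mul]
    exact Finset.sum_congr rfl fun k _ => by ring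
  rw [cv]
  simp only [h1]
  rw [integral_finsetSum _ fun k _ => (integrable_cv (hc k) (hR k) w x).const_mul _, signSum]
  refine Finset.sum_congr rfl fun k _ => ?_
  rw [integral_const_mul, cv, mul_assoc]

end

/-! ### Uniform estimates for wave packets -/

/-- The envelope, lower bound and radius attached to a band-limited profile. -/
structure IsProfile {d : ℕ} (η : 𝓢(E d, ℂ)) (L : ℕ) (C e ρ : ℝ) : Prop where
  band : ∀ ω, (𝓕 η : 𝓢(E d, ℂ)) ω ≠ 0 → ‖ω‖ < 1
  C_pos : 0 < C
  e_pos : 0 < e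
  ρ_pos : 0 < ρ
  upper : ∀ u, ‖η u‖ ≤ C / (1 + ‖u‖) ^ L
  lower : ∀ u, ‖u‖ ≤ ρ → e ≤ ‖η u‖

theorem exists_isProfile (d L : ℕ) : ∃ (η : 𝓢(E d, ℂ)) (C e ρ : ℝ), IsProfile η L C e ρ := by
  obtain ⟨η, h0, hb⟩ := exists_bandlimited d
  obtain ⟨C, hC, hu, -⟩ := exists_decay η L
  have h1 : ∀ᶠ u in nhds (0 : E d), ‖η 0‖ / 2 < ‖η u‖ :=
    continuousAt_const.eventually_lt η.continuous.norm.continuousAt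
      (half_lt_self (norm_pos_iff.2 h0))
  obtain ⟨r, hr, hball⟩ := Metric.eventually_nhds_iff_ball.1 h1
  refine ⟨η, C, ‖η 0‖ / 2, r / 2, hb, hC, half_pos (norm_pos_iff.2 h0), half_pos hr, hu,
    fun u hu => (hball u ?_).le⟩
  rw [mem_ball_zero_iff]
  linarith

theorem eventually_packet {d : ℕ} {η : 𝓢(E d, ℂ)} {L : ℕ} {C e ρ : ℝ} (hη : IsProfile η L C e ρ)
    (w : 𝓢(E d, ℂ)) {c M : ℝ} (hc : 0 < c) :
    ∀ᶠ δ in nhdsWithin (0 : ℝ) (Set.Ioi 0), ∀ ξ x : E d,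
      (‖(𝓕 w : 𝓢(E d, ℂ)) ξ‖ ≤ M →
        ‖cv (packet η δ ξ) w x‖ ≤ (M * C + 1) * (1 / (1 + ‖δ • x‖) ^ L)) ∧
      (c ≤ ‖(𝓕 w : 𝓢(E d, ℂ)) ξ‖ → ‖δ • x‖ ≤ ρ → c * e / 2 ≤ ‖cv (packet η δ ξ) w x‖) := by
  obtain ⟨K, hK, happ⟩ := exists_packet_approx η w L
  have he := hη.e_pos
  -- Below this threshold the approximation error is at most the envelope, and at most half of the
  -- main term's lower bound `c * e`.
  have hs : 0 < min 1 (min (1 / K) (c * e / 2 / K)) := by positivity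
  filter_upwards [Ioo_mem_nhdsGT hs] with δ hδ ξ x
  have hδ0 : 0 < δ := hδ.1
  have hδ1 : δ ≤ 1 := hδ.2.le.trans (min_le_left _ _)
  have hδ2 : K * δ ≤ 1 := by
    have := hδ.2.le.trans ((min_le_right _ _).trans (min_le_left _ _))
    rwa [le_div_iff₀ hK, mul_comm] at this
  have hδ3 : K * δ ≤ c * e / 2 := by
    have := hδ.2.le.trans ((min_le_right _ _).trans (min_le_right _ _))
    rwa [le_div_iff₀ hK, mul_comm] at this
  have h1 := happ δ hδ0 hδ1 ξ x
  set y := Real.fourierChar (inner ℝ x ξ) * ((𝓕 w : 𝓢(E d, ℂ)) ξ * η (δ • x)) with hy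
  have hyn : ‖y‖ = ‖(𝓕 w : 𝓢(E d, ℂ)) ξ‖ * ‖η (δ • x)‖ := by
    rw [hy, norm_mul, Circle.norm_coe, one_mul, norm_mul]
  have hg0 : 0 < 1 / (1 + ‖δ • x‖) ^ L := by positivity
  have hg1 : 1 / (1 + ‖δ • x‖) ^ L ≤ 1 := by
    rw [div_le_one (by positivity)]
    exact one_le_pow₀ (by linarith [norm_nonneg (δ • x)])
  rw [mul_div_assoc, ← mul_one_div, ← mul_assoc, mul_one_div, ← mul_one_div] at h1
  refine ⟨fun hM => ?_, fun hcw hx => ?_⟩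
  · have h2 := hη.upper (δ • x)
    rw [← mul_one_div] at h2
    have h3 : ‖y‖ ≤ M * (C * (1 / (1 + ‖δ • x‖) ^ L)) := by
      rw [hyn]
      exact mul_le_mul hM h2 (norm_nonneg _) ((norm_nonneg _).trans hM)
    have h4 := norm_le_norm_add_norm_sub' (cv (packet η δ ξ) w x) y
    nlinarith
  · have h2 := hη.lower _ hx
    have h3 : c * e ≤ ‖y‖ := by
      rw [hyn]
      exact mul_le_mul hcw h2 he.le (norm_nonneg _)
    have h4 := norm_le_norm_add_norm_sub (cv (packet η δ ξ) w x) y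
    have h5 : K * δ * (1 / (1 + ‖δ • x‖) ^ L) ≤ K * δ := mul_le_of_le_one_right (by positivity) hg1
    linarith

/-- Parameters `δ` for which the wave packets are controlled by the Fourier transforms of the
kernels at their frequencies. -/
structure IsGoodScale {d N : ℕ} (η : 𝓢(E d, ℂ)) (u : ℕ → 𝓢(E d, ℂ)) (L : ℕ) (D β ρ c δ : ℝ)
    (ξ : Fin N → E d) (I : Fin N → Finset ℕ) : Prop where
  vanish : ∀ i k, i ∉ I k → ∀ x, cv (packet η δ (ξ k)) (u i) x = 0
  upper : ∀ i k x, ‖cv (packet η δ (ξ k)) (u i) x‖ ≤ D * (1 / (1 + ‖δ • x‖) ^ L)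
  lower : ∀ i k x, c ≤ ‖(𝓕 (u i) : 𝓢(E d, ℂ)) (ξ k)‖ → ‖δ • x‖ ≤ ρ →
    β ≤ ‖cv (packet η δ (ξ k)) (u i) x‖

/-- Outside the finite windows the convolution vanishes once `δ < r`, so only finitely many pairs of
kernel and frequency restrict `δ`. -/
theorem eventually_isGoodScale {d N : ℕ} {η : 𝓢(E d, ℂ)} {L : ℕ} {C e ρ : ℝ}
    (hη : IsProfile η L C e ρ) {u : ℕ → 𝓢(E d, ℂ)} {c M : ℝ} (hc : 0 < c)
    (hM : ∀ i ξ, ‖(𝓕 (u i) : 𝓢(E d, ℂ)) ξ‖ ≤ M) {ξ : Fin N → E d} {I : Fin N → Finset ℕ} {r : ℝ}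
    (hr : 0 < r) (hI : ∀ k, ∀ ζ ∈ Metric.ball (ξ k) r, ∀ i, (𝓕 (u i) : 𝓢(E d, ℂ)) ζ ≠ 0 → i ∈ I k) :
    ∀ᶠ δ in nhdsWithin (0 : ℝ) (Set.Ioi 0),
      IsGoodScale η u L (M * C + 1) (c * e / 2) ρ c δ ξ I := by
  have h1 : ∀ᶠ δ in nhdsWithin (0 : ℝ) (Set.Ioi 0), ∀ k, ∀ i ∈ I k, ∀ ξ x : E d,
      (‖(𝓕 (u i) : 𝓢(E d, ℂ)) ξ‖ ≤ M →
        ‖cv (packet η δ ξ) (u i) x‖ ≤ (M * C + 1) * (1 / (1 + ‖δ • x‖) ^ L)) ∧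
      (c ≤ ‖(𝓕 (u i) : 𝓢(E d, ℂ)) ξ‖ → ‖δ • x‖ ≤ ρ → c * e / 2 ≤ ‖cv (packet η δ ξ) (u i) x‖) :=
    Filter.eventually_all.2 fun k => (Filter.eventually_all_finset (I k)).2 fun i _ =>
      eventually_packet hη (u i) hc
  have hM0 : 0 ≤ M := (norm_nonneg _).trans (hM 0 0)
  have hC := hη.C_pos
  filter_upwards [h1, Ioo_mem_nhdsGT hr] with δ hδ hδr
  have hv : ∀ i k, i ∉ I k → ∀ x, cv (packet η δ (ξ k)) (u i) x = 0 := by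
    intro i k hi x
    refine cv_packet_eq_zero hη.band hδr.1 (fun ζ hζ => ?_) x
    by_contra hne
    exact hi (hI k ζ (Metric.ball_subset_ball hδr.2.le hζ) i hne)
  refine ⟨hv, fun i k x => ?_, fun i k x hcw hx => ?_⟩
  · by_cases hi : i ∈ I k
    · exact (hδ k i hi (ξ k) x).1 (hM _ _)
    · rw [hv i k hi, norm_zero]
      positivity
  · have hi : i ∈ I k := hI k (ξ k) (Metric.mem_ball_self hr) i (norm_pos_iff.1 (hc.trans_le hcw))
    exact (hδ k i hi (ξ k) x).2 hcw hx

/-! ### Scaling -/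

theorem lintegral_comp_smul {d : ℕ} (f : E d → ℝ≥0∞) (hf : Measurable f) {δ : ℝ} (hδ : 0 < δ) :
    ∫⁻ x, f (δ • x) = ENNReal.ofReal ((δ ^ d)⁻¹) * ∫⁻ x, f x := by
  have h1 := Measure.map_addHaar_smul (volume : Measure (E d)) hδ.ne'
  rw [finrank_euclideanSpace_fin, abs_of_pos (by positivity)] at h1
  rw [← lintegral_map hf (by fun_prop), h1, lintegral_smul_measure, smul_eq_mul]

theorem volume_norm_smul_le {d : ℕ} {δ : ℝ} (hδ : 0 < δ) (ρ : ℝ) :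
    volume {x : E d | ‖δ • x‖ ≤ ρ} =
      ENNReal.ofReal ((δ ^ d)⁻¹) * volume (Metric.closedBall (0 : E d) ρ) := by
  have h1 := Measure.addHaar_preimage_smul (volume : Measure (E d)) hδ.ne' (Metric.closedBall 0 ρ)
  rw [finrank_euclideanSpace_fin, abs_of_pos (by positivity)] at h1
  rw [← h1]
  congr 1
  ext x
  simp

theorem lintegral_envelope_lt_top {d L : ℕ} {p : ℝ} (hL : (d : ℝ) < L * p) :
    ∫⁻ x : E d, ENNReal.ofReal ((1 / (1 + ‖x‖) ^ L) ^ p) < ∞ := by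
  have h := finite_integral_one_add_norm (E := E d) (μ := volume) (r := L * p)
    (by rwa [finrank_euclideanSpace_fin])
  refine lt_of_le_of_lt (le_of_eq ?_) h
  refine lintegral_congr fun x => ?_
  congr 1
  have h0 : 0 ≤ 1 + ‖x‖ := by positivity
  rw [one_div, Real.inv_rpow (by positivity), ← Real.rpow_natCast, ← Real.rpow_mul h0,
    Real.rpow_neg h0]

/-! ### Building blocks -/

/-- A bounded continuous function seen only by the kernels with index in `(lo, hi]`. -/
structure IsBlock {d : ℕ} (u v : ℕ → 𝓢(E d, ℂ)) (lo hi : ℕ) (τ : ℝ) (h : E d → ℂ) : Prop where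
  continuous : Continuous h
  bound : ∀ y, ‖h y‖ ≤ τ
  left : ∀ i x, cv h (u i) x ≠ 0 → lo < i ∧ i ≤ hi
  right : ∀ i x, cv h (v i) x ≠ 0 → lo < i ∧ i ≤ hi

theorem IsBlock.symm {d : ℕ} {u v : ℕ → 𝓢(E d, ℂ)} {lo hi : ℕ} {τ : ℝ} {h : E d → ℂ}
    (hb : IsBlock u v lo hi τ h) : IsBlock v u lo hi τ h :=
  ⟨hb.continuous, hb.bound, hb.right, hb.left⟩

theorem exists_ne_zero_of_signSum_ne_zero {N : ℕ} {ε : Fin N → Bool} {b : Fin N → ℂ}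
    (h : signSum ε b ≠ 0) : ∃ k, b k ≠ 0 := by
  by_contra! h0
  exact h (by simp [signSum, h0])

/-- The amplitude is fixed by `a ^ p * (δ ^ d)⁻¹ = X`, which makes the `p`-th power of the `L^p`
size proportional to `X` whatever `δ` is. As `δ → 0` the amplitude tends to zero because `d > 0`, so
the sup norm falls below `τ`. -/
theorem exists_packet_block {d : ℕ} (hd : 0 < d) {u v : ℕ → 𝓢(E d, ℂ)} {η : 𝓢(E d, ℂ)} {L : ℕ}
    {C e ρ c c' M M' : ℝ} (hη : IsProfile η L C e ρ) (hc : 0 < c) (hc' : 0 < c')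
    (hM : ∀ i ξ, ‖(𝓕 (u i) : 𝓢(E d, ℂ)) ξ‖ ≤ M) (hM' : ∀ i ξ, ‖(𝓕 (v i) : 𝓢(E d, ℂ)) ξ‖ ≤ M')
    {m lo N : ℕ} {ξ : Fin N → E d} {r : ℝ} {i₁ : ℕ} {j : Fin N → ℕ} {I : Finset ℕ}
    {J : Fin N → Finset ℕ} (hs : SeparatedFrequencies u v m c c' lo N ξ r i₁ j I J)
    {p : ℝ} (hp : 0 < p) {X τ : ℝ} (hX : 0 < X) (hτ : 0 < τ) :
    ∃ (δ a : ℝ) (hi : ℕ), 0 < δ ∧ 0 < a ∧ a ^ p * (δ ^ d)⁻¹ = X ∧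
      IsGoodScale η u L (M * C + 1) (c * e / 2) ρ c δ ξ (fun _ => I) ∧
      IsGoodScale η v L (M' * C + 1) (c' * e / 2) ρ c' δ ξ J ∧
      ∀ ε : Fin N → Bool,
        IsBlock u v lo hi τ (fun y => (a : ℂ) * signSum ε fun k => packet η δ (ξ k) y) := by
  classical
  have g1 := eventually_isGoodScale (I := fun _ => I) hη hc hM hs.pos hs.support_left
  have g2 := eventually_isGoodScale hη hc' hM' hs.pos hs.support_right
  obtain ⟨B, hB⟩ := exists_norm_schwartz_le η
  have hB0 : 0 ≤ B := (norm_nonneg _).trans (hB 0)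
  have hlim : Filter.Tendsto (fun δ : ℝ => (X * δ ^ d) ^ (1 / p) * (N * B))
      (nhdsWithin 0 (Set.Ioi 0)) (nhds 0) := by
    have h1 : Filter.Tendsto (fun δ : ℝ => (X * δ ^ d) ^ (1 / p) * (N * B)) (nhds 0)
        (nhds ((X * 0 ^ d) ^ (1 / p) * (N * B))) := by
      refine Filter.Tendsto.mul_const _ (Filter.Tendsto.rpow_const ?_ (Or.inr (by positivity)))
      exact (continuous_const.mul (continuous_pow d)).tendsto 0
    rw [zero_pow hd.ne', mul_zero, Real.zero_rpow (by positivity), zero_mul] at h1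
    exact h1.mono_left nhdsWithin_le_nhds
  obtain ⟨δ, ⟨⟨hg1, hg2⟩, hsmall⟩, hδ⟩ :=
    (((g1.and g2).and (hlim.eventually_lt_const hτ)).and self_mem_nhdsWithin).exists
  have hδ0 : 0 < δ := hδ
  set a := (X * δ ^ d) ^ (1 / p) with ha
  have ha0 : 0 < a := by positivity
  refine ⟨δ, a, I.sup id + ∑ k, (J k).sup id, hδ0, ha0, ?_, hg1, hg2, fun ε => ?_⟩
  · rw [ha, ← Real.rpow_mul (by positivity), one_div_mul_cancel hp.ne', Real.rpow_one]
    field_simp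
  have hpc : ∀ k, Continuous fun y => packet η δ (ξ k) y := fun k => continuous_packet _ _ _
  have hpb : ∀ k y, ‖packet η δ (ξ k) y‖ ≤ B := fun k y => by rw [norm_packet]; exact hB _
  refine ⟨continuous_const.mul (continuous_signSum ε hpc), fun y => ?_, fun i x hne => ?_,
    fun i x hne => ?_⟩
  · rw [norm_mul, Complex.norm_real, Real.norm_eq_abs, abs_of_pos ha0]
    refine le_trans ?_ hsmall.le
    gcongr
    refine (norm_signSum_le _ _).trans ?_
    calc ∑ k, ‖packet η δ (ξ k) y‖ ≤ ∑ _k : Fin N, B := Finset.sum_le_sum fun k _ => hpb k y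
      _ = N * B := by simp
  · rw [cv_signSum hpc hpb] at hne
    obtain ⟨k, hk⟩ := exists_ne_zero_of_signSum_ne_zero hne
    have hi : i ∈ I := by
      by_contra hi
      exact hk (by rw [hg1.vanish i k hi, mul_zero])
    have := Finset.le_sup (f := id) hi
    exact ⟨hs.lt_left i hi, this.trans (Nat.le_add_right _ _)⟩
  · rw [cv_signSum hpc hpb] at hne
    obtain ⟨k, hk⟩ := exists_ne_zero_of_signSum_ne_zero hne
    have hi : i ∈ J k := by
      by_contra hi
      exact hk (by rw [hg2.vanish i k hi, mul_zero])
    have h1 := Finset.le_sup (f := id) hi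
    have h2 := Finset.single_le_sum (f := fun k => (J k).sup id) (fun _ _ => Nat.zero_le _)
      (Finset.mem_univ k)
    exact ⟨hs.lt_right k i hi, h1.trans (h2.trans (Nat.le_add_left _ _))⟩

/-- The Jacobian `(δ ^ d)⁻¹` and the factor `a ^ p` combine to `X`, and `δ` disappears. -/
theorem lintegral_envelope_scaled {d L : ℕ} {p : ℝ} (hL : (d : ℝ) < L * p)
    {δ a X K P D : ℝ} (hδ : 0 < δ) (ha : 0 < a) (hX : a ^ p * (δ ^ d)⁻¹ = X) (hK : 0 ≤ K)
    (hP : 0 ≤ P) (hD : 0 ≤ D) :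
    ∫⁻ x : E d, ENNReal.ofReal (K * (P * (a * (D * (1 / (1 + ‖δ • x‖) ^ L)))) ^ p) =
      ENNReal.ofReal (K * D ^ p *
        (∫⁻ x : E d, ENNReal.ofReal ((1 / (1 + ‖x‖) ^ L) ^ p)).toReal * P ^ p * X) := by
  set G := ∫⁻ x : E d, ENNReal.ofReal ((1 / (1 + ‖x‖) ^ L) ^ p) with hG
  have hGt : G ≠ ∞ := (lintegral_envelope_lt_top hL).ne
  have h1 : ∀ x : E d, ENNReal.ofReal (K * (P * (a * (D * (1 / (1 + ‖δ • x‖) ^ L)))) ^ p) =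
      ENNReal.ofReal (K * (P * (a * D)) ^ p) * ENNReal.ofReal ((1 / (1 + ‖δ • x‖) ^ L) ^ p) := by
    intro x
    rw [← ENNReal.ofReal_mul (by positivity), mul_assoc, ← Real.mul_rpow (by positivity)
      (by positivity)]
    congr 3
    ring
  have hm : Measurable fun x : E d => ENNReal.ofReal ((1 / (1 + ‖x‖) ^ L) ^ p) := by fun_prop
  have h2 := lintegral_comp_smul _ hm hδ
  simp_rw [h1]
  rw [lintegral_const_mul' _ _ ENNReal.ofReal_ne_top, h2, ← hG, ← ENNReal.ofReal_toReal hGt,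
    ← ENNReal.ofReal_mul (by positivity), ← ENNReal.ofReal_mul (by positivity), ← hX,
    Real.mul_rpow hP (by positivity), Real.mul_rpow ha.le hD]
  simp only [ENNReal.toReal_ofReal ENNReal.toReal_nonneg]
  congr 1
  ring

theorem ofReal_mul_volume_scaled {d : ℕ} {p : ℝ} {δ a X K P β ρ : ℝ} (hδ : 0 < δ)
    (ha : 0 < a) (hX : a ^ p * (δ ^ d)⁻¹ = X) (hK : 0 ≤ K) (hP : 0 ≤ P) (hβ : 0 ≤ β) :
    ENNReal.ofReal (K * (P * (a * β)) ^ p) * volume {x : E d | ‖δ • x‖ ≤ ρ} =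
      ENNReal.ofReal (K * β ^ p * (volume (Metric.closedBall (0 : E d) ρ)).toReal * P ^ p * X) := by
  have hV : volume (Metric.closedBall (0 : E d) ρ) ≠ ∞ := measure_closedBall_lt_top.ne
  rw [volume_norm_smul_le hδ, ← ENNReal.ofReal_toReal hV, ← ENNReal.ofReal_mul (by positivity),
    ← ENNReal.ofReal_mul (by positivity), ← hX, Real.mul_rpow hP (by positivity),
    Real.mul_rpow ha.le hβ]
  simp only [ENNReal.toReal_ofReal ENNReal.toReal_nonneg]
  congr 1
  ring

theorem natCast_rpow_rpow (n : ℕ) {s p : ℝ} (hs : 0 ≤ s) (hp : 0 ≤ p) :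
    ((n : ℝ≥0∞) ^ s) ^ p = ENNReal.ofReal (((n : ℝ) ^ s) ^ p) := by
  rw [← ENNReal.ofReal_natCast, ENNReal.ofReal_rpow_of_nonneg (by positivity) hs,
    ENNReal.ofReal_rpow_of_nonneg (by positivity) hp]

section

variable {d : ℕ} {u v : ℕ → 𝓢(E d, ℂ)} {c c' M M' : ℝ} {m : ℕ}

/-- Blocks whose norm on the side of the common scale grows like the square root of the number of
frequencies, while the norm on the other side grows like its `1 / q`-th power: small on the side
of the common scale. -/
theorem exists_blocks_left_small (hd : 0 < d) (hc : 0 < c) (hc' : 0 < c')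
    (hM : ∀ i ξ, ‖(𝓕 (u i) : 𝓢(E d, ℂ)) ξ‖ ≤ M) (hM' : ∀ i ξ, ‖(𝓕 (v i) : 𝓢(E d, ℂ)) ξ‖ ≤ M')
    (hsep : ∀ lo N : ℕ, 0 < N →
      ∃ ξ r i₁ j I J, SeparatedFrequencies u v m c c' lo N ξ r i₁ j I J)
    {p : ℝ} (hp : 0 < p) {q : ℝ≥0∞} (hq : 0 < q) :
    ∃ K₁ K₂ : ℝ, 0 ≤ K₁ ∧ 0 < K₂ ∧ ∀ (N : ℕ) (X τ : ℝ) (lo : ℕ), 0 < N → 0 < X → 0 < τ →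
      ∃ h hi, IsBlock u v lo hi τ h ∧
        mixedPow q p (fun i => cv h (u i)) ≤ ENNReal.ofReal (K₁ * Real.sqrt N ^ p * X) ∧
        ENNReal.ofReal (K₂ * ((N : ℝ) ^ (1 / q.toReal)) ^ p * X) ≤
          mixedPow q p (fun i => cv h (v i)) := by
  -- The decay order satisfies `L * p > d`, which makes the `p`-th power of the envelope integrable
  -- even for small `p`.
  obtain ⟨L, hL⟩ := exists_nat_gt ((d : ℝ) / p)
  rw [div_lt_iff₀ hp] at hL
  obtain ⟨η, C, e, ρ, hη⟩ := exists_isProfile d L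
  obtain ⟨Ck, hCk, hkh⟩ := khintchine_upper p hp
  have hM0 : 0 ≤ M := (norm_nonneg _).trans (hM 0 0)
  have hM0' : 0 ≤ M' := (norm_nonneg _).trans (hM' 0 0)
  have hC := hη.C_pos
  have he := hη.e_pos
  have hs0 : 0 ≤ 1 / q.toReal := by positivity
  set G := (∫⁻ x : E d, ENNReal.ofReal ((1 / (1 + ‖x‖) ^ L) ^ p)).toReal with hG
  set V := (volume (Metric.closedBall (0 : E d) ρ)).toReal with hV
  have hV0 : 0 < V := ENNReal.toReal_pos (Metric.measure_closedBall_pos _ _ hη.ρ_pos).ne'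
    measure_closedBall_lt_top.ne
  refine ⟨((m : ℝ) ^ (1 / q.toReal)) ^ p * (m * (Ck * (M * C + 1) ^ p * G)),
    (c' * e / 2) ^ p * V, by positivity, by positivity, fun N X τ lo hN hX hτ => ?_⟩
  obtain ⟨ξ, r, i₁, j, I, J, hs⟩ := hsep lo N hN
  obtain ⟨δ, a, hi, hδ, ha, haX, hg1, hg2, hblock⟩ :=
    exists_packet_block hd hη hc hc' hM hM' hs hp hX hτ
  obtain ⟨Bη, hBη⟩ := exists_norm_schwartz_le η
  have hpc : ∀ k, Continuous fun y => packet η δ (ξ k) y := fun k => continuous_packet _ _ _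
  have hpb : ∀ k y, ‖packet η δ (ξ k) y‖ ≤ Bη := fun k y => by rw [norm_packet]; exact hBη _
  have hna : ∀ z : ℂ, ‖(a : ℂ) * z‖ = a * ‖z‖ := fun z => by
    rw [norm_mul, Complex.norm_real, Real.norm_eq_abs, abs_of_pos ha]
  -- The signs are chosen for the upper bound on the side of `u`; the lower bound on the side of `v`
  -- holds for all signs.
  obtain ⟨ε, hε⟩ := exists_sign_mixedPow_le (q := q) (N := N) hq hp (hkh N)
    (b := fun i k x => (a : ℂ) * cv (packet η δ (ξ k)) (u i) x)
    (fun i k => continuous_const.mul (continuous_cv (hpc k) (hpb k) _)) (I := I)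
    (fun i hi k x => by rw [hg1.vanish i k hi, mul_zero])
    (B := fun x => a * ((M * C + 1) * (1 / (1 + ‖δ • x‖) ^ L)))
    (fun i k x => by rw [hna]; exact mul_le_mul_of_nonneg_left (hg1.upper i k x) ha.le) hN
  refine ⟨_, hi, hblock ε, ?_, ?_⟩
  · have heq : (fun i => cv (fun y => (a : ℂ) * signSum ε fun k => packet η δ (ξ k) y) (u i)) =
        fun i x => signSum ε fun k => (a : ℂ) * cv (packet η δ (ξ k)) (u i) x := by
      funext i x
      exact cv_signSum hpc hpb _ _ _ _
    rw [heq]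
    refine hε.trans ?_
    rw [lintegral_envelope_scaled hL hδ ha haX hCk.le (Real.sqrt_nonneg _) (by positivity), ← hG]
    calc _ ≤ ((m : ℝ≥0∞) ^ (1 / q.toReal)) ^ p * (m * ENNReal.ofReal
          (Ck * (M * C + 1) ^ p * G * Real.sqrt N ^ p * X)) := by
          have := hs.card_left
          gcongr
      _ = _ := by
          rw [natCast_rpow_rpow m hs0 hp.le, ← ENNReal.ofReal_natCast m,
            ← ENNReal.ofReal_mul (by positivity), ← ENNReal.ofReal_mul (by positivity)]
          congr 1
          ring
  · have heq : (fun i => cv (fun y => (a : ℂ) * signSum ε fun k => packet η δ (ξ k) y) (v i)) =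
        fun i x => signSum ε fun k => (a : ℂ) * cv (packet η δ (ξ k)) (v i) x := by
      funext i x
      exact cv_signSum hpc hpb _ _ _ _
    rw [heq]
    have hlow := le_mixedPow_of_disjoint (q := q) hq hp
      (b := fun i k x => (a : ℂ) * cv (packet η δ (ξ k)) (v i) x) (J := J)
      (fun l k hl x => by rw [hg2.vanish l k hl, mul_zero]) hs.disjoint (j := j)
      (fun k => hs.support_right k _ (Metric.mem_ball_self hs.pos) _
        (norm_pos_iff.1 (hc'.trans_le (hs.lower_right k))))
      (S := {x : E d | ‖δ • x‖ ≤ ρ}) (measurableSet_le (by fun_prop) measurable_const)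
      (β := a * (c' * e / 2))
      (fun k x hx => by
        rw [hna]
        exact mul_le_mul_of_nonneg_left (hg2.lower _ k x (hs.lower_right k) hx) ha.le) hN ε
    refine le_trans (le_of_eq ?_) hlow
    have h2 := ofReal_mul_volume_scaled (K := 1) (P := 1) (β := c' * e / 2) (ρ := ρ) hδ ha haX
      zero_le_one zero_le_one (by positivity)
    rw [one_mul, one_mul, Real.one_rpow, mul_one, one_mul, ← hV] at h2
    rw [ENNReal.ofReal_rpow_of_nonneg (by positivity) hp.le, h2, natCast_rpow_rpow N hs0 hp.le,
      ← ENNReal.ofReal_mul (by positivity)]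
    congr 1
    ring

/-- The companion of `exists_blocks_left_small`: small on the side of the separated scales. -/
theorem exists_blocks_right_small (hd : 0 < d) (hc : 0 < c) (hc' : 0 < c')
    (hM : ∀ i ξ, ‖(𝓕 (u i) : 𝓢(E d, ℂ)) ξ‖ ≤ M) (hM' : ∀ i ξ, ‖(𝓕 (v i) : 𝓢(E d, ℂ)) ξ‖ ≤ M')
    (hsep : ∀ lo N : ℕ, 0 < N →
      ∃ ξ r i₁ j I J, SeparatedFrequencies u v m c c' lo N ξ r i₁ j I J)
    {p : ℝ} (hp : 0 < p) {q : ℝ≥0∞} (hq : 0 < q) :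
    ∃ K₁ K₂ : ℝ, 0 ≤ K₁ ∧ 0 < K₂ ∧ ∀ (N : ℕ) (X τ : ℝ) (lo : ℕ), 0 < N → 0 < X → 0 < τ →
      ∃ h hi, IsBlock u v lo hi τ h ∧
        mixedPow q p (fun i => cv h (v i)) ≤
          ENNReal.ofReal (K₁ * ((N : ℝ) ^ (1 / q.toReal)) ^ p * X) ∧
        ENNReal.ofReal (K₂ * Real.sqrt N ^ p * X) ≤ mixedPow q p (fun i => cv h (u i)) := by
  obtain ⟨L, hL⟩ := exists_nat_gt ((d : ℝ) / p)
  rw [div_lt_iff₀ hp] at hL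
  obtain ⟨η, C, e, ρ, hη⟩ := exists_isProfile d L
  obtain ⟨ck, hck, hkh⟩ := khintchine_lower p
  have hM0 : 0 ≤ M := (norm_nonneg _).trans (hM 0 0)
  have hM0' : 0 ≤ M' := (norm_nonneg _).trans (hM' 0 0)
  have hC := hη.C_pos
  have he := hη.e_pos
  have hs0 : 0 ≤ 1 / q.toReal := by positivity
  set G := (∫⁻ x : E d, ENNReal.ofReal ((1 / (1 + ‖x‖) ^ L) ^ p)).toReal with hG
  set V := (volume (Metric.closedBall (0 : E d) ρ)).toReal with hV
  have hV0 : 0 < V := ENNReal.toReal_pos (Metric.measure_closedBall_pos _ _ hη.ρ_pos).ne'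
    measure_closedBall_lt_top.ne
  refine ⟨((m : ℝ) ^ (1 / q.toReal)) ^ p * ((M' * C + 1) ^ p * G),
    ck * (c * e / 2) ^ p * V, by positivity, by positivity, fun N X τ lo hN hX hτ => ?_⟩
  obtain ⟨ξ, r, i₁, j, I, J, hs⟩ := hsep lo N hN
  obtain ⟨δ, a, hi, hδ, ha, haX, hg1, hg2, hblock⟩ :=
    exists_packet_block hd hη hc hc' hM hM' hs hp hX hτ
  obtain ⟨Bη, hBη⟩ := exists_norm_schwartz_le η
  have hpc : ∀ k, Continuous fun y => packet η δ (ξ k) y := fun k => continuous_packet _ _ _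
  have hpb : ∀ k y, ‖packet η δ (ξ k) y‖ ≤ Bη := fun k y => by rw [norm_packet]; exact hBη _
  have hna : ∀ z : ℂ, ‖(a : ℂ) * z‖ = a * ‖z‖ := fun z => by
    rw [norm_mul, Complex.norm_real, Real.norm_eq_abs, abs_of_pos ha]
  -- Here the signs are chosen for the lower bound on the side of `u`; the upper bound on the side
  -- of `v` holds for all signs.
  obtain ⟨ε, hε⟩ := exists_le_sign_mixedPow (q := q) (N := N) hq hp
    (fun b M h1 h2 => hkh N b M h1 h2 hp.le)
    (b := fun i k x => (a : ℂ) * cv (packet η δ (ξ k)) (u i) x)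
    (fun i k => continuous_const.mul (continuous_cv (hpc k) (hpb k) _)) (i₁ := i₁)
    (S := {x : E d | ‖δ • x‖ ≤ ρ}) (measurableSet_le (by fun_prop) measurable_const)
    (β := a * (c * e / 2)) (by positivity)
    (fun k x hx => by
      rw [hna]
      exact mul_le_mul_of_nonneg_left (hg1.lower _ k x (hs.lower_left k) hx) ha.le) hN
  refine ⟨_, hi, hblock ε, ?_, ?_⟩
  · have heq : (fun i => cv (fun y => (a : ℂ) * signSum ε fun k => packet η δ (ξ k) y) (v i)) =
        fun i x => signSum ε fun k => (a : ℂ) * cv (packet η δ (ξ k)) (v i) x := by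
      funext i x
      exact cv_signSum hpc hpb _ _ _ _
    rw [heq]
    have hup := mixedPow_le_of_disjoint (q := q) hq hp
      (b := fun i k x => (a : ℂ) * cv (packet η δ (ξ k)) (v i) x) (J := J) (m := m)
      (fun l k hl x => by rw [hg2.vanish l k hl, mul_zero]) hs.disjoint hs.card_right
      (B := fun x => a * ((M' * C + 1) * (1 / (1 + ‖δ • x‖) ^ L)))
      (fun i k x => by rw [hna]; exact mul_le_mul_of_nonneg_left (hg2.upper i k x) ha.le) ε
    refine hup.trans (le_of_eq ?_)
    have h2 := lintegral_envelope_scaled (K := 1) (P := 1) (D := M' * C + 1) hL hδ ha haX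
      zero_le_one zero_le_one (by positivity)
    simp only [one_mul, Real.one_rpow, mul_one, ← hG] at h2
    have h3 : ∀ x : E d, ENNReal.ofReal (a * ((M' * C + 1) * (1 / (1 + ‖δ • x‖) ^ L))) ^ p =
        ENNReal.ofReal ((a * ((M' * C + 1) * (1 / (1 + ‖δ • x‖) ^ L))) ^ p) := fun x =>
      ENNReal.ofReal_rpow_of_nonneg (by positivity) hp.le
    simp only [h3]
    rw [h2, natCast_rpow_rpow _ hs0 hp.le, ← ENNReal.ofReal_mul (by positivity), Nat.cast_mul,
      Real.mul_rpow (by positivity) (by positivity), Real.mul_rpow (by positivity) (by positivity)]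
    congr 1
    ring
  · have heq : (fun i => cv (fun y => (a : ℂ) * signSum ε fun k => packet η δ (ξ k) y) (u i)) =
        fun i x => signSum ε fun k => (a : ℂ) * cv (packet η δ (ξ k)) (u i) x := by
      funext i x
      exact cv_signSum hpc hpb _ _ _ _
    rw [heq]
    refine le_trans (le_of_eq ?_) hε
    rw [ofReal_mul_volume_scaled hδ ha haX hck.le (Real.sqrt_nonneg _) (by positivity), ← hV]

end

/-- Choice of the number of frequencies and of the amplitude. -/
theorem exists_parameters {s t p K₁ K₂ ε : ℝ} (hst : s < t) (hp : 0 < p) (hK₁ : 0 ≤ K₁)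
    (hK₂ : 0 < K₂) (hε : 0 < ε) :
    ∃ (N : ℕ) (X : ℝ), 0 < N ∧ 0 < X ∧ K₁ * ((N : ℝ) ^ s) ^ p * X ≤ ε ∧
      1 / ε ≤ K₂ * ((N : ℝ) ^ t) ^ p * X := by
  -- `N` makes the ratio of the two norms as large as required, and then `X` normalizes the small
  -- one to at most `ε`. The constant `K₁ + 1` avoids dividing by zero.
  have hlim : Filter.Tendsto (fun N : ℕ => (N : ℝ) ^ ((t - s) * p)) Filter.atTop Filter.atTop :=
    (tendsto_rpow_atTop (mul_pos (by linarith) hp)).comp tendsto_natCast_atTop_atTop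
  obtain ⟨N, hN, hN0⟩ := ((hlim.eventually_ge_atTop ((K₁ + 1) / (K₂ * ε ^ 2))).and
    (Filter.eventually_gt_atTop 0)).exists
  have hNr : (0 : ℝ) < N := by exact_mod_cast hN0
  have hsplit : ((N : ℝ) ^ t) ^ p = (N : ℝ) ^ ((t - s) * p) * ((N : ℝ) ^ s) ^ p := by
    rw [← Real.rpow_mul hNr.le, ← Real.rpow_mul hNr.le, ← Real.rpow_add hNr]
    congr 1
    ring
  have hP : 0 < ((N : ℝ) ^ s) ^ p := by positivity
  refine ⟨N, ε / ((K₁ + 1) * ((N : ℝ) ^ s) ^ p), hN0, by positivity, ?_, ?_⟩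
  · rw [mul_div_assoc', div_le_iff₀ (by positivity)]
    nlinarith [mul_pos hε hP]
  · rw [hsplit]
    have h1 : K₂ * ((N : ℝ) ^ ((t - s) * p) * ((N : ℝ) ^ s) ^ p) *
        (ε / ((K₁ + 1) * ((N : ℝ) ^ s) ^ p)) = (N : ℝ) ^ ((t - s) * p) * (K₂ * ε / (K₁ + 1)) := by
      field_simp
    rw [h1]
    calc 1 / ε = (K₁ + 1) / (K₂ * ε ^ 2) * (K₂ * ε / (K₁ + 1)) := by field_simp
      _ ≤ _ := by gcongr

/-! ### Bounded continuous functions as tempered distributions -/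

theorem exists_distribution {d : ℕ} {F : E d → ℂ} {R : ℝ} (hc : Continuous F)
    (hR : ∀ y, ‖F y‖ ≤ R) : ∃ f : 𝓢'(E d, ℂ), ∀ w x, conv f w x = cv F w x := by
  have hF : MemLp F ∞ (volume : Measure (E d)) :=
    memLp_top_of_bound hc.aestronglyMeasurable R (Filter.Eventually.of_forall hR)
  refine ⟨Lp.toTemperedDistribution (hF.toLp F), fun w x => ?_⟩
  rw [conv, Lp.toTemperedDistribution_apply, cv]
  refine integral_congr_ae ?_
  filter_upwards [hF.coeFn_toLp] with y hy
  rw [hy, reflectTranslate_apply, smul_eq_mul, mul_comm]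

theorem mem_tlSpace_iff {d : ℕ} {A : GL (Fin d) ℝ} {φ Φ : 𝓢(E d, ℂ)} {p : ℝ} (hp : 0 < p)
    {q : ℝ≥0∞} {f : 𝓢'(E d, ℂ)} {F : E d → ℂ} (hf : ∀ w x, conv f w x = cv F w x) :
    f ∈ tlSpace A φ Φ 0 p q ↔ mixedPow q p (fun i => cv F (dilates A φ Φ i)) < ∞ := by
  have h : tlNorm A φ Φ 0 p q f = mixedPow q p (fun i => cv F (dilates A φ Φ i)) ^ (1 / p) := by
    simp only [tlNorm, mixedPow, zero_mul, Real.rpow_zero, ENNReal.ofReal_one, one_mul, hf]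
  rw [tlSpace, Set.mem_ofPred_eq, h, ENNReal.rpow_lt_top_iff_of_pos (by positivity)]

/-! ### Gliding hump -/

/-- There are blocks with arbitrarily high scales that are small in the norm given by `u` and large
in the norm given by `v`. -/
def HasHumps {d : ℕ} (q : ℝ≥0∞) (p : ℝ) (u v : ℕ → 𝓢(E d, ℂ)) : Prop :=
  ∀ (ε : ℝ) (lo : ℕ), 0 < ε → ∃ h hi, IsBlock u v lo hi ε h ∧
    mixedPow q p (fun i => cv h (u i)) ≤ ENNReal.ofReal ε ∧
    ENNReal.ofReal (1 / ε) ≤ mixedPow q p (fun i => cv h (v i))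

theorem measurable_ellNorm {d : ℕ} (q : ℝ≥0∞) {a : ℕ → E d → ℝ≥0∞} (ha : ∀ i, Measurable (a i)) :
    Measurable fun x => ellNorm q fun i => a i x := by
  unfold ellNorm
  split_ifs
  · exact Measurable.iSup ha
  · exact (Measurable.tsum fun i => (ha i).pow_const _).pow_const _

theorem eq_of_mem_windows {lo hi : ℕ → ℕ} (h1 : ∀ n, lo n ≤ hi n) (h2 : ∀ n, hi n ≤ lo (n + 1))
    {n n' i : ℕ} (hn : lo n < i ∧ i ≤ hi n) (hn' : lo n' < i ∧ i ≤ hi n') : n = n' := by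
  have hmono : ∀ k l, k < l → hi k ≤ lo l := by
    intro k l hkl
    induction l with
    | zero => omega
    | succ l ih =>
      rcases Nat.lt_succ_iff_lt_or_eq.1 hkl with h | h
      · exact (ih h).trans ((h1 l).trans (h2 l))
      · rw [h]; exact h2 l
  by_contra hne
  rcases lt_or_gt_of_ne hne with h | h
  · have := hmono _ _ h; omega
  · have := hmono _ _ h; omega

/-- Blocks in consecutive disjoint index windows do not interact: every index of either family sees
at most one of them. Their sup norms are summable, so the sum is bounded and continuous; its
`u`-norm is controlled by a convergent series, while its `v`-norm dominates that of every block. -/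
theorem HasHumps.exists_function {d : ℕ} {q : ℝ≥0∞} (hq : 0 < q) {p : ℝ} (hp : 0 < p)
    {u v : ℕ → 𝓢(E d, ℂ)} (H : HasHumps q p u v) :
    ∃ (F : E d → ℂ) (R : ℝ), Continuous F ∧ (∀ y, ‖F y‖ ≤ R) ∧
      mixedPow q p (fun i => cv F (u i)) < ∞ ∧ mixedPow q p (fun i => cv F (v i)) = ∞ := by
  have hs0 : 0 ≤ 1 / q.toReal := by positivity
  -- `κ n` is the weight lost in `ellNorm_rpow_le_tsum`; dividing by it in `e n` leaves a geometric
  -- series.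
  set κ : ℕ → ℝ := fun n => (((2 : ℝ) ^ (n + 1)) ^ (1 / q.toReal)) ^ p with hκ
  have hκ1 : ∀ n, 1 ≤ κ n := fun n =>
    Real.one_le_rpow (Real.one_le_rpow (one_le_pow₀ (by norm_num)) hs0) hp.le
  set e : ℕ → ℝ := fun n => (1 / 2) ^ n / κ n with he
  have he0 : ∀ n, 0 < e n := fun n => div_pos (by positivity) (one_pos.trans_le (hκ1 n))
  have hele : ∀ n, e n ≤ (1 / 2) ^ n := fun n => div_le_self (by positivity) (hκ1 n)
  choose g hi hb hsmall hlarge using fun n lo => H (e n) lo (he0 n)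
  -- Each window starts where the previous one ends; the maximum keeps the endpoints nondecreasing
  -- even if a block comes with `hi` below `lo`.
  let lo : ℕ → ℕ := fun n => Nat.rec 0 (fun n l => max l (hi n l)) n
  have hlo : ∀ n, lo (n + 1) = max (lo n) (hi n (lo n)) := fun n => rfl
  set h : ℕ → E d → ℂ := fun n => g n (lo n) with hh
  set up : ℕ → ℕ := fun n => max (lo n) (hi n (lo n)) with hup
  have hw : ∀ n, lo n ≤ up n := fun n => le_max_left _ _
  have hw' : ∀ n, up n ≤ lo (n + 1) := fun n => (hlo n).ge
  have hB : ∀ n, IsBlock u v (lo n) (up n) ((1 / 2) ^ n) (h n) := fun n =>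
    ⟨(hb n _).continuous, fun y => ((hb n _).bound y).trans (hele n),
      fun i x hne => ⟨((hb n _).left i x hne).1, ((hb n _).left i x hne).2.trans (le_max_right _ _)⟩,
      fun i x hne => ⟨((hb n _).right i x hne).1,
        ((hb n _).right i x hne).2.trans (le_max_right _ _)⟩⟩
  have hsum : Summable fun n : ℕ => (1 / 2 : ℝ) ^ n :=
    summable_geometric_of_lt_one (by norm_num) (by norm_num)
  set F : E d → ℂ := fun y => ∑' n, h n y with hF
  have hFc : Continuous F := continuous_tsum (fun n => (hB n).continuous) hsum fun n y =>
    (hB n).bound y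
  have hFb : ∀ y, ‖F y‖ ≤ ∑' n : ℕ, (1 / 2 : ℝ) ^ n := fun y =>
    tsum_of_norm_bounded hsum.hasSum fun n => (hB n).bound y
  have hcv : ∀ w x, cv F w x = ∑' n, cv (h n) w x := by
    intro w x
    have h1 : ∀ n, ∫ y, ‖h n y * w (x - y)‖ ≤ (1 / 2) ^ n * ∫ y, ‖w (x - y)‖ := by
      intro n
      rw [← integral_const_mul]
      refine integral_mono_of_nonneg (Filter.Eventually.of_forall fun y => norm_nonneg _)
        ((((w.integrable (μ := volume)).comp_sub_left x).norm).const_mul _)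
        (Filter.Eventually.of_forall fun y => ?_)
      beta_reduce
      rw [norm_mul]
      gcongr
      exact (hB n).bound y
    have h2 := hasSum_integral_of_summable_integral_norm
      (fun n => integrable_cv (hB n).continuous (hB n).bound w x)
      (Summable.of_nonneg_of_le (fun n => integral_nonneg fun y => norm_nonneg _) h1
        (hsum.mul_right _))
    rw [cv]
    simp only [hF, ← tsum_mul_right]
    exact h2.tsum_eq.symm
  refine ⟨F, _, hFc, hFb, ?_, ?_⟩
  · have hpt : ∀ x, ∀ i, ∃ n, ‖cv F (u i) x‖ₑ ≤ ‖cv (h n) (u i) x‖ₑ := by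
      intro x i
      by_cases hex : ∃ n, cv (h n) (u i) x ≠ 0
      · obtain ⟨n, hn⟩ := hex
        refine ⟨n, le_of_eq ?_⟩
        rw [hcv, tsum_eq_single n]
        intro n' hn'
        by_contra hne
        exact hn' (eq_of_mem_windows hw hw' ((hB n').left i x hne) ((hB n).left i x hn))
      · push Not at hex
        exact ⟨0, by rw [hcv]; simp [hex]⟩
    have hmeas : ∀ n, Measurable fun x => ellNorm q fun i => ‖cv (h n) (u i) x‖ₑ := fun n =>
      measurable_ellNorm q fun i =>
        (continuous_cv (hB n).continuous (hB n).bound (u i)).measurable.enorm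
    calc mixedPow q p (fun i => cv F (u i))
        ≤ ∫⁻ x, ∑' n, (((2 : ℝ≥0∞) ^ (n + 1)) ^ (1 / q.toReal) *
            ellNorm q fun i => ‖cv (h n) (u i) x‖ₑ) ^ p :=
          lintegral_mono fun x => ellNorm_rpow_le_tsum hq hp (hpt x)
      _ = ∑' n, ∫⁻ x, (((2 : ℝ≥0∞) ^ (n + 1)) ^ (1 / q.toReal) *
            ellNorm q fun i => ‖cv (h n) (u i) x‖ₑ) ^ p :=
          lintegral_tsum fun n => (((hmeas n).const_mul _).pow_const p).aemeasurable
      _ ≤ ∑' n : ℕ, ENNReal.ofReal ((1 / 2) ^ n) := by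
          refine ENNReal.tsum_le_tsum fun n => ?_
          simp_rw [ENNReal.mul_rpow_of_nonneg _ _ hp.le]
          rw [lintegral_const_mul _ ((hmeas n).pow_const p)]
          refine (mul_le_mul_right (hsmall n (lo n)) _).trans (le_of_eq ?_)
          have h2 : (((2 : ℝ≥0∞) ^ (n + 1)) ^ (1 / q.toReal)) ^ p = ENNReal.ofReal (κ n) := by
            have := natCast_rpow_rpow (2 ^ (n + 1)) hs0 hp.le
            push_cast at this
            exact this
          rw [h2, ← ENNReal.ofReal_mul (by positivity), he]
          congr 1
          have := (one_pos.trans_le (hκ1 n)).ne'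
          field_simp
      _ < ∞ := by
          rw [← ENNReal.ofReal_tsum_of_nonneg (fun n => by positivity) hsum]
          exact ENNReal.ofReal_lt_top
  · refine ENNReal.eq_top_of_forall_nnreal_le fun r => ?_
    obtain ⟨n, hn⟩ := pow_unbounded_of_one_lt (r : ℝ) (one_lt_two)
    have h1 : (r : ℝ≥0∞) ≤ ENNReal.ofReal (1 / e n) := by
      rw [← ENNReal.ofReal_coe_nnreal]
      refine ENNReal.ofReal_le_ofReal (hn.le.trans ?_)
      rw [le_one_div (by positivity) (he0 n)]
      refine (hele n).trans (le_of_eq ?_)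
      rw [one_div_pow]
    refine h1.trans ((hlarge n (lo n)).trans ?_)
    refine lintegral_mono fun x => ENNReal.rpow_le_rpow (ellNorm_mono q fun i => ?_) hp.le
    by_cases hn0 : cv (h n) (v i) x = 0
    · change ‖cv (h n) (v i) x‖ₑ ≤ _
      simp [hn0]
    · change ‖cv (h n) (v i) x‖ₑ ≤ ‖cv F (v i) x‖ₑ
      refine le_of_eq ?_
      rw [hcv, tsum_eq_single n]
      intro n' hn'
      by_contra hne
      exact hn' (eq_of_mem_windows hw hw' ((hB n').right i x hne) ((hB n).right i x hn0))

theorem HasHumps.tlSpace_ne {d : ℕ} {A B : GL (Fin d) ℝ} {φ Φ ψ Ψ : 𝓢(E d, ℂ)} {q : ℝ≥0∞}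
    (hq : 0 < q) {p : ℝ} (hp : 0 < p) (H : HasHumps q p (dilates A φ Φ) (dilates B ψ Ψ)) :
    tlSpace A φ Φ 0 p q ≠ tlSpace B ψ Ψ 0 p q := by
  intro heq
  obtain ⟨F, R, hc, hR, h1, h2⟩ := H.exists_function hq hp
  obtain ⟨f, hf⟩ := exists_distribution hc hR
  have hmem := (mem_tlSpace_iff (A := A) (φ := φ) (Φ := Φ) (q := q) hp hf).2 h1
  rw [heq, mem_tlSpace_iff hp hf, h2] at hmem
  exact lt_irrefl _ hmem

/-! ### Conclusion -/

/-- The two sides grow like `N ^ (1 / 2)` and `N ^ (1 / q)`, and the sign of `1 / q - 1 / 2` decides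
which is the small one. The value `q = ∞` has exponent `0` and belongs with `q > 2`. -/
theorem hasHumps_or {d : ℕ} (hd : 0 < d) {u v : ℕ → 𝓢(E d, ℂ)} {c c' M M' : ℝ} {m : ℕ}
    (hc : 0 < c) (hc' : 0 < c') (hM : ∀ i ξ, ‖(𝓕 (u i) : 𝓢(E d, ℂ)) ξ‖ ≤ M)
    (hM' : ∀ i ξ, ‖(𝓕 (v i) : 𝓢(E d, ℂ)) ξ‖ ≤ M')
    (hsep : ∀ lo N : ℕ, 0 < N →
      ∃ ξ r i₁ j I J, SeparatedFrequencies u v m c c' lo N ξ r i₁ j I J)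
    {p : ℝ} (hp : 0 < p) {q : ℝ≥0∞} (hq : 0 < q) (hq2 : q ≠ 2) :
    HasHumps q p u v ∨ HasHumps q p v u := by
  have hne : 1 / q.toReal ≠ 1 / 2 := by
    intro h
    rw [one_div, one_div, inv_inj] at h
    apply hq2
    have hqt : q ≠ ∞ := by rintro rfl; simp at h
    rw [← ENNReal.ofReal_toReal hqt, h]
    simp
  simp only [HasHumps]
  rcases lt_or_gt_of_ne hne with hlt | hgt
  · right
    obtain ⟨K₁, K₂, hK₁, hK₂, hblk⟩ := exists_blocks_right_small hd hc hc' hM hM' hsep hp hq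
    intro ε lo hε
    obtain ⟨N, X, hN, hX, h1, h2⟩ := exists_parameters hlt hp hK₁ hK₂ hε
    obtain ⟨h, hi, hb, hs, hl⟩ := hblk N X ε lo hN hX hε
    rw [Real.sqrt_eq_rpow] at hl
    exact ⟨h, hi, hb.symm, hs.trans (ENNReal.ofReal_le_ofReal h1),
      (ENNReal.ofReal_le_ofReal h2).trans hl⟩
  · left
    obtain ⟨K₁, K₂, hK₁, hK₂, hblk⟩ := exists_blocks_left_small hd hc hc' hM hM' hsep hp hq
    intro ε lo hε
    obtain ⟨N, X, hN, hX, h1, h2⟩ := exists_parameters hgt hp hK₁ hK₂ hε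
    obtain ⟨h, hi, hb, hs, hl⟩ := hblk N X ε lo hN hX hε
    rw [Real.sqrt_eq_rpow] at hs
    exact ⟨h, hi, hb, hs.trans (ENNReal.ofReal_le_ofReal h1),
      (ENNReal.ofReal_le_ofReal h2).trans hl⟩

theorem tlSpace_ne_of_not_narrow {d : ℕ} (hd : 1 < d) {A B : GL (Fin d) ℝ}
    {φ Φ ψ Ψ : 𝓢(E d, ℂ)} (hφ : IsAnalyzingPair A φ Φ) (hψ : IsAnalyzingPair B ψ Ψ)
    {ν μ : Seminorm ℝ (E d)} {θ η : ℝ} (hν : IsAdapted (actEquiv (transposeGL A)) ν θ)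
    (hμ : IsAdapted (actEquiv (transposeGL B)) μ η)
    (hn : ∀ N, ¬ Narrow (actEquiv (transposeGL A)) (actEquiv (transposeGL B)) ν μ N)
    {p : ℝ} (hp : 0 < p) {q : ℝ≥0∞} (hq : 0 < q) (hq2 : q ≠ 2) :
    tlSpace A φ Φ 0 p q ≠ tlSpace B ψ Ψ 0 p q := by
  have hrank : 1 < Module.rank ℝ (E d) := by
    rw [← Module.finrank_eq_rank, finrank_euclideanSpace_fin]
    exact_mod_cast hd
  obtain ⟨m, c, M, hu⟩ := hφ.exists_isScaleFamily hν
  obtain ⟨m', c', M', hv⟩ := hψ.exists_isScaleFamily hμ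
  rcases hasHumps_or (by omega) hu.pos hv.pos hu.bounded hv.bounded
    (fun lo N hN => exists_separatedFrequencies hrank hν hμ hu hv hn lo hN) hp hq hq2 with H | H
  · exact H.tlSpace_ne hq hp
  · exact (H.tlSpace_ne hq hp).symm

/-- Equality of the spaces is symmetric in the two matrices, so it yields narrowness in both
directions. -/
theorem coarselyEquivalent_of_tlSpace_eq {d : ℕ} {A B : GL (Fin d) ℝ}
    (hA : IsExpansive (A : Matrix (Fin d) (Fin d) ℝ))
    (hB : IsExpansive (B : Matrix (Fin d) (Fin d) ℝ))
    {φ Φ ψ Ψ : 𝓢(E d, ℂ)} (hφ : IsAnalyzingPair A φ Φ) (hψ : IsAnalyzingPair B ψ Ψ)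
    {p : ℝ} (hp : 0 < p) {q : ℝ≥0∞} (hq : 0 < q) (hq2 : q ≠ 2)
    (heq : tlSpace A φ Φ 0 p q = tlSpace B ψ Ψ 0 p q) :
    CoarselyEquivalent (A : Matrix (Fin d) (Fin d) ℝ).transpose
      (B : Matrix (Fin d) (Fin d) ℝ).transpose := by
  rcases le_or_gt d 1 with hd | hd
  · exact coarselyEquivalent_of_le_one hd _ _
  have : Nonempty (Fin d) := ⟨⟨0, by omega⟩⟩
  obtain ⟨ν, θ, hν⟩ := exists_isAdapted (transposeGL A) (isExpansive_transpose hA)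
  obtain ⟨μ, η, hμ⟩ := exists_isAdapted (transposeGL B) (isExpansive_transpose hB)
  rw [← coe_transposeGL, ← coe_transposeGL]
  refine coarselyEquivalent_of_narrow hν hμ ?_ ?_
  · by_contra! hn
    exact tlSpace_ne_of_not_narrow hd hφ hψ hν hμ hn hp hq hq2 heq
  · by_contra! hn
    exact tlSpace_ne_of_not_narrow hd hψ hφ hμ hν hn hp hq hq2 heq.symm

end AnisoTL

end

theorem theorem5p6 {d : ℕ} (A B : GL (Fin d) ℝ)
    (hA : AnisoTL.IsExpansive (A : Matrix (Fin d) (Fin d) ℝ))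
    (hB : AnisoTL.IsExpansive (B : Matrix (Fin d) (Fin d) ℝ))
    (φ Φ ψ Ψ : 𝓢(AnisoTL.E d, ℂ))
    (hφ : AnisoTL.IsAnalyzingPair A φ Φ) (hψ : AnisoTL.IsAnalyzingPair B ψ Ψ)
    (p : ℝ) (hp : 0 < p) :
    (∀ q : ℝ≥0∞, 0 < q →
      AnisoTL.tlSpace A φ Φ 0 p q = AnisoTL.tlSpace B ψ Ψ 0 p q →
      ¬ AnisoTL.CoarselyEquivalent (A : Matrix (Fin d) (Fin d) ℝ).transpose
        (B : Matrix (Fin d) (Fin d) ℝ).transpose →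
      q = 2) ∧
    ((∃ q : ℝ≥0∞, 0 < q ∧ q ≠ 2 ∧
        AnisoTL.tlSpace A φ Φ 0 p q = AnisoTL.tlSpace B ψ Ψ 0 p q) →
      AnisoTL.CoarselyEquivalent (A : Matrix (Fin d) (Fin d) ℝ).transpose
        (B : Matrix (Fin d) (Fin d) ℝ).transpose) := by
  refine ⟨fun q hq heq hne => ?_, fun ⟨q, hq, hq2, heq⟩ =>
    AnisoTL.coarselyEquivalent_of_tlSpace_eq hA hB hφ hψ hp hq hq2 heq⟩
  by_contra hq2
  exact hne (AnisoTL.coarselyEquivalent_of_tlSpace_eq hA hB hφ hψ hp hq hq2 heq)
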